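/- Let $q = x+iy$ and $z$ be complex variables with $z+\bar z>0$; bars denote complex conjugation, subscripts denote partial derivatives, and all unknowns $\psi(q,\bar q,z,\bar z)$ are real-valued and smooth. Consider the Legendre-transformed hyperbolic complex Monge–Ampère equation $$\psi_{q\bar q}\psi_{z\bar z}-\psi_{q\bar z}\psi_{\bar q z}=e^{\psi_q+\psi_{\bar q}}\left(\psi_{q\bar q}^2-\psi_{qq}\psi_{\bar q\bar q}\right)\qquad(\mathrm{H})$$ and the hyperbolic Boyer–Finley equation, in which $y$ is a parameter, $$\psi_{z\bar z}=e^{\psi_x}\psi_{xx}.\qquad(\mathrm{BF})$$ Consider functions of the form $$\psi=[x+b(z,y)]\ln[x+b(z,y)]+[x+\bar b(\bar z,y)]\ln[x+\bar b(\bar z,y)]-2x[\ln(z+\bar z)+1]+F(z,\bar z,y)\qquad(\mathrm{A})$$ with $b$ smooth and holomorphic in $z$, $F$ smooth and real, and any continuous branch of $\ln[x+b]$, on an open set of points $(q,z)$ that projects onto $I\times\Omega$, where $y\in I$, an open interval, and $z\in\Omega$, a connected open subset of the half-plane $z+\bar z>0$. A function (A) that solves (BF) is called noninvariant if $v=\psi_x$,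 which solves $v_{z\bar z}=(e^v)_{xx}$, is invariant under no nonzero generator $(\alpha+cx)\partial_x+a(z)\partial_z+\bar a(\bar z)\partial_{\bar z}+(2c-a'(z)-\bar a'(\bar z))\partial_v$ of the point symmetries of that equation ($\alpha,c$ real constants, $a$ holomorphic). Put $$\Psi=[q+b(z)]\ln[q+b(z)]+[\bar q+\bar b(\bar z)]\ln[\bar q+\bar b(\bar z)]-(q+\bar q)[\ln(z+\bar z)+1]+\iint\frac{b(z)+\bar b(\bar z)}{(z+\bar z)^2}\,dz\,d\bar z$$ and consider the three families $$(1)\ \psi=\Psi+r(y),\qquad(2)\ \psi=\Psi+2iy\ln\frac{\bar z}{z}+r(y),\qquad(3)\ \psi=\Psi+2i\int\ln\frac{\bar z+2ik(y)}{z-2ik(y)}\,dy+r(y),$$ where $b(z)$ is an arbitrary holomorphic function, $r(y)$ and $k(y)$ are arbitrary smooth real-valued functions, and the double integral denotes any real function $G(z,\bar z)$ with $G_{z\bar z}=(b+\bar b)/(z+\bar z)^2$. Theorem. (i) Every function of the families (1)–(3) is of the form (A) and solves both (BF) and (H). (ii) Conversely, let $\psi$ be a noninvariant solution of (BF) of the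 form (A) that also solves (H). Then every $y_0\in I$ has an open interval $J\subseteq I$ around it such that the restriction of $\psi$ to $y\in J$ is taken by a point symmetry transformation of (H) (a local diffeomorphism of the space of the variables $(q,z,\psi)$ which, like its inverse, takes solutions of (H) to solutions) to a function of one of the families (1)–(3). Thus, up to symmetry transformations of (H), the three families are a complete list. -/

import Mathlib

open scoped ComplexConjugate ContDiff Topology

noncomputable section

namespace BFLift

/-! Points of the independent-variable space are pairs `(q, z)` of complex numbers, with
`x = re q` and `y = im q`.  Unknowns are real valued functions of `(q, z)`. -/

/-- A real valued function, regarded as a complex valued one. -/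
def toC (ψ : ℂ × ℂ → ℝ) : ℂ × ℂ → ℂ := fun p => (ψ p : ℂ)

/-- The Wirtinger derivative `∂/∂q`. -/
def dq (f : ℂ × ℂ → ℂ) (p : ℂ × ℂ) : ℂ :=
  (fderiv ℝ f p (1, 0) - Complex.I * fderiv ℝ f p (Complex.I, 0)) / 2

/-- The Wirtinger derivative `∂/∂q̄`. -/
def dqbar (f : ℂ × ℂ → ℂ) (p : ℂ × ℂ) : ℂ :=
  (fderiv ℝ f p (1, 0) + Complex.I * fderiv ℝ f p (Complex.I, 0)) / 2

/-- The Wirtinger derivative `∂/∂z`. -/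
def dz (f : ℂ × ℂ → ℂ) (p : ℂ × ℂ) : ℂ :=
  (fderiv ℝ f p (0, 1) - Complex.I * fderiv ℝ f p (0, Complex.I)) / 2

/-- The Wirtinger derivative `∂/∂z̄`. -/
def dzbar (f : ℂ × ℂ → ℂ) (p : ℂ × ℂ) : ℂ :=
  (fderiv ℝ f p (0, 1) + Complex.I * fderiv ℝ f p (0, Complex.I)) / 2

/-- The derivative with respect to `x = re q` (at fixed `y = im q` and fixed `z`). -/
def dx (f : ℂ × ℂ → ℂ) (p : ℂ × ℂ) : ℂ := fderiv ℝ f p (1, 0)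

/-- The Wirtinger derivative `∂/∂z` of a function of `z` alone. -/
def wz (f : ℂ → ℂ) (z : ℂ) : ℂ :=
  (fderiv ℝ f z 1 - Complex.I * fderiv ℝ f z Complex.I) / 2

/-- The Wirtinger derivative `∂/∂z̄` of a function of `z` alone. -/
def wzbar (f : ℂ → ℂ) (z : ℂ) : ℂ :=
  (fderiv ℝ f z 1 + Complex.I * fderiv ℝ f z Complex.I) / 2

/-- `ψ` is a smooth solution, on the open set `D`, of the Legendre transformed hyperbolic complex
Monge–Ampère equation
`ψ_{q q̄} ψ_{z z̄} - ψ_{q z̄} ψ_{q̄ z} = e^{ψ_q + ψ_q̄} (ψ_{q q̄}² - ψ_{q q} ψ_{q̄ q̄})`. -/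
def IsHCMASolution (ψ : ℂ × ℂ → ℝ) (D : Set (ℂ × ℂ)) : Prop :=
  IsOpen D ∧ ContDiffOn ℝ ∞ ψ D ∧ ∀ p ∈ D,
    dq (dqbar (toC ψ)) p * dz (dzbar (toC ψ)) p - dq (dzbar (toC ψ)) p * dqbar (dz (toC ψ)) p
      = Complex.exp (dq (toC ψ) p + dqbar (toC ψ) p)
        * (dq (dqbar (toC ψ)) p ^ 2 - dq (dq (toC ψ)) p * dqbar (dqbar (toC ψ)) p)

/-- `ψ` is a smooth solution, on the open set `D`, of the hyperbolic Boyer–Finley equation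
`ψ_{z z̄} = e^{ψ_x} ψ_{x x}`, in which `y` is a parameter. -/
def IsBFSolution (ψ : ℂ × ℂ → ℝ) (D : Set (ℂ × ℂ)) : Prop :=
  IsOpen D ∧ ContDiffOn ℝ ∞ ψ D ∧ ∀ p ∈ D,
    dz (dzbar (toC ψ)) p = Complex.exp (dx (toC ψ) p) * dx (dx (toC ψ)) p

/-- `D` is an open set of points `(q, z)` whose projection `(q, z) ↦ (im q, z)` is exactly
`I × Ω`, where `I` is an open interval and `Ω` is a connected open subset of the half plane
`z + z̄ > 0`. -/
structure IsDomainOver (D : Set (ℂ × ℂ)) (I : Set ℝ) (Ω : Set ℂ) : Prop where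
  isOpen : IsOpen D
  isOpen_I : IsOpen I
  ordConnected_I : I.OrdConnected
  isOpen_Ω : IsOpen Ω
  isPreconnected_Ω : IsPreconnected Ω
  re_pos : ∀ z ∈ Ω, 0 < z.re
  proj_mem : ∀ p ∈ D, p.1.im ∈ I ∧ p.2 ∈ Ω
  exists_mem : ∀ y ∈ I, ∀ z ∈ Ω, ∃ x : ℝ, ((⟨x, y⟩ : ℂ), z) ∈ D

/-- On the domain `D` over `I × Ω`, `ψ` has the form
`ψ = [x + b(z,y)] ln[x + b(z,y)] + [x + b̄(z̄,y)] ln[x + b̄(z̄,y)] - 2x [ln(z + z̄) + 1] + F(z,z̄,y)`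
with `b` smooth in `(z, y)` and holomorphic in `z`, with `F` smooth and real, and with `L` a
continuous branch of `ln[x + b(z,y)]`. -/
structure IsAnsatz (D : Set (ℂ × ℂ)) (I : Set ℝ) (Ω : Set ℂ) (b : ℂ → ℝ → ℂ) (F : ℂ → ℝ → ℝ)
    (L : ℂ × ℂ → ℂ) (ψ : ℂ × ℂ → ℝ) : Prop where
  domain : IsDomainOver D I Ω
  holomorphic_b : ∀ y ∈ I, DifferentiableOn ℂ (fun z => b z y) Ω
  smooth_b : ContDiffOn ℝ ∞ (fun s : ℂ × ℝ => b s.1 s.2) (Ω ×ˢ I)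
  smooth_F : ContDiffOn ℝ ∞ (fun s : ℂ × ℝ => F s.1 s.2) (Ω ×ˢ I)
  continuous_L : ContinuousOn L D
  exp_L : ∀ p ∈ D, Complex.exp (L p) = (p.1.re : ℂ) + b p.2 p.1.im
  eq : ∀ p ∈ D, (ψ p : ℂ) =
    ((p.1.re : ℂ) + b p.2 p.1.im) * L p + ((p.1.re : ℂ) + conj (b p.2 p.1.im)) * conj (L p)
      - 2 * (p.1.re : ℂ) * (Complex.log (p.2 + conj p.2) + 1) + (F p.2 p.1.im : ℂ)

/-- The function `v = ψ_x` is a noninvariant solution of the Boyer–Finley equation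
`v_{z z̄} = (e^v)_{x x}`: on `D` it is invariant under no nonzero generator
`(α + c x) ∂_x + a(z) ∂_z + ā(z̄) ∂_z̄ + (2c - a'(z) - ā'(z̄)) ∂_v`
(`α`, `c` real, `a` holomorphic on `Ω`) of its Lie algebra of point symmetries.  The variable `y` is
a parameter, which the generator does not involve. -/
def IsNoninvariant (ψ : ℂ × ℂ → ℝ) (D : Set (ℂ × ℂ)) (Ω : Set ℂ) : Prop :=
  ∀ (α c : ℝ) (a : ℂ → ℂ), DifferentiableOn ℂ a Ω →
    (∀ p ∈ D,
      ((α : ℂ) + (c : ℂ) * (p.1.re : ℂ)) * dx (dx (toC ψ)) p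
        + a p.2 * dz (dx (toC ψ)) p + conj (a p.2) * dzbar (dx (toC ψ)) p
      = 2 * (c : ℂ) - deriv a p.2 - conj (deriv a p.2)) →
    α = 0 ∧ c = 0 ∧ ∀ z ∈ Ω, a z = 0

/-- `G` is a real function `∫∫ (b(z) + b̄(z̄)) / (z + z̄)² dz dz̄` on `Ω`. -/
def IsDoubleIntegral (b : ℂ → ℂ) (G : ℂ → ℝ) (Ω : Set ℂ) : Prop :=
  ContDiffOn ℝ ∞ G Ω ∧
    ∀ z ∈ Ω, wz (wzbar (fun w => (G w : ℂ))) z = (b z + conj (b z)) / (z + conj z) ^ 2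

/-- The first listed function; here `L` stands for `ln[q + b(z)]` and `G` for the double
integral. -/
def sol1 (b : ℂ → ℂ) (L : ℂ × ℂ → ℂ) (G : ℂ → ℝ) (r : ℝ → ℝ) (p : ℂ × ℂ) : ℂ :=
  (p.1 + b p.2) * L p + (conj p.1 + conj (b p.2)) * conj (L p)
    - (p.1 + conj p.1) * (Complex.log (p.2 + conj p.2) + 1) + (G p.2 : ℂ) + (r p.1.im : ℂ)

/-- The second listed function. -/
def sol2 (b : ℂ → ℂ) (L : ℂ × ℂ → ℂ) (G : ℂ → ℝ) (r : ℝ → ℝ) (p : ℂ × ℂ) : ℂ :=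
  (p.1 + b p.2) * L p + (conj p.1 + conj (b p.2)) * conj (L p)
    - (p.1 + conj p.1) * (Complex.log (p.2 + conj p.2) + 1) + (G p.2 : ℂ)
    + 2 * Complex.I * (p.1.im : ℂ) * Complex.log (conj p.2 / p.2) + (r p.1.im : ℂ)

/-- The third listed function; the integral with respect to `y` starts at `y₁`. -/
def sol3 (b : ℂ → ℂ) (L : ℂ × ℂ → ℂ) (G : ℂ → ℝ) (k : ℝ → ℝ) (y₁ : ℝ) (r : ℝ → ℝ)
    (p : ℂ × ℂ) : ℂ :=
  (p.1 + b p.2) * L p + (conj p.1 + conj (b p.2)) * conj (L p)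
    - (p.1 + conj p.1) * (Complex.log (p.2 + conj p.2) + 1) + (G p.2 : ℂ)
    + 2 * Complex.I * (∫ t in y₁..p.1.im,
        Complex.log ((conj p.2 + 2 * Complex.I * (k t : ℂ)) / (p.2 - 2 * Complex.I * (k t : ℂ))))
    + (r p.1.im : ℂ)

/-- On the domain `D`, `ψ` is one of the listed functions, with `b` holomorphic, and with `r` and `k`
smooth and real. -/
def IsListed (D : Set (ℂ × ℂ)) (ψ : ℂ × ℂ → ℝ) : Prop :=
  ∃ (I : Set ℝ) (Ω : Set ℂ) (b : ℂ → ℂ) (L : ℂ × ℂ → ℂ) (G : ℂ → ℝ) (r : ℝ → ℝ),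
    IsDomainOver D I Ω ∧ DifferentiableOn ℂ b Ω ∧
    ContinuousOn L D ∧ (∀ p ∈ D, Complex.exp (L p) = p.1 + b p.2) ∧
    IsDoubleIntegral b G Ω ∧ ContDiffOn ℝ ∞ r I ∧
    ((∀ p ∈ D, (ψ p : ℂ) = sol1 b L G r p) ∨
     (∀ p ∈ D, (ψ p : ℂ) = sol2 b L G r p) ∨
     (∃ (k : ℝ → ℝ) (y₁ : ℝ), ContDiffOn ℝ ∞ k I ∧ y₁ ∈ I ∧
        ∀ p ∈ D, (ψ p : ℂ) = sol3 b L G k y₁ r p))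

/-- The graph over `D` of the function `ψ`, in the space of the variables `(q, z, ψ)`. -/
def graphOver (ψ : ℂ × ℂ → ℝ) (D : Set (ℂ × ℂ)) : Set (ℂ × ℂ × ℝ) :=
  (fun p : ℂ × ℂ => (p.1, p.2, ψ p)) '' D

/-- The local transformation `Φ` takes the function `ψ` on `D` to the function `ψ'` on `D'`. -/
def Transforms (Φ : OpenPartialHomeomorph (ℂ × ℂ × ℝ) (ℂ × ℂ × ℝ))
    (ψ : ℂ × ℂ → ℝ) (D : Set (ℂ × ℂ)) (ψ' : ℂ × ℂ → ℝ) (D' : Set (ℂ × ℂ)) : Prop :=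
  graphOver ψ D ⊆ Φ.source ∧ Φ '' graphOver ψ D = graphOver ψ' D'

/-- `Φ` is a (local) point symmetry transformation of the Legendre transformed hyperbolic complex
Monge–Ampère equation: a local diffeomorphism of the space of the variables `(q, z, ψ)` such that it
and its inverse take solutions to solutions. -/
def IsHCMASymmetry (Φ : OpenPartialHomeomorph (ℂ × ℂ × ℝ) (ℂ × ℂ × ℝ)) : Prop :=
  ContDiffOn ℝ ∞ Φ Φ.source ∧ ContDiffOn ℝ ∞ Φ.symm Φ.target ∧
  ∀ (ψ ψ' : ℂ × ℂ → ℝ) (D D' : Set (ℂ × ℂ)), IsOpen D → IsOpen D' →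
    ContDiffOn ℝ ∞ ψ D → ContDiffOn ℝ ∞ ψ' D' → Transforms Φ ψ D ψ' D' →
    (IsHCMASolution ψ D ↔ IsHCMASolution ψ' D')

end BFLift

end

/-! Write `B = x + b` and `θ = z + z̄`. For a function of the given form `ψ_x = ln|B|² - 2 ln θ`,
hence `e^{ψ_x} = |B|²/θ²` and `ψ_xx = 1/B + 1/B̄`, and (BF) reduces to `F_{zz̄} = (b + b̄)/θ²`.
Modulo (BF) the derivative `ψ_yy` cancels from (H), which becomes `θ² |B (ψ_xz + iψ_yz)|² = | |B|²
(ψ_xx + iψ_xy) |²` (`IsAnsatz.boyerFinley_iff`, `IsAnsatz.mongeAmpere_iff`).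

Listed functions. There `b = b(z) + iy`, so `B = q + b(z)` and `1 + i b_y = 0`. With `φ = F_yz` the
second equation collapses to `|iθφ - 2| = 2`, that is `θ|φ|² = 4 Re(iφ)`. This holds for `φ = 0`
(first family) and for `φ = -2i/(z - 2ik(y))` (third family; the second has `k = 0`).

Converse. Fix `(z, y)` and read the equation as an identity in `x`. Continued analytically to
infinity it cannot contain a logarithm, so `b_yz = 0` (`log_coeff_eq_zero`). What remains is an
identity of quadratic polynomials in `x`. Its leading coefficient gives an equation for `F_yz`, and
the other two determine `b_z` in terms of `Im b` up to a choice of sign (`coeff_relations`). With `g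
= Re b_y`, the function `F_yz + 2g/θ` is holomorphic in `z`, and the leading relation leaves only
zero or `2(g - i)/(z + iκ)` with `κ` real (`eq_zero_or_eq_div`).

If `b_y ≠ i` at some point, the remaining relations read `(S + S̄) b_z = e (b - b̄) S'` for a
holomorphic coordinate `S` and a constant `e`. Differentiation in `z` and `z̄` forces `b_z = iν S'`
with `ν` real (`imaginary_const_of_relation`). Then `ψ_x` is invariant under `ν∂_x + a∂_z + ā∂_z̄`,
where `a = i/S'` generates an isometry of the half plane. Noninvariance excludes this, so `b = β(z)
+ iy` (`IsAnsatz.dy_b_eq_I`).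

Now for each `y` either `F_yz(·, y) = 0` or `F_yz = -2i/(z + iκ)`. Where `F_yz` is nonzero at `y₀`,
the parameter `κ` is smooth near `y₀` and integration gives the third family. Where it vanishes, `κ`
is morally infinite and may run through infinity near `y₀`. The symmetry `z ↦ 1/z` of (H), suitably
extended to `ψ`, acts by `κ ↦ -1/κ` and moves this value to `κ = 0`, so the image belongs to the
third family (`IsNormalForm.invert`, `IsNormalForm.exists_symmetry`). In the converse the identity
and this inversion are thus the only symmetries needed, and the third family the only target. -/

noncomputable section

namespace BFLift

/-! ### Wirtinger calculus in the frame `x`, `y`, `z`, `z̄` -/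

/-- The derivative with respect to `y = im q`. -/
def dy (f : ℂ × ℂ → ℂ) (p : ℂ × ℂ) : ℂ := fderiv ℝ f p (Complex.I, 0)

/-- The real linear form `a dx + b dy + c dz + d dz̄`. -/
def frameForm (a b c d : ℂ) : ℂ × ℂ →L[ℝ] ℂ :=
  a • (Complex.ofRealCLM ∘L Complex.reCLM ∘L ContinuousLinearMap.fst ℝ ℂ ℂ)
    + b • (Complex.ofRealCLM ∘L Complex.imCLM ∘L ContinuousLinearMap.fst ℝ ℂ ℂ)
    + c • ContinuousLinearMap.snd ℝ ℂ ℂ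
    + d • ((Complex.conjCLE : ℂ →L[ℝ] ℂ) ∘L ContinuousLinearMap.snd ℝ ℂ ℂ)

theorem frameForm_apply (a b c d : ℂ) (v : ℂ × ℂ) :
    frameForm a b c d v = a * v.1.re + b * v.1.im + c * v.2 + d * conj v.2 := by
  simp [frameForm]

/-- `f` is real differentiable at `p`, with derivatives `a`, `b`, `c`, `d` along the frame
`∂/∂x`, `∂/∂y`, `∂/∂z`, `∂/∂z̄`. -/
def HasFrame (f : ℂ × ℂ → ℂ) (p : ℂ × ℂ) (a b c d : ℂ) : Prop :=
  HasFDerivAt f (frameForm a b c d) p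

section Frame

variable {f g : ℂ × ℂ → ℂ} {p : ℂ × ℂ} {a b c d a' b' c' d' : ℂ}

theorem HasFrame.dx_eq (h : HasFrame f p a b c d) : dx f p = a := by
  unfold dx; rw [HasFDerivAt.fderiv h, frameForm_apply]; simp

theorem HasFrame.dy_eq (h : HasFrame f p a b c d) : dy f p = b := by
  unfold dy; rw [HasFDerivAt.fderiv h, frameForm_apply]; simp

theorem HasFrame.dq_eq (h : HasFrame f p a b c d) : dq f p = (a - Complex.I * b) / 2 := by
  unfold dq; rw [HasFDerivAt.fderiv h, frameForm_apply, frameForm_apply]; simp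

theorem HasFrame.dqbar_eq (h : HasFrame f p a b c d) : dqbar f p = (a + Complex.I * b) / 2 := by
  unfold dqbar; rw [HasFDerivAt.fderiv h, frameForm_apply, frameForm_apply]; simp

theorem HasFrame.dz_eq (h : HasFrame f p a b c d) : dz f p = c := by
  unfold dz; rw [HasFDerivAt.fderiv h, frameForm_apply, frameForm_apply]
  simp only [Complex.zero_re, Complex.zero_im, Complex.conj_I, map_one, Complex.ofReal_zero]
  linear_combination (-c / 2 + d / 2) * Complex.I_sq

theorem HasFrame.dzbar_eq (h : HasFrame f p a b c d) : dzbar f p = d := by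
  unfold dzbar; rw [HasFDerivAt.fderiv h, frameForm_apply, frameForm_apply]
  simp only [Complex.zero_re, Complex.zero_im, Complex.conj_I, map_one, Complex.ofReal_zero]
  linear_combination (c / 2 - d / 2) * Complex.I_sq

theorem hasFrame_of_differentiableAt (h : DifferentiableAt ℝ f p) :
    HasFrame f p (dx f p) (dy f p) (dz f p) (dzbar f p) := by
  have e : frameForm (dx f p) (dy f p) (dz f p) (dzbar f p) = fderiv ℝ f p := by
    refine ContinuousLinearMap.ext fun v => ?_
    have hv : v = v.1.re • ((1 : ℂ), (0 : ℂ)) + v.1.im • (Complex.I, (0 : ℂ))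
        + v.2.re • ((0 : ℂ), (1 : ℂ)) + v.2.im • ((0 : ℂ), Complex.I) := by
      ext <;> simp
    have hz : v.2 = v.2.re + v.2.im * Complex.I := (Complex.re_add_im _).symm
    have hz' : conj v.2 = v.2.re - v.2.im * Complex.I := by apply Complex.ext <;> simp
    have hf : fderiv ℝ f p v = v.1.re * fderiv ℝ f p (1, 0) + v.1.im * fderiv ℝ f p (Complex.I, 0)
        + v.2.re * fderiv ℝ f p (0, 1) + v.2.im * fderiv ℝ f p (0, Complex.I) := by
      conv_lhs => rw [hv]
      simp only [map_add, map_smul, Complex.real_smul]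
    have hd : dz f p * v.2 + dzbar f p * conj v.2
        = dz f p * (v.2.re + v.2.im * Complex.I) + dzbar f p * (v.2.re - v.2.im * Complex.I) := by
      rw [hz', ← hz]
    rw [frameForm_apply, hf, add_assoc, hd]
    simp only [dx, dy, dz, dzbar]
    linear_combination (-(v.2.im : ℂ) * fderiv ℝ f p (0, Complex.I)) * Complex.I_sq
  unfold HasFrame
  rw [e]
  exact h.hasFDerivAt

theorem HasFrame.congr_of_eventuallyEq (h : HasFrame f p a b c d) (hg : g =ᶠ[𝓝 p] f) :
    HasFrame g p a b c d := HasFDerivAt.congr_of_eventuallyEq h hg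

theorem HasFrame.congr_coeff (h : HasFrame f p a b c d) (ha : a = a') (hb : b = b') (hc : c = c')
    (hd : d = d') : HasFrame f p a' b' c' d' := by subst ha hb hc hd; exact h

theorem hasFrame_const (k : ℂ) : HasFrame (fun _ => k) p 0 0 0 0 := by
  have e : frameForm 0 0 0 0 = 0 := by
    ext v <;> simp [frameForm_apply]
  unfold HasFrame; rw [e]; exact hasFDerivAt_const k p

theorem HasFrame.add (hf : HasFrame f p a b c d) (hg : HasFrame g p a' b' c' d') :
    HasFrame (fun s => f s + g s) p (a + a') (b + b') (c + c') (d + d') := by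
  refine (HasFDerivAt.add hf hg).congr_fderiv ?_
  ext v <;> simp [frameForm_apply] <;> ring

theorem HasFrame.sub (hf : HasFrame f p a b c d) (hg : HasFrame g p a' b' c' d') :
    HasFrame (fun s => f s - g s) p (a - a') (b - b') (c - c') (d - d') := by
  refine (HasFDerivAt.sub hf hg).congr_fderiv ?_
  ext v <;> simp [frameForm_apply] <;> ring

theorem HasFrame.mul (hf : HasFrame f p a b c d) (hg : HasFrame g p a' b' c' d') :
    HasFrame (fun s => f s * g s) p (a * g p + f p * a') (b * g p + f p * b')
      (c * g p + f p * c') (d * g p + f p * d') := by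
  refine (HasFDerivAt.mul hf hg).congr_fderiv ?_
  ext v <;> simp [frameForm_apply] <;> ring

theorem HasFrame.const_mul (k : ℂ) (hf : HasFrame f p a b c d) :
    HasFrame (fun s => k * f s) p (k * a) (k * b) (k * c) (k * d) :=
  ((hasFrame_const k).mul hf).congr_coeff (by ring) (by ring) (by ring) (by ring)

theorem HasFrame.conj (hf : HasFrame f p a b c d) :
    HasFrame (fun s => conj (f s)) p (conj a) (conj b) (conj d) (conj c) := by
  have := (Complex.conjCLE : ℂ →L[ℝ] ℂ).hasFDerivAt.comp p hf
  refine HasFDerivAt.congr_fderiv this ?_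
  ext v <;> simp [frameForm_apply]
  ring

theorem HasFrame.comp_holomorphic {h : ℂ → ℂ} {h' : ℂ} (hh : HasDerivAt h h' (f p))
    (hf : HasFrame f p a b c d) :
    HasFrame (fun s => h (f s)) p (h' * a) (h' * b) (h' * c) (h' * d) := by
  have := (hh.hasFDerivAt.restrictScalars ℝ).comp p hf
  refine HasFDerivAt.congr_fderiv this ?_
  ext v <;> simp [frameForm_apply] <;> ring

theorem hasFrame_re : HasFrame (fun s => (s.1.re : ℂ)) p 1 0 0 0 := by
  have := (Complex.ofRealCLM ∘L Complex.reCLM ∘L ContinuousLinearMap.fst ℝ ℂ ℂ).hasFDerivAt (x := p)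
  refine HasFDerivAt.congr_fderiv this ?_
  ext v <;> simp [frameForm_apply]

theorem hasFrame_fst : HasFrame (fun s => s.1) p 1 Complex.I 0 0 := by
  have := (ContinuousLinearMap.fst ℝ ℂ ℂ).hasFDerivAt (x := p)
  refine HasFDerivAt.congr_fderiv this ?_
  ext v <;> simp [frameForm_apply, mul_comm Complex.I]

theorem hasFrame_snd : HasFrame (fun s => s.2) p 0 0 1 0 := by
  have := (ContinuousLinearMap.snd ℝ ℂ ℂ).hasFDerivAt (x := p)
  refine HasFDerivAt.congr_fderiv this ?_
  ext v <;> simp [frameForm_apply]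

/-! ### Iterated derivatives of smooth functions -/

section Iterated

variable {S : Set (ℂ × ℂ)}

theorem contDiffOn_fderiv_apply (hS : IsOpen S) (hf : ContDiffOn ℝ ∞ f S) (v : ℂ × ℂ) :
    ContDiffOn ℝ ∞ (fun s => fderiv ℝ f s v) S :=
  (hf.fderiv_of_isOpen hS (by simp)).clm_apply contDiffOn_const

theorem contDiffOn_dx (hS : IsOpen S) (hf : ContDiffOn ℝ ∞ f S) : ContDiffOn ℝ ∞ (dx f) S :=
  contDiffOn_fderiv_apply hS hf _

theorem contDiffOn_dy (hS : IsOpen S) (hf : ContDiffOn ℝ ∞ f S) : ContDiffOn ℝ ∞ (dy f) S :=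
  contDiffOn_fderiv_apply hS hf _

theorem contDiffOn_dz (hS : IsOpen S) (hf : ContDiffOn ℝ ∞ f S) : ContDiffOn ℝ ∞ (dz f) S :=
  ((contDiffOn_fderiv_apply hS hf _).sub
    (contDiffOn_const.mul (contDiffOn_fderiv_apply hS hf _))).div_const _

theorem contDiffOn_dzbar (hS : IsOpen S) (hf : ContDiffOn ℝ ∞ f S) : ContDiffOn ℝ ∞ (dzbar f) S :=
  ((contDiffOn_fderiv_apply hS hf _).add
    (contDiffOn_const.mul (contDiffOn_fderiv_apply hS hf _))).div_const _

theorem hasFrame_of_contDiffOn (hS : IsOpen S) (hf : ContDiffOn ℝ ∞ f S) (hp : p ∈ S) :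
    HasFrame f p (dx f p) (dy f p) (dz f p) (dzbar f p) :=
  hasFrame_of_differentiableAt
    ((hf.contDiffAt (hS.mem_nhds hp)).differentiableAt (by simp))

/-- The derivatives of `f` along `v` and along `w` commute. -/
theorem fderiv_fderiv_apply_comm (hS : IsOpen S) (hf : ContDiffOn ℝ ∞ f S) (hp : p ∈ S)
    (v w : ℂ × ℂ) :
    fderiv ℝ (fun s => fderiv ℝ f s v) p w = fderiv ℝ (fun s => fderiv ℝ f s w) p v := by
  have hd : DifferentiableAt ℝ (fderiv ℝ f) p :=
    ((hf.fderiv_of_isOpen hS (m := ∞) (by simp)).contDiffAt (hS.mem_nhds hp)).differentiableAt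
      (by simp)
  have key (u u' : ℂ × ℂ) :
      fderiv ℝ (fun s => fderiv ℝ f s u) p u' = fderiv ℝ (fderiv ℝ f) p u' u := by
    rw [fderiv_clm_apply hd (differentiableAt_const u)]
    simp
  rw [key, key]
  exact ((hf.contDiffAt (hS.mem_nhds hp)).isSymmSndFDerivAt (by simp; exact WithTop.coe_le_coe.2 le_top)).eq _ _

theorem fderiv_linear_combination (hS : IsOpen S) (hf : ContDiffOn ℝ ∞ f S) (hp : p ∈ S)
    (k : ℂ) (v w u : ℂ × ℂ) :
    fderiv ℝ (fun s => (fderiv ℝ f s v + k * fderiv ℝ f s w) / 2) p u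
      = (fderiv ℝ (fun s => fderiv ℝ f s v) p u
          + k * fderiv ℝ (fun s => fderiv ℝ f s w) p u) / 2 := by
  have h1 (v : ℂ × ℂ) : HasFDerivAt (fun s => fderiv ℝ f s v)
      (fderiv ℝ (fun s => fderiv ℝ f s v) p) p :=
    (((contDiffOn_fderiv_apply hS hf v).contDiffAt (hS.mem_nhds hp)).differentiableAt
      (by simp)).hasFDerivAt
  have := ((h1 v).add ((h1 w).const_mul k)).mul_const (2⁻¹ : ℂ)
  have e : (fun s => (fderiv ℝ f s v + k * fderiv ℝ f s w) / 2)
    = (fun s => ((fun s => fderiv ℝ f s v) + fun s => k * fderiv ℝ f s w) s * (2⁻¹ : ℂ)) := by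
    ext s; simp [div_eq_mul_inv]
  rw [e, this.fderiv]
  simp [div_eq_mul_inv]; ring

theorem dz_eq_linear_combination (f : ℂ × ℂ → ℂ) :
    dz f = fun s => (fderiv ℝ f s (0, 1) + (-Complex.I) * fderiv ℝ f s (0, Complex.I)) / 2 := by
  ext s; simp [dz]; ring

theorem fderiv_dz (hS : IsOpen S) (hf : ContDiffOn ℝ ∞ f S) (hp : p ∈ S) (v : ℂ × ℂ) :
    fderiv ℝ (dz f) p v = dz (fun s => fderiv ℝ f s v) p := by
  rw [dz_eq_linear_combination, dz_eq_linear_combination, fderiv_linear_combination hS hf hp,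
    fderiv_fderiv_apply_comm hS hf hp _ v, fderiv_fderiv_apply_comm hS hf hp (0, Complex.I) v]

theorem fderiv_dzbar (hS : IsOpen S) (hf : ContDiffOn ℝ ∞ f S) (hp : p ∈ S) (v : ℂ × ℂ) :
    fderiv ℝ (dzbar f) p v = dzbar (fun s => fderiv ℝ f s v) p := by
  have e (f : ℂ × ℂ → ℂ) : dzbar f
    = fun s => (fderiv ℝ f s (0, 1) + Complex.I * fderiv ℝ f s (0, Complex.I)) / 2 := rfl
  rw [e, e, fderiv_linear_combination hS hf hp,
    fderiv_fderiv_apply_comm hS hf hp _ v, fderiv_fderiv_apply_comm hS hf hp (0, Complex.I) v]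

theorem dy_dz_comm (hS : IsOpen S) (hf : ContDiffOn ℝ ∞ f S) (hp : p ∈ S) :
    dy (dz f) p = dz (dy f) p := fderiv_dz hS hf hp _

theorem dy_dzbar_comm (hS : IsOpen S) (hf : ContDiffOn ℝ ∞ f S) (hp : p ∈ S) :
    dy (dzbar f) p = dzbar (dy f) p := fderiv_dzbar hS hf hp _

theorem dzbar_dz_comm (hS : IsOpen S) (hf : ContDiffOn ℝ ∞ f S) (hp : p ∈ S) :
    dzbar (dz f) p = dz (dzbar f) p := by
  have h1 : dzbar (dz f) p
    = (fderiv ℝ (dz f) p (0, 1) + Complex.I * fderiv ℝ (dz f) p (0, Complex.I)) / 2 := rfl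
  have h2 : dz (dzbar f) p
    = (fderiv ℝ (dzbar f) p (0, 1) - Complex.I * fderiv ℝ (dzbar f) p (0, Complex.I)) / 2 := rfl
  rw [h1, h2, fderiv_dz hS hf hp, fderiv_dz hS hf hp, fderiv_dzbar hS hf hp, fderiv_dzbar hS hf hp]
  simp only [dz, dzbar]
  rw [fderiv_fderiv_apply_comm hS hf hp (0, Complex.I) (0, 1)]
  ring

/-- Functions that agree on an open set have the same derivative there. -/
theorem fderiv_congr_on (hS : IsOpen S) (h : ∀ s ∈ S, f s = g s) (hp : p ∈ S) :
    fderiv ℝ f p = fderiv ℝ g p :=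
  Filter.EventuallyEq.fderiv_eq (Filter.eventuallyEq_of_mem (hS.mem_nhds hp) h)

theorem dy_congr_on (hS : IsOpen S) (h : ∀ s ∈ S, f s = g s) (hp : p ∈ S) : dy f p = dy g p := by
  simp only [dy, fderiv_congr_on hS h hp]

theorem dz_congr_on (hS : IsOpen S) (h : ∀ s ∈ S, f s = g s) (hp : p ∈ S) : dz f p = dz g p := by
  simp only [dz, fderiv_congr_on hS h hp]

theorem dzbar_congr_on (hS : IsOpen S) (h : ∀ s ∈ S, f s = g s) (hp : p ∈ S) :
    dzbar f p = dzbar g p := by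
  simp only [dzbar, fderiv_congr_on hS h hp]

theorem dq_congr_on (hS : IsOpen S) (h : ∀ s ∈ S, f s = g s) (hp : p ∈ S) : dq f p = dq g p := by
  simp only [dq, fderiv_congr_on hS h hp]

theorem dqbar_congr_on (hS : IsOpen S) (h : ∀ s ∈ S, f s = g s) (hp : p ∈ S) :
    dqbar f p = dqbar g p := by
  simp only [dqbar, fderiv_congr_on hS h hp]

end Iterated

end Frame

/-! ### Functions of `(z, y)` on the cylinder over `Ω × I` -/

/-- A function of `(z, y)`, regarded as a function of `(q, z)` with `y = im q`. -/
def lift (b : ℂ → ℝ → ℂ) : ℂ × ℂ → ℂ := fun p => b p.2 p.1.im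

/-- The set of points `(q, z)` with `z ∈ Ω` and `im q ∈ I`. -/
def cylinder (Ω : Set ℂ) (I : Set ℝ) : Set (ℂ × ℂ) := {p | p.2 ∈ Ω ∧ p.1.im ∈ I}

theorem isOpen_cylinder {Ω : Set ℂ} {I : Set ℝ} (hΩ : IsOpen Ω) (hI : IsOpen I) :
    IsOpen (cylinder Ω I) :=
  (hΩ.preimage continuous_snd).inter (hI.preimage (Complex.continuous_im.comp continuous_fst))

theorem contDiffOn_lift {b : ℂ → ℝ → ℂ} {Ω : Set ℂ} {I : Set ℝ}
    (hb : ContDiffOn ℝ ∞ (fun s : ℂ × ℝ => b s.1 s.2) (Ω ×ˢ I)) :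
    ContDiffOn ℝ ∞ (lift b) (cylinder Ω I) := by
  have h : ContDiff ℝ ∞ (fun p : ℂ × ℂ => (p.2, p.1.im)) :=
    contDiff_snd.prodMk (Complex.imCLM.contDiff.comp contDiff_fst)
  exact hb.comp h.contDiffOn (fun p hp => ⟨hp.1, hp.2⟩)

/-- `f` does not depend on `x = re q`. -/
def XInvariant (f : ℂ × ℂ → ℂ) : Prop := ∀ p (t : ℝ), f (p + ((t : ℂ), 0)) = f p

theorem xInvariant_lift (b : ℂ → ℝ → ℂ) : XInvariant (lift b) := fun p t => by simp [lift]

theorem XInvariant.fderiv_eq {f : ℂ × ℂ → ℂ} (h : XInvariant f) (p : ℂ × ℂ) (t : ℝ) :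
    fderiv ℝ f (p + ((t : ℂ), 0)) = fderiv ℝ f p := by
  have : (fun s => f (s + ((t : ℂ), 0))) = f := funext fun s => h s t
  rw [← fderiv_comp_add_right, this]

theorem XInvariant.dy {f : ℂ × ℂ → ℂ} (h : XInvariant f) : XInvariant (dy f) := fun p t => by
  simp only [BFLift.dy, h.fderiv_eq]

theorem XInvariant.dz {f : ℂ × ℂ → ℂ} (h : XInvariant f) : XInvariant (dz f) := fun p t => by
  simp only [BFLift.dz, h.fderiv_eq]

theorem XInvariant.dzbar {f : ℂ × ℂ → ℂ} (h : XInvariant f) : XInvariant (dzbar f) := fun p t => by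
  simp only [BFLift.dzbar, h.fderiv_eq]

theorem XInvariant.dx_eq_zero {f : ℂ × ℂ → ℂ} (h : XInvariant f) (p : ℂ × ℂ) : dx f p = 0 := by
  by_cases hd : DifferentiableAt ℝ f p
  · have h1 := hd.hasFDerivAt.hasLineDerivAt ((1 : ℂ), (0 : ℂ))
    have h2 : (fun t : ℝ => f (p + t • ((1 : ℂ), (0 : ℂ)))) = fun _ => f p := by
      ext t; simpa using h p t
    unfold HasLineDerivAt at h1
    rw [h2] at h1
    exact h1.unique (hasDerivAt_const _ _)
  -- At a point of non-differentiability `fderiv` takes the default value zero, so no regularity is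
  -- needed.
  · simp [dx, fderiv_zero_of_not_differentiableAt hd]

/-- A function that does not depend on `x` is determined by its values at points `(iy, z)`. -/
theorem XInvariant.eq_of_eq {f : ℂ × ℂ → ℂ} (h : XInvariant f) {p s : ℂ × ℂ}
    (h1 : p.1.im = s.1.im) (h2 : p.2 = s.2) : f p = f s := by
  have : p = s + (((p.1.re - s.1.re : ℝ) : ℂ), 0) := by
    apply Prod.ext
    · apply Complex.ext <;> simp [h1]
    · simp [h2]
  rw [this, h]

/-! ### Restriction of a frame to the `z`-variable and to the `y`-variable -/

section Slices

variable {f : ℂ × ℂ → ℂ} {p : ℂ × ℂ} {a b c d : ℂ}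

theorem HasFrame.hasFDerivAt_snd (h : HasFrame f p a b c d) :
    HasFDerivAt (fun z => f (p.1, z))
      (c • ContinuousLinearMap.id ℝ ℂ + d • (Complex.conjCLE : ℂ →L[ℝ] ℂ)) p.2 := by
  have h1 : HasFDerivAt (fun z : ℂ => (p.1, z)) (ContinuousLinearMap.inr ℝ ℂ ℂ) p.2 :=
    hasFDerivAt_prodMk_right p.1 p.2
  have := HasFDerivAt.comp p.2 (f := fun z : ℂ => (p.1, z)) (g := f) h h1
  refine HasFDerivAt.congr_fderiv this ?_
  ext v
  simp [frameForm_apply]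

theorem HasFrame.hasDerivAt_snd (h : HasFrame f p a b c 0) :
    HasDerivAt (fun z => f (p.1, z)) c p.2 := by
  have h1 := h.hasFDerivAt_snd
  have h2 : HasFDerivAt (fun z => f (p.1, z)) (c • ContinuousLinearMap.id ℂ ℂ) p.2 :=
    hasFDerivAt_of_restrictScalars ℝ h1 (by ext v; simp)
  exact h2.hasDerivAt.congr_deriv (by simp)

/-- The Cauchy–Riemann equations: testing the real derivative `c v + d v̄ = e v` on `v = 1` and `v =
i` separates `c` from `d`. -/
theorem HasFrame.eq_of_hasDerivAt_snd (h : HasFrame f p a b c d) {e : ℂ}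
    (he : HasDerivAt (fun z => f (p.1, z)) e p.2) : c = e ∧ d = 0 := by
  have h1 := h.hasFDerivAt_snd.unique (he.hasFDerivAt.restrictScalars ℝ)
  have e1 : c + d = e := by simpa using congrArg (fun l => l (1 : ℂ)) h1
  have e2 : c * Complex.I + d * -Complex.I = Complex.I * e := by
    simpa using congrArg (fun l => l Complex.I) h1
  have e3 : c - d = e := by
    apply mul_left_cancel₀ Complex.I_ne_zero
    linear_combination e2
  constructor
  · linear_combination (e1 + e3) / 2
  · linear_combination (e1 - e3) / 2

theorem HasFrame.hasDerivAt_im (h : HasFrame f p a b c d) :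
    HasDerivAt (fun t : ℝ => f (⟨p.1.re, t⟩, p.2)) b p.1.im := by
  have h1 : HasDerivAt (fun t : ℝ => (((⟨p.1.re, t⟩ : ℂ)), p.2)) (Complex.I, 0) p.1.im := by
    refine HasDerivAt.prodMk ?_ (hasDerivAt_const _ _)
    have e : Complex.mk p.1.re = fun t : ℝ => (p.1.re : ℂ) + (t : ℂ) * Complex.I := by
      ext t; exact Complex.mk_eq_add_mul_I _ _
    rw [e]
    simpa using ((Complex.ofRealCLM.hasDerivAt (x := p.1.im)).mul_const Complex.I).const_add
      (p.1.re : ℂ)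
  have := HasFDerivAt.comp_hasDerivAt (f := fun t : ℝ => (((⟨p.1.re, t⟩ : ℂ)), p.2)) p.1.im h h1
  simpa [Function.comp_def, frameForm_apply] using this

end Slices

/-! ### Conjugation symmetry of the derivatives of real functions -/

section Real

variable {f : ℂ × ℂ → ℂ} {p : ℂ × ℂ} {S : Set (ℂ × ℂ)}

theorem dzbar_eq_conj_dz (hf : DifferentiableAt ℝ f p) (hr : ∀ s, conj (f s) = f s) :
    dzbar f p = conj (dz f p) := by
  have h := (hasFrame_of_differentiableAt hf).conj
  rw [show (fun s => conj (f s)) = f from funext hr] at h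
  exact h.dzbar_eq

theorem dy_dzbar_eq_conj (hS : IsOpen S) (hf : ContDiffOn ℝ ∞ f S) (hr : ∀ s, conj (f s) = f s)
    (hp : p ∈ S) : dy (dzbar f) p = conj (dy (dz f) p) := by
  have hd (s) (hs : s ∈ S) : DifferentiableAt ℝ f s :=
    (hf.contDiffAt (hS.mem_nhds hs)).differentiableAt (by simp)
  rw [dy_congr_on hS (fun s hs => dzbar_eq_conj_dz (hd s hs) hr) hp]
  exact (hasFrame_of_contDiffOn hS (contDiffOn_dz hS hf) hp).conj.dy_eq

end Real

theorem dzbar_lift_eq_zero {b : ℂ → ℝ → ℂ} {Ω : Set ℂ} {I : Set ℝ} (hΩ : IsOpen Ω) (hI : IsOpen I)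
    (hs : ContDiffOn ℝ ∞ (fun s : ℂ × ℝ => b s.1 s.2) (Ω ×ˢ I))
    (hb : ∀ y ∈ I, DifferentiableOn ℂ (fun z => b z y) Ω) {p : ℂ × ℂ} (hp : p ∈ cylinder Ω I) :
    dz (lift b) p = deriv (fun z => b z p.1.im) p.2 ∧ dzbar (lift b) p = 0 :=
  (hasFrame_of_contDiffOn (isOpen_cylinder hΩ hI) (contDiffOn_lift hs) hp).eq_of_hasDerivAt_snd
    (((hb _ hp.2).differentiableAt (hΩ.mem_nhds hp.1)).hasDerivAt)

/-! ### Continuous branches of the logarithm -/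

/-- By continuity `L s - L p` has imaginary part in `(-π, π)` for `s` near `p`, so it is the
principal logarithm of its own exponential `B s / B p`. This makes a merely continuous branch as
smooth as its argument. -/
theorem eventually_eq_log {L B : ℂ × ℂ → ℂ} {D : Set (ℂ × ℂ)} (hD : IsOpen D)
    (hL : ContinuousOn L D) (hB : ∀ p ∈ D, Complex.exp (L p) = B p) {p : ℂ × ℂ} (hp : p ∈ D) :
    ∀ᶠ s in 𝓝 p, L s = L p + Complex.log (B s / B p) := by
  have hc : ContinuousAt L p := hL.continuousAt (hD.mem_nhds hp)
  have h1 : ∀ᶠ s in 𝓝 p, |(L s - L p).im| < Real.pi := by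
    have : ContinuousAt (fun s => |(L s - L p).im|) p :=
      (Complex.continuous_im.continuousAt.comp (hc.sub continuousAt_const)).abs
    exact this.eventually_lt_const (by simpa using Real.pi_pos)
  filter_upwards [h1, hD.mem_nhds hp] with s hs hsD
  rw [← hB s hsD, ← hB p hp, ← Complex.exp_sub, Complex.log_exp (by linarith [(abs_lt.1 hs).1])
    (abs_lt.1 hs).2.le]
  ring

theorem contDiffOn_log_branch {L B : ℂ × ℂ → ℂ} {D : Set (ℂ × ℂ)} (hD : IsOpen D)
    (hL : ContinuousOn L D) (hB : ∀ p ∈ D, Complex.exp (L p) = B p) (hs : ContDiffOn ℝ ∞ B D) :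
    ContDiffOn ℝ ∞ L D := by
  intro p hp
  have h0 : B p ≠ 0 := by rw [← hB p hp]; exact Complex.exp_ne_zero _
  have h1 : ContDiffAt ℝ ∞ (fun s => B s / B p) p :=
    (hs.contDiffAt (hD.mem_nhds hp)).div_const _
  have h2 : ContDiffAt ℝ ∞ (fun s => L p + Complex.log (B s / B p)) p := by
    refine contDiffAt_const.add ?_
    have := (Complex.contDiffAt_log (n := ∞) (x := B p / B p)
      (by rw [div_self h0]; exact Complex.one_mem_slitPlane)).restrict_scalars ℝ
    exact this.comp p h1
  exact (h2.congr_of_eventuallyEq (eventually_eq_log hD hL hB hp)).contDiffWithinAt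

theorem hasFrame_log_branch {L B : ℂ × ℂ → ℂ} {D : Set (ℂ × ℂ)} (hD : IsOpen D)
    (hL : ContinuousOn L D) (hB : ∀ p ∈ D, Complex.exp (L p) = B p) {p : ℂ × ℂ} (hp : p ∈ D)
    {a b c d : ℂ} (h : HasFrame B p a b c d) :
    HasFrame L p (a / B p) (b / B p) (c / B p) (d / B p) := by
  have h0 : B p ≠ 0 := by rw [← hB p hp]; exact Complex.exp_ne_zero _
  have h1 : HasDerivAt (fun w => L p + Complex.log (w / B p)) (1 / B p) (B p) := by
    have := ((hasDerivAt_id (B p)).div_const (B p)).clog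
      (by rw [id, div_self h0]; exact Complex.one_mem_slitPlane)
    simpa [h0] using this.const_add (L p)
  exact ((h.comp_holomorphic h1).congr_of_eventuallyEq
    (eventually_eq_log hD hL hB hp)).congr_coeff (by ring) (by ring) (by ring) (by ring)

/-! ### The two equations on functions of the logarithmic form -/

theorem hasFrame_add_conj (p : ℂ × ℂ) : HasFrame (fun s => s.2 + conj s.2) p 0 0 1 1 :=
  (hasFrame_snd.add hasFrame_snd.conj).congr_coeff (by simp) (by simp) (by simp) (by simp)

theorem add_conj_mem_slitPlane {z : ℂ} (hz : 0 < z.re) : z + conj z ∈ Complex.slitPlane := by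
  left; simp; linarith

theorem add_conj_ne_zero {z : ℂ} (hz : 0 < z.re) : z + conj z ≠ 0 :=
  Complex.slitPlane_ne_zero (add_conj_mem_slitPlane hz)

theorem hasFrame_log_add_conj {p : ℂ × ℂ} (hp : 0 < p.2.re) :
    HasFrame (fun s => Complex.log (s.2 + conj s.2)) p 0 0 (1 / (p.2 + conj p.2))
      (1 / (p.2 + conj p.2)) :=
  ((hasFrame_add_conj p).comp_holomorphic
    (Complex.hasDerivAt_log (add_conj_mem_slitPlane hp))).congr_coeff
    (by simp) (by simp) (by simp) (by simp)

/-! ### Derivatives of the ansatz up to second order -/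

namespace IsAnsatz

variable {D : Set (ℂ × ℂ)} {I : Set ℝ} {Ω : Set ℂ} {b : ℂ → ℝ → ℂ} {F : ℂ → ℝ → ℝ}
  {L : ℂ × ℂ → ℂ} {ψ : ℂ × ℂ → ℝ} {p : ℂ × ℂ}

/-- The argument `x + b` of the logarithm. -/
def arg (b : ℂ → ℝ → ℂ) (p : ℂ × ℂ) : ℂ := p.1.re + lift b p

/-- The real function `F`, as a complex valued function of `(q, z)`. -/
def liftF (F : ℂ → ℝ → ℝ) : ℂ × ℂ → ℂ := lift fun z y => (F z y : ℂ)

theorem isOpen_cylinder (h : IsAnsatz D I Ω b F L ψ) : IsOpen (cylinder Ω I) :=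
  BFLift.isOpen_cylinder h.domain.isOpen_Ω h.domain.isOpen_I

theorem mem_cylinder (h : IsAnsatz D I Ω b F L ψ) (hp : p ∈ D) : p ∈ cylinder Ω I :=
  ⟨(h.domain.proj_mem p hp).2, (h.domain.proj_mem p hp).1⟩

theorem re_pos (h : IsAnsatz D I Ω b F L ψ) (hp : p ∈ D) : 0 < p.2.re :=
  h.domain.re_pos _ (h.domain.proj_mem p hp).2

theorem contDiffOn_b (h : IsAnsatz D I Ω b F L ψ) : ContDiffOn ℝ ∞ (lift b) (cylinder Ω I) :=
  contDiffOn_lift h.smooth_b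

theorem contDiffOn_F (h : IsAnsatz D I Ω b F L ψ) : ContDiffOn ℝ ∞ (liftF F) (cylinder Ω I) :=
  contDiffOn_lift (Complex.ofRealCLM.contDiff.comp_contDiffOn h.smooth_F)

theorem conj_liftF (F : ℂ → ℝ → ℝ) (s : ℂ × ℂ) : conj (liftF F s) = liftF F s :=
  Complex.conj_ofReal _

theorem dzbar_b (h : IsAnsatz D I Ω b F L ψ) {s : ℂ × ℂ} (hs : s ∈ cylinder Ω I) :
    dzbar (lift b) s = 0 :=
  (dzbar_lift_eq_zero h.domain.isOpen_Ω h.domain.isOpen_I h.smooth_b h.holomorphic_b hs).2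

theorem dz_b (h : IsAnsatz D I Ω b F L ψ) {s : ℂ × ℂ} (hs : s ∈ cylinder Ω I) :
    dz (lift b) s = deriv (fun z => b z s.1.im) s.2 :=
  (dzbar_lift_eq_zero h.domain.isOpen_Ω h.domain.isOpen_I h.smooth_b h.holomorphic_b hs).1

theorem hasFrame_b (h : IsAnsatz D I Ω b F L ψ) {s : ℂ × ℂ} (hs : s ∈ cylinder Ω I) :
    HasFrame (lift b) s 0 (dy (lift b) s) (dz (lift b) s) 0 :=
  (hasFrame_of_contDiffOn h.isOpen_cylinder h.contDiffOn_b hs).congr_coeff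
    ((xInvariant_lift b).dx_eq_zero s) rfl rfl (h.dzbar_b hs)

theorem hasFrame_dy_b (h : IsAnsatz D I Ω b F L ψ) {s : ℂ × ℂ} (hs : s ∈ cylinder Ω I) :
    HasFrame (dy (lift b)) s 0 (dy (dy (lift b)) s) (dy (dz (lift b)) s) 0 := by
  have hS := h.isOpen_cylinder
  refine (hasFrame_of_contDiffOn hS (contDiffOn_dy hS h.contDiffOn_b) hs).congr_coeff
    ((xInvariant_lift b).dy.dx_eq_zero s) rfl (dy_dz_comm hS h.contDiffOn_b hs).symm ?_
  rw [← dy_dzbar_comm hS h.contDiffOn_b hs, dy_congr_on hS (fun s hs => h.dzbar_b hs) hs]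
  exact (hasFrame_const 0).dy_eq

theorem hasFrame_dz_b (h : IsAnsatz D I Ω b F L ψ) {s : ℂ × ℂ} (hs : s ∈ cylinder Ω I) :
    HasFrame (dz (lift b)) s 0 (dy (dz (lift b)) s) (dz (dz (lift b)) s) 0 := by
  have hS := h.isOpen_cylinder
  refine (hasFrame_of_contDiffOn hS (contDiffOn_dz hS h.contDiffOn_b) hs).congr_coeff
    ((xInvariant_lift b).dz.dx_eq_zero s) rfl rfl ?_
  rw [dzbar_dz_comm hS h.contDiffOn_b hs, dz_congr_on hS (fun s hs => h.dzbar_b hs) hs]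
  exact (hasFrame_const 0).dz_eq

theorem hasFrame_F (h : IsAnsatz D I Ω b F L ψ) {s : ℂ × ℂ} (hs : s ∈ cylinder Ω I) :
    HasFrame (liftF F) s 0 (dy (liftF F) s) (dz (liftF F) s) (dzbar (liftF F) s) :=
  (hasFrame_of_contDiffOn h.isOpen_cylinder h.contDiffOn_F hs).congr_coeff
    ((xInvariant_lift _).dx_eq_zero s) rfl rfl rfl

theorem hasFrame_dy_F (h : IsAnsatz D I Ω b F L ψ) {s : ℂ × ℂ} (hs : s ∈ cylinder Ω I) :
    HasFrame (dy (liftF F)) s 0 (dy (dy (liftF F)) s) (dy (dz (liftF F)) s)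
      (dy (dzbar (liftF F)) s) := by
  have hS := h.isOpen_cylinder
  exact (hasFrame_of_contDiffOn hS (contDiffOn_dy hS h.contDiffOn_F) hs).congr_coeff
    ((xInvariant_lift _).dy.dx_eq_zero s) rfl (dy_dz_comm hS h.contDiffOn_F hs).symm
    (dy_dzbar_comm hS h.contDiffOn_F hs).symm

theorem hasFrame_dz_F (h : IsAnsatz D I Ω b F L ψ) {s : ℂ × ℂ} (hs : s ∈ cylinder Ω I) :
    HasFrame (dz (liftF F)) s 0 (dy (dz (liftF F)) s) (dz (dz (liftF F)) s)
      (dz (dzbar (liftF F)) s) := by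
  have hS := h.isOpen_cylinder
  exact (hasFrame_of_contDiffOn hS (contDiffOn_dz hS h.contDiffOn_F) hs).congr_coeff
    ((xInvariant_lift _).dz.dx_eq_zero s) rfl rfl (dzbar_dz_comm hS h.contDiffOn_F hs)

theorem hasFrame_dzbar_F (h : IsAnsatz D I Ω b F L ψ) {s : ℂ × ℂ} (hs : s ∈ cylinder Ω I) :
    HasFrame (dzbar (liftF F)) s 0 (conj (dy (dz (liftF F)) s)) (dz (dzbar (liftF F)) s)
      (dzbar (dzbar (liftF F)) s) := by
  have hS := h.isOpen_cylinder
  exact (hasFrame_of_contDiffOn hS (contDiffOn_dzbar hS h.contDiffOn_F) hs).congr_coeff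
    ((xInvariant_lift _).dzbar.dx_eq_zero s)
    (dy_dzbar_eq_conj hS h.contDiffOn_F (conj_liftF F) hs) rfl rfl

theorem exp_L_eq (h : IsAnsatz D I Ω b F L ψ) (s : ℂ × ℂ) (hs : s ∈ D) :
    Complex.exp (L s) = arg b s := h.exp_L s hs

theorem arg_ne_zero (h : IsAnsatz D I Ω b F L ψ) (hp : p ∈ D) : arg b p ≠ 0 := by
  rw [← h.exp_L_eq p hp]; exact Complex.exp_ne_zero _

theorem hasFrame_arg (h : IsAnsatz D I Ω b F L ψ) (hp : p ∈ D) :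
    HasFrame (arg b) p 1 (dy (lift b) p) (dz (lift b) p) 0 :=
  (hasFrame_re.add (h.hasFrame_b (h.mem_cylinder hp))).congr_coeff (by ring) (by ring) (by ring)
    (by ring)

theorem hasFrame_L (h : IsAnsatz D I Ω b F L ψ) (hp : p ∈ D) :
    HasFrame L p (1 / arg b p) (dy (lift b) p / arg b p) (dz (lift b) p / arg b p) 0 :=
  (hasFrame_log_branch h.domain.isOpen h.continuous_L h.exp_L_eq hp (h.hasFrame_arg hp)).congr_coeff
    rfl rfl rfl (by simp)

theorem contDiffOn_L (h : IsAnsatz D I Ω b F L ψ) : ContDiffOn ℝ ∞ L D := by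
  refine contDiffOn_log_branch h.domain.isOpen h.continuous_L h.exp_L_eq ?_
  have h1 : ContDiff ℝ ∞ (fun s : ℂ × ℂ => (s.1.re : ℂ)) :=
    Complex.ofRealCLM.contDiff.comp (Complex.reCLM.contDiff.comp contDiff_fst)
  exact h1.contDiffOn.add (h.contDiffOn_b.mono fun s hs => h.mem_cylinder hs)

/-- `ψ`, in terms of the lifted functions. -/
theorem toC_eq (h : IsAnsatz D I Ω b F L ψ) (s : ℂ × ℂ) (hs : s ∈ D) :
    toC ψ s = arg b s * L s + conj (arg b s * L s)
      - 2 * s.1.re * (Complex.log (s.2 + conj s.2) + 1) + liftF F s := by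
  have := h.eq s hs
  simp only [toC, this, arg, lift, liftF, map_mul, map_add, Complex.conj_ofReal]

theorem contDiffOn (h : IsAnsatz D I Ω b F L ψ) : ContDiffOn ℝ ∞ ψ D := by
  have h1 : ContDiff ℝ ∞ (fun s : ℂ × ℂ => (s.1.re : ℂ)) :=
    Complex.ofRealCLM.contDiff.comp (Complex.reCLM.contDiff.comp contDiff_fst)
  have h2 : ContDiffOn ℝ ∞ (arg b) D :=
    h1.contDiffOn.add (h.contDiffOn_b.mono fun s hs => h.mem_cylinder hs)
  have hm := h2.mul h.contDiffOn_L
  have h3 : ContDiffOn ℝ ∞ (fun s : ℂ × ℂ => conj (arg b s * L s)) D :=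
    (Complex.conjCLE : ℂ →L[ℝ] ℂ).contDiff.comp_contDiffOn hm
  have h4 : ContDiffOn ℝ ∞ (fun s : ℂ × ℂ => Complex.log (s.2 + conj s.2)) D := by
    intro s hs
    have e : ContDiff ℝ ∞ (fun s : ℂ × ℂ => s.2 + conj s.2) :=
      contDiff_snd.add ((Complex.conjCLE : ℂ →L[ℝ] ℂ).contDiff.comp contDiff_snd)
    exact (((Complex.contDiffAt_log (n := ∞) (add_conj_mem_slitPlane (h.re_pos hs))).restrict_scalars
      ℝ).comp s e.contDiffAt).contDiffWithinAt
  have h5 := ((hm.add h3).sub ((contDiffOn_const (c := (2 : ℂ)).mul h1.contDiffOn).mul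
    (h4.add (contDiffOn_const (c := (1 : ℂ)))))).add
    (h.contDiffOn_F.mono fun s hs => h.mem_cylinder hs)
  have h6 := Complex.reCLM.contDiff.comp_contDiffOn (h5.congr fun s hs => h.toC_eq s hs)
  exact h6.congr fun s _ => by simp [toC]

theorem hasFrame_psi (h : IsAnsatz D I Ω b F L ψ) (hp : p ∈ D) :
    HasFrame (toC ψ) p
      (L p + conj (L p) - 2 * Complex.log (p.2 + conj p.2))
      (dy (lift b) p * (L p + 1) + conj (dy (lift b) p * (L p + 1)) + dy (liftF F) p)
      (dz (lift b) p * (L p + 1) - 2 * p.1.re * (1 / (p.2 + conj p.2)) + dz (liftF F) p)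
      (conj (dz (lift b) p * (L p + 1)) - 2 * p.1.re * (1 / (p.2 + conj p.2))
        + dzbar (liftF F) p) := by
  have h0 := h.arg_ne_zero hp
  have hc : conj (arg b p) ≠ 0 := by simpa using h0
  have h1 := (h.hasFrame_arg hp).mul (h.hasFrame_L hp)
  have h2 := (((h1.add h1.conj).sub ((hasFrame_re.const_mul 2).mul
    ((hasFrame_log_add_conj (h.re_pos hp)).add (hasFrame_const 1)))).add
    (h.hasFrame_F (h.mem_cylinder hp))).congr_of_eventuallyEq
    (Filter.eventuallyEq_of_mem (h.domain.isOpen.mem_nhds hp) h.toC_eq)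
  refine h2.congr_coeff ?_ ?_ ?_ ?_ <;>
    · simp only [map_add, map_mul, map_div₀, map_one, map_zero]
      field_simp
      ring

theorem hasFrame_dx_psi (h : IsAnsatz D I Ω b F L ψ) (hp : p ∈ D) :
    HasFrame (dx (toC ψ)) p (1 / arg b p + 1 / conj (arg b p))
      (dy (lift b) p / arg b p + conj (dy (lift b) p) / conj (arg b p))
      (dz (lift b) p / arg b p - 2 / (p.2 + conj p.2))
      (conj (dz (lift b) p) / conj (arg b p) - 2 / (p.2 + conj p.2)) := by
  have h1 := h.hasFrame_L hp
  refine (((h1.add h1.conj).sub ((hasFrame_log_add_conj (h.re_pos hp)).const_mul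
    2)).congr_of_eventuallyEq (Filter.eventuallyEq_of_mem (h.domain.isOpen.mem_nhds hp)
    fun s hs => (h.hasFrame_psi hs).dx_eq)).congr_coeff ?_ ?_ ?_ ?_ <;>
    · simp only [map_div₀, map_one, map_zero]
      ring

/-- Only `ψ_xy` is made explicit. The second coefficient, `ψ_yy`, cancels from (H) once (BF) holds,
and the last two are not used. -/
theorem hasFrame_dy_psi (h : IsAnsatz D I Ω b F L ψ) (hp : p ∈ D) :
    ∃ e f g, HasFrame (dy (toC ψ)) p
      (dy (lift b) p / arg b p + conj (dy (lift b) p) / conj (arg b p)) e f g := by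
  have h1 := (h.hasFrame_dy_b (h.mem_cylinder hp)).mul ((h.hasFrame_L hp).add (hasFrame_const 1))
  refine ⟨_, _, _, (((h1.add h1.conj).add
    (h.hasFrame_dy_F (h.mem_cylinder hp))).congr_of_eventuallyEq (Filter.eventuallyEq_of_mem
      (h.domain.isOpen.mem_nhds hp)
    fun s hs => (h.hasFrame_psi hs).dy_eq)).congr_coeff ?_ rfl rfl rfl⟩
  simp only [map_add, map_mul, map_div₀, map_one, map_zero]
  ring

theorem hasFrame_dz_psi (h : IsAnsatz D I Ω b F L ψ) (hp : p ∈ D) :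
    ∃ f g, HasFrame (dz (toC ψ)) p
      (dz (lift b) p / arg b p - 2 / (p.2 + conj p.2))
      (dy (dz (lift b)) p * (L p + 1) + dz (lift b) p * dy (lift b) p / arg b p
        + dy (dz (liftF F)) p) f g := by
  have h1 := (h.hasFrame_dz_b (h.mem_cylinder hp)).mul ((h.hasFrame_L hp).add (hasFrame_const 1))
  have h2 : HasFrame (fun s => 1 / (s.2 + conj s.2)) p 0 0 _ _ :=
    ((hasFrame_add_conj p).comp_holomorphic (h := fun w => 1 / w)
      ((hasDerivAt_const _ (1 : ℂ)).div (hasDerivAt_id _)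
        (add_conj_ne_zero (h.re_pos hp)))).congr_coeff (by simp) (by simp) rfl rfl
  refine ⟨_, _, (((h1.sub ((hasFrame_re.const_mul 2).mul h2)).add
    (h.hasFrame_dz_F (h.mem_cylinder hp))).congr_of_eventuallyEq (Filter.eventuallyEq_of_mem
      (h.domain.isOpen.mem_nhds hp)
    fun s hs => (h.hasFrame_psi hs).dz_eq)).congr_coeff ?_ ?_ rfl rfl⟩ <;>
  · ring

theorem hasFrame_dzbar_psi (h : IsAnsatz D I Ω b F L ψ) (hp : p ∈ D) :
    ∃ g, HasFrame (dzbar (toC ψ)) p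
      (conj (dz (lift b) p / arg b p) - 2 / (p.2 + conj p.2))
      (conj (dy (dz (lift b)) p * (L p + 1) + dz (lift b) p * dy (lift b) p / arg b p
        + dy (dz (liftF F)) p))
      (2 * p.1.re / (p.2 + conj p.2) ^ 2 + dz (dzbar (liftF F)) p) g := by
  have h1 := ((h.hasFrame_dz_b (h.mem_cylinder hp)).mul
    ((h.hasFrame_L hp).add (hasFrame_const 1))).conj
  have h2 : HasFrame (fun s => 1 / (s.2 + conj s.2)) p 0 0 _ _ :=
    ((hasFrame_add_conj p).comp_holomorphic (h := fun w => 1 / w)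
      ((hasDerivAt_const _ (1 : ℂ)).div (hasDerivAt_id _)
        (add_conj_ne_zero (h.re_pos hp)))).congr_coeff (by simp) (by simp) rfl rfl
  refine ⟨_, (((h1.sub ((hasFrame_re.const_mul 2).mul h2)).add
    (h.hasFrame_dzbar_F (h.mem_cylinder hp))).congr_of_eventuallyEq (Filter.eventuallyEq_of_mem
      (h.domain.isOpen.mem_nhds hp)
    fun s hs => (h.hasFrame_psi hs).dzbar_eq)).congr_coeff ?_ ?_ ?_ rfl⟩ <;>
  · simp only [map_add, map_mul, map_div₀, map_one, map_zero]
    ring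

theorem exp_dx_psi (h : IsAnsatz D I Ω b F L ψ) (hp : p ∈ D) :
    Complex.exp (dx (toC ψ) p) = arg b p * conj (arg b p) / (p.2 + conj p.2) ^ 2 := by
  rw [(h.hasFrame_psi hp).dx_eq, Complex.exp_sub, Complex.exp_add, Complex.exp_conj,
    h.exp_L_eq p hp, two_mul (Complex.log _), Complex.exp_add,
    Complex.exp_log (add_conj_ne_zero (h.re_pos hp)), sq]

/-- The right side of (BF) is `(|B|²/θ²)(1/B + 1/B̄) = (2x + b + b̄)/θ²`, and the term `-2x ln θ`
already contributes `2x/θ²` to the left side. The remaining condition does not involve `x`. -/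
theorem boyerFinley_iff (h : IsAnsatz D I Ω b F L ψ) (hp : p ∈ D) :
    dz (dzbar (toC ψ)) p = Complex.exp (dx (toC ψ) p) * dx (dx (toC ψ)) p ↔
      dz (dzbar (liftF F)) p = (lift b p + conj (lift b p)) / (p.2 + conj p.2) ^ 2 := by
  obtain ⟨g, hg⟩ := h.hasFrame_dzbar_psi hp
  have h0 := h.arg_ne_zero hp
  have hc : conj (arg b p) ≠ 0 := by simpa using h0
  have hθ := add_conj_ne_zero (h.re_pos hp)
  have e : arg b p * conj (arg b p) / (p.2 + conj p.2) ^ 2 * (1 / arg b p + 1 / conj (arg b p))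
      = 2 * p.1.re / (p.2 + conj p.2) ^ 2
        + (lift b p + conj (lift b p)) / (p.2 + conj p.2) ^ 2 := by
    have : arg b p * conj (arg b p) * (1 / arg b p + 1 / conj (arg b p))
        = 2 * p.1.re + (lift b p + conj (lift b p)) := by
      have e1 : arg b p + conj (arg b p) = 2 * p.1.re + (lift b p + conj (lift b p)) := by
        simp only [arg, map_add, Complex.conj_ofReal]; ring
      rw [← e1]; field_simp; ring
    rw [← add_div, ← this]; ring
  rw [hg.dz_eq, h.exp_dx_psi hp, (h.hasFrame_dx_psi hp).dx_eq, e]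
  exact add_right_inj _

/-- The quantity `(x + b) (ψ_{xz} + i ψ_{yz})`. -/
def mixed (b : ℂ → ℝ → ℂ) (F : ℂ → ℝ → ℝ) (L : ℂ × ℂ → ℂ) (p : ℂ × ℂ) : ℂ :=
  dz (lift b) p * (1 + Complex.I * dy (lift b) p)
    + arg b p * (Complex.I * (dy (dz (lift b)) p * (L p + 1) + dy (dz (liftF F)) p)
      - 2 / (p.2 + conj p.2))

/-- The quantity `|x + b|² (ψ_{xx} + i ψ_{xy})`. -/
def pure (b : ℂ → ℝ → ℂ) (p : ℂ × ℂ) : ℂ :=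
  conj (arg b p) * (1 + Complex.I * dy (lift b) p)
    + arg b p * (1 + Complex.I * conj (dy (lift b) p))

/-- In real terms `ψ_{qq̄}² - ψ_qq ψ_q̄q̄ = (ψ_xx ψ_yy - ψ_xy²)/4`, while (BF) turns the first term
of (H) into `e^{ψ_x} ψ_xx (ψ_xx + ψ_yy)/4`. The products `ψ_xx ψ_yy` cancel and leave `|ψ_xz +
iψ_yz|² = e^{ψ_x} (ψ_xx² + ψ_xy²)`; the factor `θ²|B|²` then clears the denominators. -/
theorem mongeAmpere_iff (h : IsAnsatz D I Ω b F L ψ) (hp : p ∈ D)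
    (hBF : dz (dzbar (toC ψ)) p = Complex.exp (dx (toC ψ) p) * dx (dx (toC ψ)) p) :
    dq (dqbar (toC ψ)) p * dz (dzbar (toC ψ)) p - dq (dzbar (toC ψ)) p * dqbar (dz (toC ψ)) p
      = Complex.exp (dq (toC ψ) p + dqbar (toC ψ) p)
        * (dq (dqbar (toC ψ)) p ^ 2 - dq (dq (toC ψ)) p * dqbar (dqbar (toC ψ)) p) ↔
    (p.2 + conj p.2) ^ 2 * (mixed b F L p * conj (mixed b F L p))
      = pure b p * conj (pure b p) := by
  obtain ⟨g, hg⟩ := h.hasFrame_dzbar_psi hp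
  obtain ⟨f', g', hg'⟩ := h.hasFrame_dz_psi hp
  have hX := h.hasFrame_dx_psi hp
  obtain ⟨e, f2, g2, hY⟩ := h.hasFrame_dy_psi hp
  have hE := h.exp_dx_psi hp
  have h0 := h.arg_ne_zero hp
  have hc : conj (arg b p) ≠ 0 := by simpa using h0
  have hθ := add_conj_ne_zero (h.re_pos hp)
  have hq : HasFrame (dq (toC ψ)) p _ _ _ _ :=
    ((hX.sub (hY.const_mul Complex.I)).const_mul (1 / 2)).congr_of_eventuallyEq
      (Filter.Eventually.of_forall fun s => by simp only [dq, dx, dy]; ring)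
  have hqbar : HasFrame (dqbar (toC ψ)) p _ _ _ _ :=
    ((hX.add (hY.const_mul Complex.I)).const_mul (1 / 2)).congr_of_eventuallyEq
      (Filter.Eventually.of_forall fun s => by simp only [dqbar, dx, dy]; ring)
  have hsum : dq (toC ψ) p + dqbar (toC ψ) p = dx (toC ψ) p := by
    simp only [dq, dqbar, dx]; ring
  rw [hBF, hX.dx_eq, hsum, hE, hqbar.dq_eq, hqbar.dqbar_eq, hq.dq_eq, hg.dq_eq, hg'.dqbar_eq]
  have hmix : arg b p * (dz (lift b) p / arg b p - 2 / (p.2 + conj p.2) + Complex.I *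
      (dy (dz (lift b)) p * (L p + 1) + dz (lift b) p * dy (lift b) p / arg b p
        + dy (dz (liftF F)) p)) = mixed b F L p := by
    unfold mixed; field_simp; ring
  have hpur : arg b p * conj (arg b p) * (1 / arg b p + 1 / conj (arg b p) + Complex.I *
      (dy (lift b) p / arg b p + conj (dy (lift b) p) / conj (arg b p))) = pure b p := by
    unfold pure; field_simp; ring
  have hreal : conj (p.2 + conj p.2) = p.2 + conj p.2 := by simp [add_comm]
  rw [← hmix, ← hpur]
  simp only [map_mul, map_add, map_sub, map_div₀, map_one, Complex.conj_conj, Complex.conj_I,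
    map_ofNat]
  rw [add_comm (conj p.2) p.2]
  -- From here on a quantity and its conjugate are treated as independent variables: the claim is a
  -- rational identity.
  generalize arg b p = B at *
  generalize conj B = B' at *
  generalize dz (lift b) p = z1
  generalize dy (lift b) p = y1
  generalize dy (dz (lift b)) p = w1
  generalize dy (dz (liftF F)) p = u1
  generalize L p = l1
  generalize p.2 + conj p.2 = t at *
  generalize conj z1 = z2
  generalize conj y1 = y2
  generalize conj w1 = w2
  generalize conj u1 = u2
  generalize conj l1 = l2
  generalize z1 / B - 2 / t = X1
  generalize z2 / B' - 2 / t = X2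
  generalize w1 * (l1 + 1) + z1 * y1 / B + u1 = Y1
  generalize w2 * (l2 + 1) + z2 * y2 / B' + u2 = Y2
  generalize ha : 1 / B + 1 / B' = a
  generalize hm : y1 / B + y2 / B' = m
  rw [add_comm (1 / B') (1 / B), ha, add_comm (y2 / B') (y1 / B), hm]
  have hI := Complex.I_sq
  have e1 : (1 / 2 * (a + Complex.I * m) - Complex.I * (1 / 2 * (m + Complex.I * e))) / 2
      = (a + e) / 4 := by linear_combination (-e / 4) * hI
  have e2 : (1 / 2 * (a - Complex.I * m) - Complex.I * (1 / 2 * (m - Complex.I * e))) / 2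
      = (a - e - 2 * Complex.I * m) / 4 := by linear_combination (e / 4) * hI
  have e3 : (1 / 2 * (a + Complex.I * m) + Complex.I * (1 / 2 * (m + Complex.I * e))) / 2
      = (a - e + 2 * Complex.I * m) / 4 := by linear_combination (e / 4) * hI
  rw [e1, e2, e3]
  -- The differences of the two sides of the two equations are proportional, with the nonzero factor
  -- `-4θ²|B|²`. Here `a`, `m`, `e` stand for `ψ_xx`, `ψ_xy`, `ψ_yy`, and `e` drops out.
  have e4 : t ^ 2 * (B * (X1 + Complex.I * Y1) * (B' * (X2 + -Complex.I * Y2)))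
      - B * B' * (a + Complex.I * m) * (B' * B * (a + -Complex.I * m))
      = -(4 * t ^ 2 * (B * B')) * ((a + e) / 4 * (B * B' / t ^ 2 * a)
        - (X2 - Complex.I * Y2) / 2 * ((X1 + Complex.I * Y1) / 2)
        - B * B' / t ^ 2 * (((a + e) / 4) ^ 2
          - (a - e - 2 * Complex.I * m) / 4 * ((a - e + 2 * Complex.I * m) / 4))) := by
    field_simp
    ring
  rw [← sub_eq_zero, ← sub_eq_zero (a := t ^ 2 * _), e4, mul_eq_zero, neg_eq_zero]
  simp [h0, hc, hθ]

end IsAnsatz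
/-! ### The inversion symmetry -/

theorem inv_re_pos {z : ℂ} (hz : 0 < z.re) : 0 < (z⁻¹).re := by
  rw [Complex.inv_re]
  exact div_pos hz (Complex.normSq_pos.2 fun h => by simp [h] at hz)

theorem ne_zero_of_re_pos {z : ℂ} (hz : 0 < z.re) : z ≠ 0 := fun h => by simp [h] at hz

theorem log_inv_of_re_pos {z : ℂ} (hz : 0 < z.re) : Complex.log z⁻¹ = -Complex.log z :=
  Complex.log_inv z (Complex.mem_slitPlane_iff_arg.1 (Or.inl hz)).1

theorem HasFrame.comp_inv {f : ℂ × ℂ → ℂ} {p : ℂ × ℂ} {a b c d : ℂ} (hp : p.2 ≠ 0)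
    (h : HasFrame f (p.1, p.2⁻¹) a b c d) :
    HasFrame (fun s => f (s.1, s.2⁻¹)) p a b (c * (-(p.2 ^ 2)⁻¹)) (d * conj (-(p.2 ^ 2)⁻¹)) := by
  have h1 : HasFDerivAt (fun s : ℂ × ℂ => (s.1, s.2⁻¹))
      ((ContinuousLinearMap.fst ℝ ℂ ℂ).prod
        (frameForm 0 0 (-(p.2 ^ 2)⁻¹) 0)) p := by
    refine hasFDerivAt_fst.prodMk ?_
    exact (hasFrame_snd.comp_holomorphic (hasDerivAt_inv hp)).congr_coeff (by ring) (by ring)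
      (by ring) (by ring)
  have h2 := HasFDerivAt.comp p (f := fun s : ℂ × ℂ => (s.1, s.2⁻¹)) (g := f) h h1
  refine HasFDerivAt.congr_fderiv h2 ?_
  ext v <;> simp [frameForm_apply]
  ring

theorem hasFrame_two_re_mul_log {p : ℂ × ℂ} (hp : 0 < p.2.re) :
    HasFrame (fun s => s.1 * Complex.log s.2 + conj (s.1 * Complex.log s.2)) p
      (Complex.log p.2 + conj (Complex.log p.2))
      (Complex.I * Complex.log p.2 - Complex.I * conj (Complex.log p.2))
      (p.1 * p.2⁻¹) (conj (p.1 * p.2⁻¹)) := by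
  have h1 := hasFrame_fst.mul (hasFrame_snd.comp_holomorphic (p := p)
    (Complex.hasDerivAt_log (Or.inl hp)))
  refine (h1.add h1.conj).congr_coeff ?_ ?_ ?_ ?_ <;> simp
  ring

/-- Every term of (H) is multiplied by `|z|⁻⁴`. The chain rule supplies this factor on the left. The
added function `-2(q ln z + q̄ ln z̄)` contributes nothing to the second derivatives that occur in
(H), but shifts `ψ_q + ψ_q̄` by `-2(ln z + ln z̄)`, which gives the same factor on the right. -/
theorem isHCMASolution_inversion {ψ ψ' : ℂ × ℂ → ℝ} {D D' : Set (ℂ × ℂ)} (hD' : IsOpen D')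
    (hψ' : ContDiffOn ℝ ∞ ψ' D') (h : IsHCMASolution ψ D)
    (hre : ∀ p ∈ D', 0 < p.2.re) (hmem : ∀ p ∈ D', (p.1, p.2⁻¹) ∈ D)
    (heq : ∀ p ∈ D', ψ' p = ψ (p.1, p.2⁻¹) + 4 * (p.1 * Complex.log p.2⁻¹).re) :
    IsHCMASolution ψ' D' := by
  obtain ⟨hD, hψ, hH⟩ := h
  refine ⟨hD', hψ', fun p hp => ?_⟩
  have hs : ContDiffOn ℝ ∞ (toC ψ) D := Complex.ofRealCLM.contDiff.comp_contDiffOn hψ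
  have heqC : ∀ s ∈ D', toC ψ' s = toC ψ (s.1, s.2⁻¹)
      - 2 * (s.1 * Complex.log s.2 + conj (s.1 * Complex.log s.2)) := by
    intro s hs
    rw [Complex.add_conj]
    simp only [toC]
    rw [heq s hs, log_inv_of_re_pos (hre s hs)]
    push_cast
    simp only [mul_neg, Complex.neg_re]
    push_cast
    ring
  have hev {f g : ℂ × ℂ → ℂ} {s : ℂ × ℂ} (hs : s ∈ D') (hfg : ∀ s ∈ D', f s = g s) : f =ᶠ[𝓝 s] g :=
    Filter.eventuallyEq_of_mem (hD'.mem_nhds hs) hfg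
  have hfr : ∀ s ∈ D', HasFrame (toC ψ') s _ _ _ _ := fun s hs' =>
    (((hasFrame_of_contDiffOn hD hs (hmem s hs')).comp_inv (ne_zero_of_re_pos (hre s hs'))).sub
      ((hasFrame_two_re_mul_log (hre s hs')).const_mul 2)).congr_of_eventuallyEq (hev hs' heqC)
  have hlog : HasFrame (fun s : ℂ × ℂ => Complex.log s.2) p 0 0 p.2⁻¹ 0 :=
    (hasFrame_snd.comp_holomorphic (p := p) (Complex.hasDerivAt_log (Or.inl (hre p hp)))).congr_coeff
      (by ring) (by ring) (by ring) (by ring)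
  have hq0 : p.2 ≠ 0 := ne_zero_of_re_pos (hre p hp)
  have hinv : HasFrame (fun s : ℂ × ℂ => s.2⁻¹) p 0 0 (-(p.2 ^ 2)⁻¹) 0 :=
    (hasFrame_snd.comp_holomorphic (p := p) (hasDerivAt_inv hq0)).congr_coeff
      (by ring) (by ring) (by ring) (by ring)
  have hX := ((hasFrame_of_contDiffOn hD (contDiffOn_dx hD hs) (hmem p hp)).comp_inv hq0).sub
    ((hlog.add hlog.conj).const_mul 2)
  have hX' := hX.congr_of_eventuallyEq (hev hp fun s hs' => (hfr s hs').dx_eq)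
  have hY := ((hasFrame_of_contDiffOn hD (contDiffOn_dy hD hs) (hmem p hp)).comp_inv hq0).sub
    (((hlog.const_mul Complex.I).sub (hlog.conj.const_mul Complex.I)).const_mul 2)
  have hY' := hY.congr_of_eventuallyEq (hev hp fun s hs' => (hfr s hs').dy_eq)
  have hZ := (((hasFrame_of_contDiffOn hD (contDiffOn_dz hD hs) (hmem p hp)).comp_inv hq0).mul
    (((hinv.mul hinv).const_mul (-1)))).sub ((hasFrame_fst.mul hinv).const_mul 2)
  have hZ' := hZ.congr_of_eventuallyEq (hev hp fun s hs' => (hfr s hs').dz_eq.trans (by ring))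
  have hW := (((hasFrame_of_contDiffOn hD (contDiffOn_dzbar hD hs) (hmem p hp)).comp_inv hq0).mul
    (((hinv.mul hinv).const_mul (-1)).conj)).sub ((hasFrame_fst.mul hinv).conj.const_mul 2)
  have hW' := hW.congr_of_eventuallyEq (hev hp fun s hs' => (hfr s hs').dzbar_eq.trans (by
    congr 3; ring))
  have hq : HasFrame (dq (toC ψ')) p _ _ _ _ :=
    ((hX'.sub (hY'.const_mul Complex.I)).const_mul (1 / 2)).congr_of_eventuallyEq
      (Filter.Eventually.of_forall fun s => by simp only [dq, dx, dy]; ring)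
  have hqbar : HasFrame (dqbar (toC ψ')) p _ _ _ _ :=
    ((hX'.add (hY'.const_mul Complex.I)).const_mul (1 / 2)).congr_of_eventuallyEq
      (Filter.Eventually.of_forall fun s => by simp only [dqbar, dx, dy]; ring)
  have hsX := hasFrame_of_contDiffOn hD (contDiffOn_dx hD hs) (hmem p hp)
  have hsY := hasFrame_of_contDiffOn hD (contDiffOn_dy hD hs) (hmem p hp)
  have hsq : HasFrame (dq (toC ψ)) (p.1, p.2⁻¹) _ _ _ _ :=
    ((hsX.sub (hsY.const_mul Complex.I)).const_mul (1 / 2)).congr_of_eventuallyEq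
      (Filter.Eventually.of_forall fun s => by simp only [dq, dx, dy]; ring)
  have hsqbar : HasFrame (dqbar (toC ψ)) (p.1, p.2⁻¹) _ _ _ _ :=
    ((hsX.add (hsY.const_mul Complex.I)).const_mul (1 / 2)).congr_of_eventuallyEq
      (Filter.Eventually.of_forall fun s => by simp only [dqbar, dx, dy]; ring)
  have key := hH _ (hmem p hp)
  have hI := Complex.I_sq
  have e1 : dq (dqbar (toC ψ')) p = dq (dqbar (toC ψ)) (p.1, p.2⁻¹) := by
    rw [hqbar.dq_eq, hsqbar.dq_eq]; simp
  have e2 : dq (dq (toC ψ')) p = dq (dq (toC ψ)) (p.1, p.2⁻¹) := by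
    rw [hq.dq_eq, hsq.dq_eq]; simp
  have e3 : dqbar (dqbar (toC ψ')) p = dqbar (dqbar (toC ψ)) (p.1, p.2⁻¹) := by
    rw [hqbar.dqbar_eq, hsqbar.dqbar_eq]; simp
  have e4 : dz (dzbar (toC ψ')) p
      = (p.2⁻¹ * conj p.2⁻¹) ^ 2 * dz (dzbar (toC ψ)) (p.1, p.2⁻¹) := by
    rw [hW'.dz_eq]; simp; ring
  have e5 : dq (dzbar (toC ψ')) p = -(conj p.2⁻¹) ^ 2 * dq (dzbar (toC ψ)) (p.1, p.2⁻¹) := by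
    rw [hW'.dq_eq]
    have : dq (dzbar (toC ψ)) (p.1, p.2⁻¹) = (dx (dzbar (toC ψ)) (p.1, p.2⁻¹)
      - Complex.I * dy (dzbar (toC ψ)) (p.1, p.2⁻¹)) / 2 := rfl
    rw [this]
    simp
    linear_combination (-(conj p.2)⁻¹) * hI
  have e6 : dqbar (dz (toC ψ')) p = -(p.2⁻¹) ^ 2 * dqbar (dz (toC ψ)) (p.1, p.2⁻¹) := by
    rw [hZ'.dqbar_eq]
    have : dqbar (dz (toC ψ)) (p.1, p.2⁻¹) = (dx (dz (toC ψ)) (p.1, p.2⁻¹)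
      + Complex.I * dy (dz (toC ψ)) (p.1, p.2⁻¹)) / 2 := rfl
    rw [this]
    simp
    linear_combination (-(p.2)⁻¹) * hI
  have e7 : Complex.exp (dq (toC ψ') p + dqbar (toC ψ') p) = (p.2⁻¹ * conj p.2⁻¹) ^ 2
      * Complex.exp (dq (toC ψ) (p.1, p.2⁻¹) + dqbar (toC ψ) (p.1, p.2⁻¹)) := by
    have e (φ : ℂ × ℂ → ℂ) (s : ℂ × ℂ) : dq φ s + dqbar φ s = dx φ s := by
      simp only [dq, dqbar, dx]; ring
    rw [e, e, (hfr p hp).dx_eq, Complex.exp_sub, two_mul, Complex.exp_add, Complex.exp_add,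
      Complex.exp_conj, Complex.exp_log hq0, div_eq_mul_inv, mul_comm]
    congr 1
    rw [map_inv₀, ← mul_inv, sq, mul_inv]
  rw [e1, e2, e3, e4, e5, e6, e7]
  linear_combination (p.2⁻¹ * conj p.2⁻¹) ^ 2 * key

/-- The involution `(q, z, ψ) ↦ (q, 1/z, ψ + 2 q ln z + 2 q̄ ln z̄)` of the half space `re z > 0`. -/
def inversion : OpenPartialHomeomorph (ℂ × ℂ × ℝ) (ℂ × ℂ × ℝ) where
  toFun s := (s.1, s.2.1⁻¹, s.2.2 + 4 * (s.1 * Complex.log s.2.1).re)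
  invFun s := (s.1, s.2.1⁻¹, s.2.2 + 4 * (s.1 * Complex.log s.2.1).re)
  source := {s | 0 < s.2.1.re}
  target := {s | 0 < s.2.1.re}
  map_source' _ hs := inv_re_pos hs
  map_target' _ hs := inv_re_pos hs
  left_inv' s hs := by ext <;> simp [log_inv_of_re_pos hs]; ring
  right_inv' s hs := by ext <;> simp [log_inv_of_re_pos hs]; ring
  open_source := isOpen_lt continuous_const (by fun_prop)
  open_target := isOpen_lt continuous_const (by fun_prop)
  continuousOn_toFun := by
    refine continuousOn_fst.prodMk (ContinuousOn.prodMk ?_ ?_)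
    · exact (continuous_fst.comp continuous_snd).continuousOn.inv₀ fun s hs => ne_zero_of_re_pos hs
    · refine (continuous_snd.comp continuous_snd).continuousOn.add (continuousOn_const.mul ?_)
      refine Complex.continuous_re.comp_continuousOn (continuousOn_fst.mul ?_)
      exact (continuous_fst.comp continuous_snd).continuousOn.clog fun s hs => Or.inl hs
  continuousOn_invFun := by
    refine continuousOn_fst.prodMk (ContinuousOn.prodMk ?_ ?_)
    · exact (continuous_fst.comp continuous_snd).continuousOn.inv₀ fun s hs => ne_zero_of_re_pos hs
    · refine (continuous_snd.comp continuous_snd).continuousOn.add (continuousOn_const.mul ?_)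
      refine Complex.continuous_re.comp_continuousOn (continuousOn_fst.mul ?_)
      exact (continuous_fst.comp continuous_snd).continuousOn.clog fun s hs => Or.inl hs

theorem inversion_apply (s : ℂ × ℂ × ℝ) :
    inversion s = (s.1, s.2.1⁻¹, s.2.2 + 4 * (s.1 * Complex.log s.2.1).re) := rfl

theorem contDiffOn_inversion : ContDiffOn ℝ ∞ inversion inversion.source := by
  intro s hs
  have h1 : ContDiffAt ℝ ∞ (fun s : ℂ × ℂ × ℝ => s.2.1) s := by fun_prop
  have h2 : ContDiffAt ℝ ∞ (fun s : ℂ × ℂ × ℝ => Complex.log s.2.1) s := by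
    have h := (Complex.contDiffAt_log (n := ∞) (x := s.2.1) (Or.inl hs)).restrict_scalars ℝ
    exact h.comp s h1
  refine ContDiffAt.contDiffWithinAt (contDiffAt_fst.prodMk (ContDiffAt.prodMk ?_ ?_))
  · exact ((contDiffAt_inv ℂ (ne_zero_of_re_pos hs) (n := ∞)).restrict_scalars ℝ).comp s h1
  · exact (contDiffAt_snd.comp s contDiffAt_snd).add (contDiffAt_const.mul
      (Complex.reCLM.contDiff.contDiffAt.comp s (contDiffAt_fst.mul h2)))

theorem isHCMASolution_of_transforms_inversion {ψ ψ' : ℂ × ℂ → ℝ} {D D' : Set (ℂ × ℂ)}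
    (hD' : IsOpen D') (hψ' : ContDiffOn ℝ ∞ ψ' D') (ht : Transforms inversion ψ D ψ' D')
    (h : IsHCMASolution ψ D) : IsHCMASolution ψ' D' := by
  have key : ∀ p ∈ D', 0 < p.2.re ∧ (p.1, p.2⁻¹) ∈ D ∧
      ψ' p = ψ (p.1, p.2⁻¹) + 4 * (p.1 * Complex.log p.2⁻¹).re := by
    intro p hp
    have : (p.1, p.2, ψ' p) ∈ inversion '' graphOver ψ D := by
      rw [ht.2]; exact ⟨p, hp, rfl⟩
    obtain ⟨_, ⟨s, hs, rfl⟩, hsp⟩ := this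
    have hpos : 0 < s.2.re := ht.1 ⟨s, hs, rfl⟩
    rw [inversion_apply] at hsp
    simp only [Prod.mk.injEq] at hsp
    obtain ⟨h1, h2, h3⟩ := hsp
    rw [← h2, ← h1, inv_inv]
    exact ⟨inv_re_pos hpos, hs, h3.symm⟩
  exact isHCMASolution_inversion hD' hψ' h (fun p hp => (key p hp).1) (fun p hp => (key p hp).2.1)
    (fun p hp => (key p hp).2.2)

/-- The inversion is an involution, so one direction of the symmetry property yields the other. -/
theorem transforms_inversion_symm {ψ ψ' : ℂ × ℂ → ℝ} {D D' : Set (ℂ × ℂ)}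
    (ht : Transforms inversion ψ D ψ' D') : Transforms inversion ψ' D' ψ D := by
  constructor
  · rw [← ht.2]
    rintro _ ⟨s, hs, rfl⟩
    exact inversion.map_source (ht.1 hs)
  · rw [← ht.2, Set.image_image]
    conv_rhs => rw [← Set.image_id (graphOver ψ D)]
    exact Set.image_congr fun s hs => inversion.left_inv (ht.1 hs)

theorem isHCMASymmetry_inversion : IsHCMASymmetry inversion :=
  ⟨contDiffOn_inversion, contDiffOn_inversion, fun _ _ _ _ hD hD' hψ hψ' ht =>
    ⟨isHCMASolution_of_transforms_inversion hD' hψ' ht,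
      isHCMASolution_of_transforms_inversion hD hψ (transforms_inversion_symm ht)⟩⟩

/-! ### The identity symmetry -/

theorem isHCMASolution_congr {ψ ψ' : ℂ × ℂ → ℝ} {D : Set (ℂ × ℂ)} (heq : ∀ p ∈ D, ψ' p = ψ p)
    (h : IsHCMASolution ψ D) : IsHCMASolution ψ' D := by
  obtain ⟨hD, hψ, hH⟩ := h
  refine ⟨hD, hψ.congr heq, fun p hp => ?_⟩
  have h0 : ∀ s ∈ D, toC ψ' s = toC ψ s := fun s hs => by simp only [toC, heq s hs]
  have h1 : ∀ s ∈ D, dq (toC ψ') s = dq (toC ψ) s := fun s hs => dq_congr_on hD h0 hs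
  have h2 : ∀ s ∈ D, dqbar (toC ψ') s = dqbar (toC ψ) s := fun s hs => dqbar_congr_on hD h0 hs
  have h3 : ∀ s ∈ D, dz (toC ψ') s = dz (toC ψ) s := fun s hs => dz_congr_on hD h0 hs
  have h4 : ∀ s ∈ D, dzbar (toC ψ') s = dzbar (toC ψ) s := fun s hs => dzbar_congr_on hD h0 hs
  rw [dq_congr_on hD h2 hp, dz_congr_on hD h4 hp, dq_congr_on hD h4 hp, dqbar_congr_on hD h3 hp,
    h1 p hp, h2 p hp, dq_congr_on hD h1 hp, dqbar_congr_on hD h2 hp]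
  exact hH p hp

theorem eq_of_graphOver_eq {ψ ψ' : ℂ × ℂ → ℝ} {D D' : Set (ℂ × ℂ)}
    (h : graphOver ψ D = graphOver ψ' D') : D = D' ∧ ∀ p ∈ D, ψ' p = ψ p := by
  have key {ψ ψ' : ℂ × ℂ → ℝ} {D D' : Set (ℂ × ℂ)} (h : graphOver ψ D = graphOver ψ' D')
      (p : ℂ × ℂ) (hp : p ∈ D) : p ∈ D' ∧ ψ' p = ψ p := by
    have : (p.1, p.2, ψ p) ∈ graphOver ψ' D' := by rw [← h]; exact ⟨p, hp, rfl⟩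
    obtain ⟨s, hs, hsp⟩ := this
    simp only [Prod.mk.injEq] at hsp
    have e : s = p := Prod.ext hsp.1 hsp.2.1
    exact ⟨e ▸ hs, e ▸ hsp.2.2⟩
  exact ⟨Set.Subset.antisymm (fun p hp => (key h p hp).1) (fun p hp => (key h.symm p hp).1),
    fun p hp => (key h p hp).2⟩

theorem isHCMASymmetry_refl :
    IsHCMASymmetry (OpenPartialHomeomorph.refl (ℂ × ℂ × ℝ)) := by
  refine ⟨contDiff_id.contDiffOn, contDiff_id.contDiffOn,
    fun ψ ψ' D D' _ _ _ _ ht => ?_⟩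
  obtain ⟨rfl, he⟩ := eq_of_graphOver_eq (by simpa using ht.2 : graphOver ψ D = graphOver ψ' D')
  exact ⟨isHCMASolution_congr he, isHCMASolution_congr fun p hp => (he p hp).symm⟩

theorem transforms_refl (ψ : ℂ × ℂ → ℝ) (D : Set (ℂ × ℂ)) :
    Transforms (OpenPartialHomeomorph.refl (ℂ × ℂ × ℝ)) ψ D ψ D :=
  ⟨fun _ _ => trivial, by simp⟩

/-! ### Smoothness of integrals depending on a parameter -/

section ParametricIntegral

open MeasureTheory

universe u

variable {H : Type u} [NormedAddCommGroup H] [NormedSpace ℝ H]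

theorem hasFDerivAt_integral_unit {V : Type u} [NormedAddCommGroup V] [NormedSpace ℝ V]
    [CompleteSpace V] {f : H × ℝ → V} {W : Set (H × ℝ)} (hW : IsOpen W)
    (hf : ContDiffOn ℝ ∞ f W) {p : H} (hp : ∀ t ∈ Set.Icc (0 : ℝ) 1, (p, t) ∈ W) :
    HasFDerivAt (fun x => ∫ t in (0 : ℝ)..1, f (x, t))
      (∫ t in (0 : ℝ)..1, (fderiv ℝ f (p, t)).comp (ContinuousLinearMap.inl ℝ H ℝ)) p := by
  set f' : H × ℝ → H →L[ℝ] V := fun s => (fderiv ℝ f s).comp (ContinuousLinearMap.inl ℝ H ℝ)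
  have hf'c : ContinuousOn f' W :=
    ((hf.fderiv_of_isOpen hW (m := 0) (by simp)).continuousOn).clm_comp continuousOn_const
  have hcurve (x : H) : Continuous fun t : ℝ => (x, t) := by fun_prop
  have hf'p : ContinuousOn (fun t => f' (p, t)) (Set.Icc 0 1) :=
    hf'c.comp (hcurve p).continuousOn hp
  obtain ⟨C, hC⟩ := (isCompact_Icc (a := (0 : ℝ)) (b := 1)).exists_bound_of_continuousOn hf'p
  -- The derivative is bounded by `C` on the compact segment over `p`, hence by `C + 1` on an open
  -- set around it. The tube lemma extracts a product neighbourhood, on which the constant `C + 1`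
  -- dominates.
  have hO : IsOpen (W ∩ (fun s => ‖f' s‖) ⁻¹' Set.Iio (C + 1)) :=
    hf'c.norm.isOpen_inter_preimage hW isOpen_Iio
  obtain ⟨u, v, hu, -, hpu, hv, huv⟩ := generalized_tube_lemma (isCompact_singleton (x := p))
    (isCompact_Icc (a := (0 : ℝ)) (b := 1)) hO (by
      rintro ⟨x, t⟩ ⟨rfl, ht⟩
      exact ⟨hp t ht, lt_of_le_of_lt (hC t ht) (by linarith)⟩)
  have hpu' : u ∈ 𝓝 p := hu.mem_nhds (hpu rfl)
  have hIoc : Set.uIoc (0 : ℝ) 1 ⊆ Set.Icc 0 1 := by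
    rw [Set.uIoc_of_le zero_le_one]; exact Set.Ioc_subset_Icc_self
  have hmem {x : H} (hx : x ∈ u) {t : ℝ} (ht : t ∈ Set.Icc (0 : ℝ) 1) : (x, t) ∈ W :=
    (huv ⟨hx, hv ht⟩).1
  have hfc {x : H} (hx : x ∈ u) : ContinuousOn (fun t => f (x, t)) (Set.Icc 0 1) :=
    hf.continuousOn.comp (hcurve x).continuousOn fun t ht => hmem hx ht
  have hmeas {E : Type u} [NormedAddCommGroup E] {g : ℝ → E} (hg : ContinuousOn g (Set.Icc 0 1)) :
      AEStronglyMeasurable g (volume.restrict (Set.uIoc 0 1)) :=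
    (hg.mono hIoc).aestronglyMeasurable measurableSet_uIoc
  refine intervalIntegral.hasFDerivAt_integral_of_dominated_of_fderiv_le (F := fun x t => f (x, t))
    (F' := fun x t => f' (x, t)) (bound := fun _ => C + 1) hpu' ?_ ?_ ?_ ?_ ?_ ?_
  · filter_upwards [hpu'] with x hx using hmeas (hfc hx)
  · refine ContinuousOn.intervalIntegrable ?_
    rw [Set.uIcc_of_le zero_le_one]; exact hfc (hpu rfl)
  · exact hmeas hf'p
  · exact Filter.Eventually.of_forall fun t ht x hx => (huv ⟨hx, hv (hIoc ht)⟩).2.le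
  · exact intervalIntegrable_const
  · refine Filter.Eventually.of_forall fun t ht x hx => ?_
    have h1 : HasFDerivAt f (fderiv ℝ f (x, t)) (x, t) :=
      ((hf.contDiffAt (hW.mem_nhds (hmem hx (hIoc ht)))).differentiableAt (by simp)).hasFDerivAt
    exact HasFDerivAt.comp x (f := fun x => (x, t)) h1 (hasFDerivAt_prodMk_left x t)

/-- The derivative of the integral is again an integral of the same kind, with values in `H →L[ℝ]
V`. The induction on the order of differentiability therefore runs over all target spaces, and `H`
and `V` share a universe so that this space stays in it. -/
theorem contDiffOn_integral_unit {V : Type u} [NormedAddCommGroup V] [NormedSpace ℝ V]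
    [CompleteSpace V] {f : H × ℝ → V} {W : Set (H × ℝ)} {U : Set H} (hW : IsOpen W) (hU : IsOpen U)
    (hf : ContDiffOn ℝ ∞ f W) (hUW : ∀ p ∈ U, ∀ t ∈ Set.Icc (0 : ℝ) 1, (p, t) ∈ W) :
    ContDiffOn ℝ ∞ (fun x => ∫ t in (0 : ℝ)..1, f (x, t)) U := by
  rw [contDiffOn_infty]
  intro n
  induction n generalizing V with
  | zero =>
    rw [Nat.cast_zero, contDiffOn_zero]
    exact fun p hp =>
      (hasFDerivAt_integral_unit hW hf (hUW p hp)).continuousAt.continuousWithinAt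
  | succ n ih =>
    rw [Nat.cast_succ, contDiffOn_succ_iff_fderiv_of_isOpen hU]
    refine ⟨fun p hp =>
      (hasFDerivAt_integral_unit hW hf (hUW p hp)).differentiableAt.differentiableWithinAt,
      by simp, ?_⟩
    have h1 : ContDiffOn ℝ ∞
        (fun s => (fderiv ℝ f s).comp (ContinuousLinearMap.inl ℝ H ℝ)) W :=
      (hf.fderiv_of_isOpen hW (by simp)).clm_comp contDiffOn_const
    exact (ih h1).congr fun p hp => (hasFDerivAt_integral_unit hW hf (hUW p hp)).fderiv

/-- The substitution `t = y₁ + (y - y₁) τ` moves the variable endpoint into the integrand. Convexity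
of `I` keeps the new argument inside the domain. -/
theorem contDiffOn_intervalIntegral {V : Type u} [NormedAddCommGroup V] [NormedSpace ℝ V]
    [CompleteSpace V] {H : Type u} [NormedAddCommGroup H] [NormedSpace ℝ H]
    {f : H × ℝ → V} {U : Set H} {I : Set ℝ} (hU : IsOpen U) (hI : IsOpen I)
    (hI' : I.OrdConnected) {y₁ : ℝ} (hy₁ : y₁ ∈ I) (hf : ContDiffOn ℝ ∞ f (U ×ˢ I)) :
    ContDiffOn ℝ ∞ (fun s : H × ℝ => ∫ t in y₁..s.2, f (s.1, t)) (U ×ˢ I) := by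
  have e : (fun s : H × ℝ => ∫ t in y₁..s.2, f (s.1, t))
      = fun s => (s.2 - y₁) • ∫ t in (0 : ℝ)..1, f (s.1, y₁ + (s.2 - y₁) * t) := by
    ext s
    rw [intervalIntegral.smul_integral_comp_add_mul (fun t => f (s.1, t))]
    simp
  have hg : ContDiff ℝ ∞ (fun s : (H × ℝ) × ℝ => (s.1.1, y₁ + (s.1.2 - y₁) * s.2)) := by fun_prop
  have hO : IsOpen ((fun s : (H × ℝ) × ℝ => (s.1.1, y₁ + (s.1.2 - y₁) * s.2)) ⁻¹' (U ×ˢ I)) :=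
    (hU.prod hI).preimage hg.continuous
  rw [e]
  refine (contDiff_snd.sub contDiff_const).contDiffOn.smul
    (contDiffOn_integral_unit hO (hU.prod hI) (hf.comp hg.contDiffOn fun s hs => hs) ?_)
  rintro ⟨x, y⟩ ⟨hx, hy⟩ t ht
  refine ⟨hx, ?_⟩
  have h1 := hI'.convex hy₁ hy (sub_nonneg.2 ht.2) ht.1 (by ring)
  have h2 : y₁ + (y - y₁) * t = (1 - t) • y₁ + t • y := by simp only [smul_eq_mul]; ring
  simpa [h2] using h1

end ParametricIntegral

open IsAnsatz

/-! ### The listed functions are solutions -/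

section OneVariable

variable {f : ℂ → ℂ} {p : ℂ × ℂ}

theorem fderiv_comp_snd (hf : DifferentiableAt ℝ f p.2) (v : ℂ × ℂ) :
    fderiv ℝ (fun s : ℂ × ℂ => f s.2) p v = fderiv ℝ f p.2 v.2 := by
  have : HasFDerivAt (fun s : ℂ × ℂ => f s.2)
      ((fderiv ℝ f p.2).comp (ContinuousLinearMap.snd ℝ ℂ ℂ)) p :=
    HasFDerivAt.comp p (f := Prod.snd) hf.hasFDerivAt hasFDerivAt_snd
  rw [this.fderiv]
  rfl

theorem dz_comp_snd (hf : DifferentiableAt ℝ f p.2) :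
    dz (fun s : ℂ × ℂ => f s.2) p = wz f p.2 := by
  simp only [dz, wz, fderiv_comp_snd hf]

theorem dzbar_comp_snd (hf : DifferentiableAt ℝ f p.2) :
    dzbar (fun s : ℂ × ℂ => f s.2) p = wzbar f p.2 := by
  simp only [dzbar, wzbar, fderiv_comp_snd hf]

theorem dz_dzbar_comp_snd {Ω : Set ℂ} (hΩ : IsOpen Ω) (hf : ContDiffOn ℝ ∞ f Ω) (hp : p.2 ∈ Ω) :
    dz (dzbar (fun s : ℂ × ℂ => f s.2)) p = wz (wzbar f) p.2 := by
  have hd (z) (hz : z ∈ Ω) : DifferentiableAt ℝ f z :=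
    (hf.contDiffAt (hΩ.mem_nhds hz)).differentiableAt (by simp)
  have hf' : ContDiffOn ℝ ∞ (fderiv ℝ f) Ω := hf.fderiv_of_isOpen hΩ (by simp)
  have hw : ContDiffOn ℝ ∞ (wzbar f) Ω :=
    ((hf'.clm_apply contDiffOn_const).add
      (contDiffOn_const.mul (hf'.clm_apply contDiffOn_const))).div_const _
  rw [dz_congr_on (hΩ.preimage continuous_snd) (fun s hs => dzbar_comp_snd (hd _ hs)) hp]
  exact dz_comp_snd ((hw.contDiffAt (hΩ.mem_nhds hp)).differentiableAt (by simp))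

end OneVariable

theorem dz_dzbar_comp_im_eq_zero (r : ℝ → ℝ) (p : ℂ × ℂ) :
    dz (liftF fun _ y => r y) p = 0 ∧ dzbar (liftF fun _ y => r y) p = 0 := by
  have key (v : ℂ) : fderiv ℝ (liftF fun _ y => r y) p (0, v) = 0 := by
    by_cases hd : DifferentiableAt ℝ (liftF fun _ y => r y) p
    · have h1 := hd.hasFDerivAt.hasLineDerivAt ((0 : ℂ), v)
      have h2 : (fun t : ℝ => liftF (fun _ y => r y) (p + t • ((0 : ℂ), v)))
          = fun _ => liftF (fun _ y => r y) p := by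
        ext t; simp [liftF, lift]
      unfold HasLineDerivAt at h1
      rw [h2] at h1
      exact h1.unique (hasDerivAt_const _ _)
    -- Again the default value zero of `fderiv` agrees with the claim.
    · simp [fderiv_zero_of_not_differentiableAt hd]
  simp [dz, dzbar, key]

/-- The listed functions are the case `b(z, y) = b(z) + iy` of the ansatz, because `x + iy = q`. -/
theorem isAnsatz_of_holomorphic {D : Set (ℂ × ℂ)} {I : Set ℝ} {Ω : Set ℂ} {b : ℂ → ℂ}
    {L : ℂ × ℂ → ℂ} {F : ℂ → ℝ → ℝ} {ψ : ℂ × ℂ → ℝ} (hD : IsDomainOver D I Ω)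
    (hb : DifferentiableOn ℂ b Ω) (hL : ContinuousOn L D)
    (hexp : ∀ p ∈ D, Complex.exp (L p) = p.1 + b p.2)
    (hF : ContDiffOn ℝ ∞ (fun s : ℂ × ℝ => F s.1 s.2) (Ω ×ˢ I))
    (hψ : ∀ p ∈ D, (ψ p : ℂ) = (p.1 + b p.2) * L p + (conj p.1 + conj (b p.2)) * conj (L p)
      - (p.1 + conj p.1) * (Complex.log (p.2 + conj p.2) + 1) + (F p.2 p.1.im : ℂ)) :
    IsAnsatz D I Ω (fun z y => b z + Complex.I * y) F L ψ where
  domain := hD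
  holomorphic_b _ _ := hb.add_const _
  smooth_b := by
    have h1 : ContDiffOn ℝ ∞ b Ω := (hb.contDiffOn hD.isOpen_Ω (n := ∞)).restrict_scalars ℝ
    have h2 : ContDiff ℝ ∞ (fun s : ℂ × ℝ => Complex.I * (s.2 : ℂ)) :=
      contDiff_const.mul (Complex.ofRealCLM.contDiff.comp contDiff_snd)
    exact (h1.comp contDiffOn_fst fun s hs => hs.1).add h2.contDiffOn
  smooth_F := hF
  continuous_L := hL
  exp_L p hp := by
    rw [hexp p hp]
    conv_lhs => rw [← Complex.re_add_im p.1]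
    ring
  eq p hp := by
    rw [hψ p hp, Complex.add_conj]
    have h1 : p.1 = p.1.re + Complex.I * p.1.im := by rw [mul_comm, Complex.re_add_im]
    have h2 : conj p.1 = p.1.re - Complex.I * p.1.im := by apply Complex.ext <;> simp
    rw [h2]
    nth_rewrite 1 [h1]
    simp only [map_add, map_mul, Complex.conj_I, Complex.conj_ofReal]
    push_cast
    ring

/-- A function `(q + b) ln (q + b) + c.c. - (q + q̄) [ln (z + z̄) + 1] + F` is a solution of both
equations if `F_{z z̄}` is the prescribed one and `φ = F_{y z}` satisfies `(z + z̄) |φ|² = 4 re (iφ)`. -/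
theorem IsAnsatz.isSolution {D : Set (ℂ × ℂ)} {I : Set ℝ} {Ω : Set ℂ} {b : ℂ → ℂ}
    {L : ℂ × ℂ → ℂ} {F : ℂ → ℝ → ℝ} {ψ : ℂ × ℂ → ℝ}
    (h : IsAnsatz D I Ω (fun z y => b z + Complex.I * y) F L ψ)
    (hF : ∀ p ∈ cylinder Ω I, dz (dzbar (liftF F)) p = (b p.2 + conj (b p.2)) / (p.2 + conj p.2) ^ 2)
    (hφ : ∀ p ∈ cylinder Ω I, (p.2 + conj p.2) * (dy (dz (liftF F)) p * conj (dy (dz (liftF F)) p))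
      = 2 * (Complex.I * dy (dz (liftF F)) p + conj (Complex.I * dy (dz (liftF F)) p))) :
    IsBFSolution ψ D ∧ IsHCMASolution ψ D := by
  have hBF : ∀ p ∈ D, dz (dzbar (toC ψ)) p = Complex.exp (dx (toC ψ) p) * dx (dx (toC ψ)) p := by
    intro p hp
    rw [h.boyerFinley_iff hp, hF p (h.mem_cylinder hp)]
    congr 1
    simp only [lift, map_add, map_mul, Complex.conj_I, Complex.conj_ofReal]
    ring
  refine ⟨⟨h.domain.isOpen, h.contDiffOn, hBF⟩, ⟨h.domain.isOpen, h.contDiffOn, fun p hp => ?_⟩⟩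
  rw [h.mongeAmpere_iff hp (hBF p hp)]
  have hS := h.isOpen_cylinder
  have hdy : ∀ s ∈ cylinder Ω I, dy (lift fun z y => b z + Complex.I * y) s = Complex.I := by
    intro s hs
    refine (h.hasFrame_b hs).hasDerivAt_im.unique ?_
    simp only [lift]
    simpa using ((Complex.ofRealCLM.hasDerivAt (x := s.1.im)).const_mul Complex.I).const_add (b s.2)
  have hpc := h.mem_cylinder hp
  have hdyz : dy (dz (lift fun z y => b z + Complex.I * y)) p = 0 := by
    rw [dy_dz_comm hS h.contDiffOn_b hpc, dz_congr_on hS hdy hpc]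
    exact (hasFrame_const _).dz_eq
  have key := hφ p hpc
  have hθ := add_conj_ne_zero (h.re_pos hp)
  simp only [mixed, pure, hdy p hpc, hdyz, map_add, map_mul, map_sub, map_one, map_zero, map_ofNat,
    map_div₀, Complex.conj_conj, Complex.conj_I] at key ⊢
  generalize dy (dz (liftF F)) p = φ at *
  generalize conj φ = φ' at *
  generalize arg (fun z y => b z + Complex.I * y) p = B at *
  generalize conj B = B' at *
  rw [add_comm (conj p.2) p.2]
  generalize p.2 + conj p.2 = θ at *
  have hI := Complex.I_sq
  -- With `b_y = i` the factor `1 + i b_y` vanishes and `1 + i conj(b_y) = 2`. So `mixed` is `B (iφ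
  -- - 2/θ)` and `pure` is `2B`, and `|B|²` divides out of the equation.
  have e1 : 1 + Complex.I * Complex.I = 0 := by rw [Complex.I_mul_I]; ring
  have e2 : 1 + Complex.I * -Complex.I = 2 := by rw [mul_neg, Complex.I_mul_I]; ring
  have e3 : 1 + -Complex.I * -Complex.I = 0 := by rw [neg_mul_neg, Complex.I_mul_I]; ring
  have e4 : 1 + -Complex.I * conj (-Complex.I) = 2 := by
    rw [map_neg, Complex.conj_I, neg_neg, neg_mul, Complex.I_mul_I]; ring
  rw [e1, e2, e3, e4]
  field_simp
  ring_nf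
  ring_nf at key
  rw [hI]
  linear_combination (B * B' * θ) * key

/-! ### The angular terms of the listed functions -/

/-- The function `2i ln ((z̄ + 2ik) / (z - 2ik))`, written as a real function of `z` and `y`. -/
def angle (k : ℝ → ℝ) (z : ℂ) (y : ℝ) : ℝ := 4 * (Complex.log (z - 2 * Complex.I * k y)).im

theorem re_sub_two_I_mul (z : ℂ) (k : ℝ) : (z - 2 * Complex.I * k).re = z.re := by simp

/-- For `Re w > 0` the argument lies in `(-π/2, π/2)`, so `-2 arg w` stays in the principal strip.
-/
theorem log_conj_div {w : ℂ} (hw : 0 < w.re) :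
    Complex.log (conj w / w) = conj (Complex.log w) - Complex.log w := by
  have h0 := ne_zero_of_re_pos hw
  have harg : |w.arg| < Real.pi / 2 := Complex.abs_arg_lt_pi_div_two_iff.2 (Or.inl hw)
  have h1 := abs_lt.1 harg
  rw [← Complex.log_exp (x := conj (Complex.log w) - Complex.log w), Complex.exp_sub,
    Complex.exp_conj, Complex.exp_log h0]
  · simp [Complex.log_im]; linarith
  · simp [Complex.log_im]; linarith

theorem angle_eq {z : ℂ} (hz : 0 < z.re) (k : ℝ → ℝ) (y : ℝ) :
    (angle k z y : ℂ) = 2 * Complex.I * Complex.log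
      ((conj z + 2 * Complex.I * (k y : ℂ)) / (z - 2 * Complex.I * (k y : ℂ))) := by
  have h1 : conj z + 2 * Complex.I * (k y : ℂ) = conj (z - 2 * Complex.I * (k y : ℂ)) := by
    simp only [map_sub, map_mul, Complex.conj_I, Complex.conj_ofReal, map_ofNat]
    ring
  rw [h1, log_conj_div (by rwa [re_sub_two_I_mul])]
  have h2 := Complex.sub_conj (Complex.log (z - 2 * Complex.I * (k y : ℂ)))
  unfold angle
  push_cast at h2 ⊢
  linear_combination (2 * Complex.I) * h2
    + 4 * ((Complex.log (z - 2 * Complex.I * (k y : ℂ))).im : ℂ) * Complex.I_sq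

section Angle

variable {Ω : Set ℂ} {I : Set ℝ} {k : ℝ → ℝ} {y₁ : ℝ}

theorem contDiffOn_angle (hre : ∀ z ∈ Ω, 0 < z.re) (hk : ContDiffOn ℝ ∞ k I) :
    ContDiffOn ℝ ∞ (fun s : ℂ × ℝ => angle k s.1 s.2) (Ω ×ˢ I) := by
  have h1 : ContDiffOn ℝ ∞ (fun s : ℂ × ℝ => s.1 - 2 * Complex.I * (k s.2 : ℂ)) (Ω ×ˢ I) := by
    refine contDiffOn_fst.sub (contDiffOn_const.mul ?_)
    exact Complex.ofRealCLM.contDiff.comp_contDiffOn (hk.comp contDiffOn_snd fun s hs => hs.2)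
  have h2 : ContDiffOn ℝ ∞ (fun s : ℂ × ℝ => Complex.log (s.1 - 2 * Complex.I * (k s.2 : ℂ)))
      (Ω ×ˢ I) := fun s hs => by
    have h := (Complex.contDiffAt_log (n := ∞) (x := s.1 - 2 * Complex.I * (k s.2 : ℂ))
      (Or.inl (by rw [re_sub_two_I_mul]; exact hre _ hs.1))).restrict_scalars ℝ
    exact h.comp_contDiffWithinAt s (h1 s hs)
  exact contDiffOn_const.mul (Complex.imCLM.contDiff.comp_contDiffOn h2)

theorem hasFrame_sub_two_I_mul (hI : IsOpen I) (hk : ContDiffOn ℝ ∞ k I) {p : ℂ × ℂ}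
    (hp : p.1.im ∈ I) : ∃ e, HasFrame (fun s => s.2 - 2 * Complex.I * (k s.1.im : ℂ)) p 0 e 1 0 := by
  have hs : ContDiffOn ℝ ∞ (liftF fun _ y => k y) (cylinder Set.univ I) :=
    contDiffOn_lift (Complex.ofRealCLM.contDiff.comp_contDiffOn
      (hk.comp contDiffOn_snd fun s hs => hs.2))
  have h1 := (hasFrame_of_contDiffOn (isOpen_cylinder isOpen_univ hI) hs
    (p := p) ⟨trivial, hp⟩).congr_coeff ((xInvariant_lift _).dx_eq_zero p) rfl
    (dz_dzbar_comp_im_eq_zero k p).1 (dz_dzbar_comp_im_eq_zero k p).2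
  exact ⟨_, (hasFrame_snd.sub (h1.const_mul (2 * Complex.I))).congr_coeff (by ring) rfl (by ring)
    (by ring)⟩

theorem hasFrame_angle (hI : IsOpen I) (hk : ContDiffOn ℝ ∞ k I) {p : ℂ × ℂ} (hp : p.1.im ∈ I)
    (hre : 0 < p.2.re) : ∃ e, HasFrame (liftF (angle k)) p 0 e
      (-2 * Complex.I / (p.2 - 2 * Complex.I * k p.1.im))
      (2 * Complex.I / conj (p.2 - 2 * Complex.I * k p.1.im)) := by
  obtain ⟨e, h1⟩ := hasFrame_sub_two_I_mul hI hk hp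
  have h2 := h1.comp_holomorphic (Complex.hasDerivAt_log
    (Or.inl (by rw [re_sub_two_I_mul]; exact hre)))
  have h3 := ((h2.sub h2.conj).const_mul (-2 * Complex.I)).congr_of_eventuallyEq
    (g := liftF (angle k)) (Filter.Eventually.of_forall fun s => by
      simp only [liftF, lift, angle]
      rw [Complex.sub_conj]
      push_cast
      linear_combination (4 * ((Complex.log (s.2 - 2 * Complex.I * (k s.1.im : ℂ))).im : ℂ))
        * Complex.I_sq)
  refine ⟨_, h3.congr_coeff (by simp) rfl ?_ ?_⟩
  · simp only [map_mul, map_zero]; ring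
  · simp only [map_mul, map_inv₀, map_one]; ring

theorem dz_dzbar_angle (hΩ : IsOpen Ω) (hI : IsOpen I) (hre : ∀ z ∈ Ω, 0 < z.re)
    (hk : ContDiffOn ℝ ∞ k I) {p : ℂ × ℂ} (hp : p ∈ cylinder Ω I) :
    dz (dzbar (liftF (angle k))) p = 0 := by
  have hfr (s) (hs : s ∈ cylinder Ω I) := (hasFrame_angle hI hk hs.2 (hre _ hs.1)).choose_spec
  rw [dz_congr_on (isOpen_cylinder hΩ hI) (fun s hs => (hfr s hs).dzbar_eq) hp]
  obtain ⟨e, h1⟩ := hasFrame_sub_two_I_mul hI hk hp.2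
  have h0 : conj (p.2 - 2 * Complex.I * k p.1.im) ≠ 0 := by
    rw [Ne, map_eq_zero]
    exact ne_zero_of_re_pos (by rw [re_sub_two_I_mul]; exact hre _ hp.1)
  have h2 := (h1.conj.comp_holomorphic (hasDerivAt_inv h0)).const_mul (2 * Complex.I)
  rw [show (fun s : ℂ × ℂ => 2 * Complex.I / conj (s.2 - 2 * Complex.I * k s.1.im))
    = fun s => 2 * Complex.I * (conj (s.2 - 2 * Complex.I * k s.1.im))⁻¹ from
      funext fun s => div_eq_mul_inv _ _, h2.dz_eq]
  simp

/-- The integral of the angular term with respect to `y`. -/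
def angleIntegral (k : ℝ → ℝ) (y₁ : ℝ) (z : ℂ) (y : ℝ) : ℝ := ∫ t in y₁..y, angle k z t

theorem contDiffOn_angleIntegral (hΩ : IsOpen Ω) (hI : IsOpen I) (hI' : I.OrdConnected)
    (hre : ∀ z ∈ Ω, 0 < z.re) (hk : ContDiffOn ℝ ∞ k I) (hy₁ : y₁ ∈ I) :
    ContDiffOn ℝ ∞ (fun s : ℂ × ℝ => angleIntegral k y₁ s.1 s.2) (Ω ×ˢ I) := by
  have h := contDiffOn_intervalIntegral hΩ hI hI' hy₁ (contDiffOn_angle hre hk)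
  exact h

theorem hasDerivAt_angleIntegral (hI : IsOpen I) (hI' : I.OrdConnected)
    (hk : ContDiffOn ℝ ∞ k I) (hy₁ : y₁ ∈ I) {z : ℂ} (hz : 0 < z.re) {y : ℝ} (hy : y ∈ I) :
    HasDerivAt (angleIntegral k y₁ z) (angle k z y) y := by
  have hc : ContinuousOn (angle k z) I := by
    have h1 := (contDiffOn_angle (Ω := {z}) (by rintro _ rfl; exact hz) hk).continuousOn
    have h2 : ContinuousOn (fun t : ℝ => (z, t)) I := (Continuous.prodMk_right z).continuousOn
    have h3 : Set.MapsTo (fun t : ℝ => (z, t)) I ({z} ×ˢ I) := fun t ht => Set.mk_mem_prod rfl ht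
    have h4 := h1.comp h2 h3
    simpa only [Function.comp_def] using h4
  refine intervalIntegral.integral_hasDerivAt_right ?_ ?_ (hc.continuousAt (hI.mem_nhds hy))
  · exact (hc.mono (hI'.uIcc_subset hy₁ hy)).intervalIntegrable
  · exact hc.stronglyMeasurableAtFilter hI y hy

theorem dy_angleIntegral (hΩ : IsOpen Ω) (hI : IsOpen I) (hI' : I.OrdConnected)
    (hre : ∀ z ∈ Ω, 0 < z.re) (hk : ContDiffOn ℝ ∞ k I) (hy₁ : y₁ ∈ I) {p : ℂ × ℂ}
    (hp : p ∈ cylinder Ω I) : dy (liftF (angleIntegral k y₁)) p = liftF (angle k) p :=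
  (hasFrame_of_contDiffOn (isOpen_cylinder hΩ hI) (contDiffOn_lift
    (Complex.ofRealCLM.contDiff.comp_contDiffOn (contDiffOn_angleIntegral hΩ hI hI' hre hk hy₁)))
    hp).hasDerivAt_im.unique
    (hasDerivAt_angleIntegral hI hI' hk hy₁ (hre _ hp.1) hp.2).ofReal_comp

theorem contDiffOn_liftF_angleIntegral (hΩ : IsOpen Ω) (hI : IsOpen I) (hI' : I.OrdConnected)
    (hre : ∀ z ∈ Ω, 0 < z.re) (hk : ContDiffOn ℝ ∞ k I) (hy₁ : y₁ ∈ I) :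
    ContDiffOn ℝ ∞ (liftF (angleIntegral k y₁)) (cylinder Ω I) :=
  contDiffOn_lift
    (Complex.ofRealCLM.contDiff.comp_contDiffOn (contDiffOn_angleIntegral hΩ hI hI' hre hk hy₁))

theorem dy_dz_angleIntegral (hΩ : IsOpen Ω) (hI : IsOpen I) (hI' : I.OrdConnected)
    (hre : ∀ z ∈ Ω, 0 < z.re) (hk : ContDiffOn ℝ ∞ k I) (hy₁ : y₁ ∈ I) {p : ℂ × ℂ}
    (hp : p ∈ cylinder Ω I) : dy (dz (liftF (angleIntegral k y₁))) p
      = -2 * Complex.I / (p.2 - 2 * Complex.I * k p.1.im) := by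
  have hS := isOpen_cylinder hΩ hI
  rw [dy_dz_comm hS (contDiffOn_liftF_angleIntegral hΩ hI hI' hre hk hy₁) hp,
    dz_congr_on hS (fun s hs => dy_angleIntegral hΩ hI hI' hre hk hy₁ hs) hp]
  exact (hasFrame_angle hI hk hp.2 (hre _ hp.1)).choose_spec.dz_eq

/-- The angle is harmonic in `z`, so the `y`-derivative of the quantity is zero; and at `y = y₁` the
integral vanishes for all `z`. Constancy in `y` concludes, without a second differentiation under
the integral sign. -/
theorem dz_dzbar_angleIntegral (hΩ : IsOpen Ω) (hI : IsOpen I) (hI' : I.OrdConnected)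
    (hre : ∀ z ∈ Ω, 0 < z.re) (hk : ContDiffOn ℝ ∞ k I) (hy₁ : y₁ ∈ I) {p : ℂ × ℂ}
    (hp : p ∈ cylinder Ω I) : dz (dzbar (liftF (angleIntegral k y₁))) p = 0 := by
  have hS := isOpen_cylinder hΩ hI
  have hK := contDiffOn_liftF_angleIntegral hΩ hI hI' hre hk hy₁
  have hK1 := contDiffOn_dzbar hS hK
  have hK2 := contDiffOn_dz hS hK1
  have hderiv : ∀ s ∈ cylinder Ω I, dy (dz (dzbar (liftF (angleIntegral k y₁)))) s = 0 := by
    intro s hs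
    rw [dy_dz_comm hS hK1 hs, dz_congr_on hS (fun s hs => dy_dzbar_comm hS hK hs) hs]
    have h1 : ∀ s ∈ cylinder Ω I, dzbar (dy (liftF (angleIntegral k y₁))) s
        = dzbar (liftF (angle k)) s := fun s hs =>
      dzbar_congr_on hS (fun s hs => dy_angleIntegral hΩ hI hI' hre hk hy₁ hs) hs
    rw [dz_congr_on hS h1 hs]
    exact dz_dzbar_angle hΩ hI hre hk hs
  have hinit1 : ∀ s ∈ cylinder Ω I, s.1.im = y₁ →
      dzbar (liftF (angleIntegral k y₁)) s = 0 := by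
    intro s hs hsy
    refine ((hasFrame_of_contDiffOn hS hK hs).eq_of_hasDerivAt_snd (e := 0) ?_).2
    have : (fun z => liftF (angleIntegral k y₁) (s.1, z)) = fun _ => 0 := by
      ext z; simp [liftF, lift, hsy, angleIntegral]
    rw [this]; exact hasDerivAt_const _ _
  have hinit2 : ∀ s ∈ cylinder Ω I, s.1.im = y₁ →
      dz (dzbar (liftF (angleIntegral k y₁))) s = 0 := by
    intro s hs hsy
    refine ((hasFrame_of_contDiffOn hS hK1 hs).eq_of_hasDerivAt_snd (e := 0) ?_).1
    refine (hasDerivAt_const s.2 (0 : ℂ)).congr_of_eventuallyEq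
      (Filter.eventuallyEq_of_mem (hΩ.mem_nhds hs.1) fun z hz => hinit1 (s.1, z) ⟨hz, hs.2⟩ hsy)
  have hd : ∀ t ∈ I, HasDerivAt
      (fun t : ℝ => dz (dzbar (liftF (angleIntegral k y₁))) (⟨p.1.re, t⟩, p.2)) 0 t := by
    intro t ht
    have hm : ((⟨p.1.re, t⟩ : ℂ), p.2) ∈ cylinder Ω I := ⟨hp.1, ht⟩
    have := (hasFrame_of_contDiffOn hS hK2 hm).hasDerivAt_im
    rwa [hderiv _ hm] at this
  have hconst := hI.is_const_of_deriv_eq_zero hI'.isPreconnected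
    (fun t ht => (hd t ht).differentiableAt.differentiableWithinAt) (fun t ht => (hd t ht).deriv)
    hp.2 hy₁
  exact hconst.trans (hinit2 (⟨p.1.re, y₁⟩, p.2) ⟨hp.1, hy₁⟩ rfl)

end Angle

/-! ### The listed functions as solutions of both equations -/

theorem dy_dz_liftF_add {Ω : Set ℂ} {I : Set ℝ} (hΩ : IsOpen Ω) (hI : IsOpen I) {G : ℂ → ℝ}
    {K : ℂ → ℝ → ℝ} {r : ℝ → ℝ} (hG : ContDiffOn ℝ ∞ G Ω)
    (hK : ContDiffOn ℝ ∞ (liftF K) (cylinder Ω I)) (hr : ContDiffOn ℝ ∞ r I) {p : ℂ × ℂ}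
    (hp : p ∈ cylinder Ω I) :
    dy (dz (liftF fun z y => G z + K z y + r y)) p = dy (dz (liftF K)) p ∧
    dz (dzbar (liftF fun z y => G z + K z y + r y)) p
      = wz (wzbar fun z => (G z : ℂ)) p.2 + dz (dzbar (liftF K)) p := by
  have hS := isOpen_cylinder hΩ hI
  have hG' : ContDiffOn ℝ ∞ (fun z => (G z : ℂ)) Ω := Complex.ofRealCLM.contDiff.comp_contDiffOn hG
  have hGs : ContDiffOn ℝ ∞ (fun s : ℂ × ℂ => (G s.2 : ℂ)) (cylinder Ω I) :=
    hG'.comp contDiffOn_snd fun s hs => hs.1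
  have hrs : ContDiffOn ℝ ∞ (liftF fun _ y => r y) (cylinder Ω I) :=
    contDiffOn_lift (Complex.ofRealCLM.contDiff.comp_contDiffOn
      (hr.comp contDiffOn_snd fun s hs => hs.2))
  have hfr : ∀ s ∈ cylinder Ω I, HasFrame (liftF fun z y => G z + K z y + r y) s _ _ _ _ :=
    fun s hs => (((hasFrame_of_contDiffOn hS hGs hs).add (hasFrame_of_contDiffOn hS hK hs)).add
      (hasFrame_of_contDiffOn hS hrs hs)).congr_of_eventuallyEq
      (Filter.Eventually.of_forall fun s => by simp [liftF, lift])
  have h1 : ∀ s ∈ cylinder Ω I, dz (liftF fun z y => G z + K z y + r y) s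
      = dz (fun s : ℂ × ℂ => (G s.2 : ℂ)) s + dz (liftF K) s := fun s hs => by
    rw [(hfr s hs).dz_eq, (dz_dzbar_comp_im_eq_zero r s).1, add_zero]
  have h2 : ∀ s ∈ cylinder Ω I, dzbar (liftF fun z y => G z + K z y + r y) s
      = dzbar (fun s : ℂ × ℂ => (G s.2 : ℂ)) s + dzbar (liftF K) s := fun s hs => by
    rw [(hfr s hs).dzbar_eq, (dz_dzbar_comp_im_eq_zero r s).2, add_zero]
  constructor
  · rw [dy_congr_on hS h1 hp, ((hasFrame_of_contDiffOn hS (contDiffOn_dz hS hGs) hp).add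
      (hasFrame_of_contDiffOn hS (contDiffOn_dz hS hK) hp)).dy_eq, dy_dz_comm hS hGs hp]
    have h3 : ∀ s ∈ cylinder Ω I, dy (fun s : ℂ × ℂ => (G s.2 : ℂ)) s = 0 := fun s hs =>
      (hasFrame_of_contDiffOn hS hGs hs).hasDerivAt_im.unique (hasDerivAt_const s.1.im (G s.2 : ℂ))
    rw [dz_congr_on hS h3 hp, (hasFrame_const 0).dz_eq, zero_add]
  · rw [dz_congr_on hS h2 hp, ((hasFrame_of_contDiffOn hS (contDiffOn_dzbar hS hGs) hp).add
      (hasFrame_of_contDiffOn hS (contDiffOn_dzbar hS hK) hp)).dz_eq,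
      dz_dzbar_comp_snd hΩ hG' hp.1]

/-- The three families differ only in the term `K`. It must be harmonic in `z`, and `K_yz` must
satisfy the quadratic relation, to which `G` and `r` contribute nothing. -/
theorem conclusion_of_form {D : Set (ℂ × ℂ)} {I : Set ℝ} {Ω : Set ℂ} {b : ℂ → ℂ}
    {L : ℂ × ℂ → ℂ} {G : ℂ → ℝ} {K : ℂ → ℝ → ℝ} {r : ℝ → ℝ} {ψ : ℂ × ℂ → ℝ}
    (hD : IsDomainOver D I Ω) (hb : DifferentiableOn ℂ b Ω) (hL : ContinuousOn L D)
    (hexp : ∀ p ∈ D, Complex.exp (L p) = p.1 + b p.2) (hG : IsDoubleIntegral b G Ω)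
    (hr : ContDiffOn ℝ ∞ r I) (hK : ContDiffOn ℝ ∞ (fun s : ℂ × ℝ => K s.1 s.2) (Ω ×ˢ I))
    (hKz : ∀ p ∈ cylinder Ω I, dz (dzbar (liftF K)) p = 0)
    (hφ : ∀ p ∈ cylinder Ω I, (p.2 + conj p.2) * (dy (dz (liftF K)) p * conj (dy (dz (liftF K)) p))
      = 2 * (Complex.I * dy (dz (liftF K)) p + conj (Complex.I * dy (dz (liftF K)) p)))
    (hψ : ∀ p ∈ D, (ψ p : ℂ) = (p.1 + b p.2) * L p + (conj p.1 + conj (b p.2)) * conj (L p)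
      - (p.1 + conj p.1) * (Complex.log (p.2 + conj p.2) + 1) + (G p.2 : ℂ) + (K p.2 p.1.im : ℂ)
      + (r p.1.im : ℂ)) :
    (∃ (I : Set ℝ) (Ω : Set ℂ) (b : ℂ → ℝ → ℂ) (F : ℂ → ℝ → ℝ) (L : ℂ × ℂ → ℂ),
        IsAnsatz D I Ω b F L ψ) ∧ IsBFSolution ψ D ∧ IsHCMASolution ψ D := by
  have hF : ContDiffOn ℝ ∞ (fun s : ℂ × ℝ => G s.1 + K s.1 s.2 + r s.2) (Ω ×ˢ I) :=
    ((hG.1.comp contDiffOn_fst fun s hs => hs.1).add hK).add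
      (hr.comp contDiffOn_snd fun s hs => hs.2)
  have h := isAnsatz_of_holomorphic (F := fun z y => G z + K z y + r y) hD hb hL hexp hF
    (fun p hp => by rw [hψ p hp]; push_cast; ring)
  have hK' : ContDiffOn ℝ ∞ (liftF K) (cylinder Ω I) :=
    contDiffOn_lift (Complex.ofRealCLM.contDiff.comp_contDiffOn hK)
  have key {p} (hp : p ∈ cylinder Ω I) := dy_dz_liftF_add hD.isOpen_Ω hD.isOpen_I hG.1 hK' hr hp
  refine ⟨⟨_, _, _, _, _, h⟩, h.isSolution (fun p hp => ?_) (fun p hp => ?_)⟩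
  · rw [(key hp).2, hKz p hp, hG.2 _ hp.1, add_zero]
  · rw [(key hp).1]; exact hφ p hp

/-- For `φ = -2i/w` one has `iφ = 2/w`, and both sides equal `4θ/|w|²`. It is applied to `w = z -
2ik`, which has the same real part as `z`. -/
theorem quadratic_relation {w : ℂ} (hw : 0 < w.re) {θ : ℂ} (hθ : w + conj w = θ) :
    θ * (-2 * Complex.I / w * conj (-2 * Complex.I / w))
      = 2 * (Complex.I * (-2 * Complex.I / w) + conj (Complex.I * (-2 * Complex.I / w))) := by
  have h0 := ne_zero_of_re_pos hw
  have hc : conj w ≠ 0 := by simpa using h0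
  subst hθ
  simp only [map_mul, map_div₀, map_neg, Complex.conj_I, map_ofNat]
  field_simp
  ring

/-- The interval `I'` may be larger than `I`, because the base point of the integral need not lie
over the domain. -/
theorem conclusion_of_angleIntegral {D : Set (ℂ × ℂ)} {I I' : Set ℝ} {Ω : Set ℂ} {b : ℂ → ℂ}
    {L : ℂ × ℂ → ℂ} {G : ℂ → ℝ} {r k : ℝ → ℝ} {y₁ : ℝ} {ψ : ℂ × ℂ → ℝ}
    (hD : IsDomainOver D I Ω) (hb : DifferentiableOn ℂ b Ω) (hL : ContinuousOn L D)
    (hexp : ∀ p ∈ D, Complex.exp (L p) = p.1 + b p.2) (hG : IsDoubleIntegral b G Ω)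
    (hr : ContDiffOn ℝ ∞ r I) (hII : I ⊆ I') (hI' : IsOpen I') (hI'' : I'.OrdConnected)
    (hk : ContDiffOn ℝ ∞ k I') (hy₁ : y₁ ∈ I')
    (hψ : ∀ p ∈ D, (ψ p : ℂ) = (p.1 + b p.2) * L p + (conj p.1 + conj (b p.2)) * conj (L p)
      - (p.1 + conj p.1) * (Complex.log (p.2 + conj p.2) + 1) + (G p.2 : ℂ)
      + (angleIntegral k y₁ p.2 p.1.im : ℂ) + (r p.1.im : ℂ)) :
    (∃ (I : Set ℝ) (Ω : Set ℂ) (b : ℂ → ℝ → ℂ) (F : ℂ → ℝ → ℝ) (L : ℂ × ℂ → ℂ),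
        IsAnsatz D I Ω b F L ψ) ∧ IsBFSolution ψ D ∧ IsHCMASolution ψ D := by
  have hΩ := hD.isOpen_Ω
  have hre := hD.re_pos
  have hsub {p} (hp : p ∈ cylinder Ω I) : p ∈ cylinder Ω I' := ⟨hp.1, hII hp.2⟩
  refine conclusion_of_form hD hb hL hexp hG hr
    ((contDiffOn_angleIntegral hΩ hI' hI'' hre hk hy₁).mono (Set.prod_mono_right hII))
    (fun p hp => dz_dzbar_angleIntegral hΩ hI' hI'' hre hk hy₁ (hsub hp)) (fun p hp => ?_) hψ
  rw [dy_dz_angleIntegral hΩ hI' hI'' hre hk hy₁ (hsub hp)]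
  refine quadratic_relation (by rw [re_sub_two_I_mul]; exact hre _ hp.1) ?_
  simp only [map_sub, map_mul, Complex.conj_I, Complex.conj_ofReal, map_ofNat]
  ring

theorem isSolution_of_isListed {D : Set (ℂ × ℂ)} {ψ : ℂ × ℂ → ℝ} (h : IsListed D ψ) :
    (∃ (I : Set ℝ) (Ω : Set ℂ) (b : ℂ → ℝ → ℂ) (F : ℂ → ℝ → ℝ) (L : ℂ × ℂ → ℂ),
        IsAnsatz D I Ω b F L ψ) ∧ IsBFSolution ψ D ∧ IsHCMASolution ψ D := by
  obtain ⟨I, Ω, b, L, G, r, hD, hb, hL, hexp, hG, hr, h1 | h2 | ⟨k, y₁, hk, hy₁, h3⟩⟩ := h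
  · have h0 : liftF (fun _ _ => 0) = fun _ => (0 : ℂ) := by ext; simp [liftF, lift]
    have e1 : dz (fun _ => (0 : ℂ)) = fun _ => 0 := funext fun s => (hasFrame_const 0).dz_eq
    have e2 : dzbar (fun _ => (0 : ℂ)) = fun _ => 0 := funext fun s => (hasFrame_const 0).dzbar_eq
    have e3 : dy (fun _ => (0 : ℂ)) = fun _ => 0 := funext fun s => (hasFrame_const 0).dy_eq
    refine conclusion_of_form (K := fun _ _ => 0) hD hb hL hexp hG hr contDiffOn_const
      (fun p _ => by rw [h0, e2, e1]) (fun p _ => by simp [h0, e1, e3])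
      (fun p hp => by rw [h1 p hp]; simp [sol1])
  -- The second family is the third with `k = 0`: integration of the constant angle from `0` gives
  -- the factor `y`. Since `0` may lie outside `I`, the integral is taken over the whole line.
  · refine conclusion_of_angleIntegral (I' := Set.univ) (k := fun _ => 0) (y₁ := 0) hD hb hL hexp hG
      hr (Set.subset_univ _) isOpen_univ Set.ordConnected_univ contDiffOn_const trivial
      (fun p hp => ?_)
    have h4 := angle_eq (hD.re_pos _ (hD.proj_mem p hp).2) (fun _ => 0) 0
    rw [h2 p hp, sol2]
    have h5 : (angleIntegral (fun _ => 0) 0 p.2 p.1.im : ℂ)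
        = p.1.im * (angle (fun _ => 0) p.2 0 : ℝ) := by
      simp [angleIntegral, angle]
      ring
    rw [h5, h4]
    simp only [Complex.ofReal_zero, mul_zero, add_zero, sub_zero]
    ring
  · refine conclusion_of_angleIntegral hD hb hL hexp hG hr le_rfl hD.isOpen_I hD.ordConnected_I hk
      hy₁ (fun p hp => ?_)
    rw [h3 p hp, sol3, angleIntegral, ← intervalIntegral.integral_ofReal,
      ← intervalIntegral.integral_const_mul]
    simp only [angle_eq (hD.re_pos _ (hD.proj_mem p hp).2)]

/-! ### Elimination of the logarithm -/

/-- If `b₀` is not real, `x + b₀` never meets the real axis. Otherwise the half line is followed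
from `x₀` away from the zero `-b₀`, and `σ` records the direction. -/
theorem exists_sign_slitPlane {b₀ : ℂ} {x₀ : ℝ} (h : (x₀ : ℂ) + b₀ ≠ 0) :
    ∃ σ : ℝ, σ * σ = 1 ∧ ∀ t ≥ σ * x₀, (t : ℂ) + σ * b₀ ∈ Complex.slitPlane := by
  by_cases him : b₀.im = 0
  · have hne : x₀ + b₀.re ≠ 0 := fun h0 => h (by apply Complex.ext <;> simp [h0, him])
    rcases hne.lt_or_gt with hlt | hgt
    · exact ⟨-1, by norm_num, fun t ht => Or.inl (by simp; linarith)⟩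
    · exact ⟨1, by norm_num, fun t ht => Or.inl (by simp; linarith)⟩
  · exact ⟨1, by norm_num, fun t _ => Or.inr (by simpa using him)⟩

/-- In the variable `t = σx` the given branch differs from the principal logarithm by a continuous
function with constant exponential `σ`. Its variation near the base point has imaginary part below
`π` in absolute value, so it is locally constant. -/
theorem eventually_branch_eq {S : Set ℝ} (hS : IsOpen S) {L : ℝ → ℂ} (hL : ContinuousOn L S)
    {b₀ : ℂ} (hexp : ∀ x ∈ S, Complex.exp (L x) = x + b₀) {x₀ σ : ℝ} (hx₀ : x₀ ∈ S)
    (hσ : σ * σ = 1) (hslit : ∀ t ≥ σ * x₀, (t : ℂ) + σ * b₀ ∈ Complex.slitPlane) :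
    ∃ κ : ℂ, ∀ᶠ t in 𝓝 (σ * x₀), σ * t ∈ S ∧ L (σ * t) = Complex.log (t + σ * b₀) + κ := by
  have hx : σ * (σ * x₀) = x₀ := by rw [← mul_assoc, hσ, one_mul]
  have hmem : ∀ᶠ t in 𝓝 (σ * x₀), σ * t ∈ S :=
    (continuous_const_mul σ).continuousAt.eventually_mem (by rw [hx]; exact hS.mem_nhds hx₀)
  have hσC : (σ : ℂ) * σ = 1 := by exact_mod_cast hσ
  have hcB : Continuous fun t : ℝ => (t : ℂ) + σ * b₀ := by fun_prop
  have hc : ContinuousAt (fun t => L (σ * t) - Complex.log (t + σ * b₀)) (σ * x₀) := by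
    refine ContinuousAt.sub ?_ (hcB.continuousAt.clog (hslit _ le_rfl))
    refine ContinuousAt.comp (f := fun t => σ * t) ?_ (continuous_const_mul σ).continuousAt
    rw [hx]; exact hL.continuousAt (hS.mem_nhds hx₀)
  have hexp' : ∀ t, σ * t ∈ S → (t : ℂ) + σ * b₀ ≠ 0 →
      Complex.exp (L (σ * t) - Complex.log (t + σ * b₀)) = σ := by
    intro t ht h0
    rw [Complex.exp_sub, hexp _ ht, Complex.exp_log h0, div_eq_iff h0]
    push_cast
    linear_combination (-b₀) * hσC
  have hlt : ∀ᶠ t in 𝓝 (σ * x₀), |((L (σ * t) - Complex.log (t + σ * b₀))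
      - (L (σ * (σ * x₀)) - Complex.log ((σ * x₀ : ℝ) + σ * b₀))).im| < Real.pi := by
    have : ContinuousAt (fun t => |((L (σ * t) - Complex.log (t + σ * b₀))
      - (L (σ * (σ * x₀)) - Complex.log ((σ * x₀ : ℝ) + σ * b₀))).im|) (σ * x₀) :=
      (Complex.continuous_im.continuousAt.comp (hc.sub continuousAt_const)).abs
    exact this.eventually_lt_const (by simpa using Real.pi_pos)
  have hne : ∀ᶠ t : ℝ in 𝓝 (σ * x₀), (t : ℂ) + σ * b₀ ≠ 0 :=
    hcB.continuousAt.eventually_ne (Complex.slitPlane_ne_zero (hslit _ le_rfl))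
  refine ⟨L (σ * (σ * x₀)) - Complex.log ((σ * x₀ : ℝ) + σ * b₀), ?_⟩
  filter_upwards [hmem, hlt, hne] with t ht h1 h2
  refine ⟨ht, ?_⟩
  have h3 := Complex.log_exp (by linarith [(abs_lt.1 h1).1]) (abs_lt.1 h1).2.le
  have hσ0 : (σ : ℂ) ≠ 0 := fun h0 => by simp [h0] at hσC
  rw [Complex.exp_sub, hexp' t ht h2, hexp' (σ * x₀) (by rwa [hx])
    (Complex.slitPlane_ne_zero (hslit _ le_rfl)), div_self hσ0, Complex.log_one] at h3
  linear_combination -h3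

/-- A quadratic polynomial in `x` cannot be equal to `|A₀ + (x + b₀) (A₁ + u ln (x + b₀))|²`
unless `u = 0`. -/
theorem log_coeff_eq_zero {S : Set ℝ} (hS : IsOpen S) {L : ℝ → ℂ} (hL : ContinuousOn L S)
    {b₀ A₀ A₁ u θ c d : ℂ} (hθ : θ ≠ 0) (hexp : ∀ x ∈ S, Complex.exp (L x) = x + b₀)
    (heq : ∀ x ∈ S, ‖θ * (A₀ + (x + b₀) * (A₁ + u * L x))‖
      = ‖conj ((x : ℂ) + b₀) * c + (x + b₀) * d‖)
    (hne : S.Nonempty) : u = 0 := by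
  obtain ⟨x₀, hx₀⟩ := hne
  have h0 : (x₀ : ℂ) + b₀ ≠ 0 := by rw [← hexp x₀ hx₀]; exact Complex.exp_ne_zero _
  obtain ⟨σ, hσ, hslit⟩ := exists_sign_slitPlane h0
  obtain ⟨κ, hκ⟩ := eventually_branch_eq hS hL hexp hx₀ hσ hslit
  have hσC : (σ : ℂ) * σ = 1 := by exact_mod_cast hσ
  have hσn : ‖(σ : ℂ)‖ = 1 := by
    rw [Complex.norm_real, Real.norm_eq_abs]
    rcases mul_self_eq_one_iff.1 hσ with h | h <;> simp [h]
  set B : ℝ → ℂ := fun t => t + σ * b₀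
  set f : ℝ → ℂ := fun t => θ * (A₀ + σ * B t * (A₁ + u * (Complex.log (B t) + κ)))
  set R : ℝ → ℂ := fun t => σ * (conj (B t) * c + B t * d)
  have hB (t : ℝ) : AnalyticAt ℝ B t := Complex.ofRealCLM.analyticAt t |>.add analyticAt_const
  have hlog (t : ℝ) (ht : t ≥ σ * x₀) : AnalyticAt ℝ (fun t => Complex.log (B t)) t :=
    AnalyticAt.comp (f := B) ((analyticAt_clog (hslit t ht)).restrictScalars (𝕜 := ℝ)) (hB t)
  have hconj {g : ℝ → ℂ} {t : ℝ} (hg : AnalyticAt ℝ g t) : AnalyticAt ℝ (fun t => conj (g t)) t :=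
    ((Complex.conjCLE : ℂ →L[ℝ] ℂ).analyticAt (g t)).comp hg
  have hf (t : ℝ) (ht : t ≥ σ * x₀) : AnalyticAt ℝ f t :=
    analyticAt_const.mul (analyticAt_const.add ((analyticAt_const.mul (hB t)).mul
      (analyticAt_const.add (analyticAt_const.mul ((hlog t ht).add analyticAt_const)))))
  have hR (t : ℝ) : AnalyticAt ℝ R t :=
    analyticAt_const.mul (((hconj (hB t)).mul analyticAt_const).add ((hB t).mul analyticAt_const))
  -- Both squared moduli are real analytic along the whole half line, so the local identity
  -- continues to infinity.
  have hall : Set.EqOn (fun t => f t * conj (f t)) (fun t => R t * conj (R t))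
      (Set.Ici (σ * x₀)) := by
    refine AnalyticOnNhd.eqOn_of_preconnected_of_eventuallyEq (𝕜 := ℝ)
      (fun t ht => (hf t ht).mul (hconj (hf t ht))) (fun t _ => (hR t).mul (hconj (hR t)))
      isPreconnected_Ici (Set.self_mem_Ici (a := σ * x₀)) ?_
    filter_upwards [hκ] with t ht
    have hx : ((σ * t : ℝ) : ℂ) + b₀ = σ * B t := by
      simp only [B]; push_cast; linear_combination (-b₀) * hσC
    have := heq _ ht.1
    rw [ht.2, hx, map_mul, Complex.conj_ofReal] at this
    rw [Complex.mul_conj, Complex.mul_conj, Complex.normSq_eq_norm_sq, Complex.normSq_eq_norm_sq]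
    simp only [f, R]
    rw [this]
    congr 3
    ring
  by_contra hu
  have hu' : 0 < ‖u‖ := norm_pos_iff.2 hu
  have hθ' : 0 < ‖θ‖ := norm_pos_iff.2 hθ
  -- If `u ≠ 0`, then `|f|` grows at least like `|B| ln|B|`, while `|R|` is at most a constant times
  -- `|B|`. The threshold below is what remains after division by `|B| ≥ 1`.
  have htend : Filter.Tendsto (fun t : ℝ => ‖θ‖ * ‖u‖ * (Real.log (t - ‖b₀‖) - ‖κ‖))
      Filter.atTop Filter.atTop := by
    refine Filter.Tendsto.const_mul_atTop (by positivity) ?_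
    refine Filter.tendsto_atTop_add_const_right _ _ (Real.tendsto_log_atTop.comp ?_)
    exact Filter.tendsto_atTop_add_const_right _ _ Filter.tendsto_id
  obtain ⟨t, ht1, ht2, ht3⟩ := ((htend.eventually_gt_atTop
    (‖θ‖ * (‖A₀‖ + ‖A₁‖) + ‖c‖ + ‖d‖)).and ((Filter.eventually_ge_atTop (σ * x₀)).and
      (Filter.eventually_ge_atTop (1 + ‖b₀‖)))).exists
  have hBt : t - ‖b₀‖ ≤ ‖B t‖ := by
    have h1 : (t : ℂ) = B t - σ * b₀ := by simp [B]
    have h2 : ‖(t : ℂ)‖ ≤ ‖B t‖ + ‖σ * b₀‖ := by rw [h1]; exact norm_sub_le _ _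
    rw [norm_mul, hσn, one_mul, Complex.norm_real, Real.norm_eq_abs] at h2
    linarith [le_abs_self t]
  have hB1 : 1 ≤ ‖B t‖ := by linarith
  have hlogB : Real.log (t - ‖b₀‖) ≤ ‖Complex.log (B t)‖ := by
    calc Real.log (t - ‖b₀‖) ≤ Real.log ‖B t‖ := Real.log_le_log (by linarith) hBt
      _ = (Complex.log (B t)).re := (Complex.log_re _).symm
      _ ≤ _ := Complex.re_le_norm _
  have hnorm : ‖f t‖ = ‖R t‖ := by
    have := hall ht2
    simp only [Complex.mul_conj, Complex.normSq_eq_norm_sq] at this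
    have h2 : ‖f t‖ ^ 2 = ‖R t‖ ^ 2 := by exact_mod_cast this
    exact (sq_eq_sq₀ (norm_nonneg _) (norm_nonneg _)).1 h2
  have hRle : ‖R t‖ ≤ ‖B t‖ * (‖c‖ + ‖d‖) := by
    simp only [R]
    rw [norm_mul, hσn, one_mul]
    refine (norm_add_le _ _).trans (le_of_eq ?_)
    rw [norm_mul, norm_mul, RCLike.norm_conj]; ring
  have hfge : ‖θ‖ * (‖B t‖ * (‖u‖ * (Real.log (t - ‖b₀‖) - ‖κ‖))) ≤
      ‖f t‖ + ‖θ‖ * (‖A₀‖ + ‖B t‖ * ‖A₁‖) := by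
    have h1 : θ * (σ * B t * (u * (Complex.log (B t) + κ))) = f t - θ * (A₀ + σ * B t * A₁) := by
      simp only [f]; ring
    have h2 : ‖θ * (σ * B t * (u * (Complex.log (B t) + κ)))‖
        ≤ ‖f t‖ + ‖θ‖ * (‖A₀‖ + ‖B t‖ * ‖A₁‖) := by
      rw [h1]
      refine (norm_sub_le _ _).trans ?_
      refine add_le_add le_rfl ((norm_mul_le _ _).trans (mul_le_mul_of_nonneg_left ?_ (norm_nonneg _)))
      refine (norm_add_le _ _).trans (le_of_eq ?_)
      rw [norm_mul, norm_mul, hσn, one_mul]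
    refine le_trans ?_ h2
    rw [norm_mul, norm_mul, norm_mul, norm_mul, hσn, one_mul]
    gcongr
    have h3 : ‖Complex.log (B t)‖ ≤ ‖Complex.log (B t) + κ‖ + ‖κ‖ := by
      simpa using norm_sub_le (Complex.log (B t) + κ) κ
    linarith
  have hmul := mul_lt_mul_of_pos_left ht1 (by linarith : 0 < ‖B t‖)
  have hA : ‖θ‖ * ‖A₀‖ ≤ ‖B t‖ * (‖θ‖ * ‖A₀‖) := le_mul_of_one_le_left (by positivity) hB1
  nlinarith

/-! ### Comparison of coefficients -/

theorem quadratic_coeffs_eq_zero {S : Set ℝ} (hS : IsOpen S) (hne : S.Nonempty) {k₀ k₁ k₂ : ℂ}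
    (h : ∀ x ∈ S, k₀ + k₁ * x + k₂ * (x : ℂ) ^ 2 = 0) : k₀ = 0 ∧ k₁ = 0 ∧ k₂ = 0 := by
  obtain ⟨x, hx⟩ := hne
  obtain ⟨ε, hε, hball⟩ := Metric.isOpen_iff.1 hS x hx
  have h1 := h x hx
  have h2 := h (x + ε / 2) (hball (by simp [abs_of_pos hε, hε]))
  have h3 := h (x - ε / 2) (hball (by simp [abs_of_pos hε, hε]))
  have hε' : (ε : ℂ) ≠ 0 := by exact_mod_cast hε.ne'
  push_cast at h2 h3
  have e2 : k₂ = 0 := by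
    have : k₂ * (ε : ℂ) ^ 2 = 0 := by linear_combination 2 * h2 + 2 * h3 - 4 * h1
    simpa [hε'] using this
  have e1 : k₁ = 0 := by
    have : k₁ * (ε : ℂ) = 0 := by rw [e2] at h2 h3; linear_combination h2 - h3
    simpa [hε'] using this
  exact ⟨by rw [e1, e2] at h1; linear_combination h1, e1, e2⟩

/-- The relations between the coefficients of the powers of `x` in the second equation.  Here
`γ = b_y`, `W = θ b_z (1 + iγ)` and `τ = θ (i F_{yz} - 2/θ)`. -/
theorem coeff_relations {S : Set ℝ} (hS : IsOpen S) (hne : S.Nonempty) {b₀ W τ γ : ℂ}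
    (h : ∀ x ∈ S, (W + (x + b₀) * τ) * conj (W + (x + b₀) * τ)
      = (conj ((x : ℂ) + b₀) * (1 + Complex.I * γ) + (x + b₀) * (1 + Complex.I * conj γ))
        * conj (conj ((x : ℂ) + b₀) * (1 + Complex.I * γ) + (x + b₀) * (1 + Complex.I * conj γ))) :
    τ * conj τ = 4 * (1 + γ.re ^ 2) ∧
    (W * conj τ + 4 * Complex.I * b₀.im * ((1 + Complex.I * γ) * (1 - Complex.I * γ.re)))
      * (W * conj τ + 4 * Complex.I * b₀.im
        * (conj (1 + Complex.I * conj γ) * (1 + Complex.I * γ.re))) = 0 := by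
  obtain ⟨a, m⟩ := b₀
  obtain ⟨g, η⟩ := γ
  obtain ⟨w₁, w₂⟩ := W
  obtain ⟨t₁, t₂⟩ := τ
  -- With `X = x + Re b₀`, `m = Im b₀` and `γ = g + iη`, the expression on the right before taking
  -- the squared modulus is `2X + 2i(gX + mη)`.
  have hreal : ∀ x ∈ S,
      (w₁ + ((x + a) * t₁ - m * t₂)) ^ 2 + (w₂ + ((x + a) * t₂ + m * t₁)) ^ 2
        = (2 * (x + a)) ^ 2 + (2 * ((x + a) * g + m * η)) ^ 2 := by
    intro x hx
    have h1 := congrArg Complex.re (h x hx)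
    simp at h1
    linear_combination h1
  have hk := quadratic_coeffs_eq_zero hS hne
    (k₀ := (((w₁ + (a * t₁ - m * t₂)) ^ 2 + (w₂ + (a * t₂ + m * t₁)) ^ 2
      - ((2 * a) ^ 2 + (2 * (a * g + m * η)) ^ 2) : ℝ) : ℂ))
    (k₁ := ((2 * (w₁ + (a * t₁ - m * t₂)) * t₁ + 2 * (w₂ + (a * t₂ + m * t₁)) * t₂
      - (8 * a + 8 * (a * g + m * η) * g) : ℝ) : ℂ))
    (k₂ := ((t₁ ^ 2 + t₂ ^ 2 - (4 + 4 * g ^ 2) : ℝ) : ℂ))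
    (fun x hx => by
      have := hreal x hx
      norm_cast
      linear_combination this)
  norm_cast at hk
  obtain ⟨e0, e1, e2⟩ := hk
  -- The coefficients re-expanded in powers of `x + Re b₀`: `Re(Wτ̄) = 4gmη`, `|W + imτ|² = 4m²η²`
  -- and `|τ|² = 4(1 + g²)`.
  have f1 : w₁ * t₁ + w₂ * t₂ = 4 * g * m * η := by linear_combination e1 / 2 - a * e2
  have f0 : (w₁ - m * t₂) ^ 2 + (w₂ + m * t₁) ^ 2 = 4 * m ^ 2 * η ^ 2 := by
    linear_combination e0 - a * e1 + a ^ 2 * e2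
  have f2 : t₁ ^ 2 + t₂ ^ 2 = 4 * (1 + g ^ 2) := by linear_combination e2
  set v := w₂ * t₁ - w₁ * t₂
  -- The number `(W + imτ)τ̄` has known modulus and known real part, which determines its imaginary
  -- part up to sign. The two signs are the two factors of the claim.
  have f3 : (v + 4 * m * (1 + g ^ 2)) ^ 2 = (4 * m * η) ^ 2 := by
    simp only [v]
    linear_combination (t₁ ^ 2 + t₂ ^ 2) * f0 - (w₁ * t₁ + w₂ * t₂ + 4 * g * m * η) * f1
      + (-2 * m * (w₂ * t₁ - w₁ * t₂) - m ^ 2 * (t₁ ^ 2 + t₂ ^ 2 + 4 * (1 + g ^ 2))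
        + 4 * m ^ 2 * η ^ 2) * f2
  constructor
  · apply Complex.ext <;> simp [sq]
    · linear_combination f2
    · ring
  · have e1 : (⟨w₁, w₂⟩ : ℂ) * conj (⟨t₁, t₂⟩ : ℂ) + 4 * Complex.I * (m : ℂ)
        * ((1 + Complex.I * ⟨g, η⟩) * (1 - Complex.I * g))
        = Complex.I * (v + 4 * m * (1 + g ^ 2) - 4 * m * η : ℝ) := by
      apply Complex.ext <;> simp [sq]
      · linear_combination f1
      · simp only [v]; ring
    have e2 : (⟨w₁, w₂⟩ : ℂ) * conj (⟨t₁, t₂⟩ : ℂ) + 4 * Complex.I * (m : ℂ)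
        * (conj (1 + Complex.I * conj (⟨g, η⟩ : ℂ)) * (1 + Complex.I * g))
        = Complex.I * (v + 4 * m * (1 + g ^ 2) + 4 * m * η : ℝ) := by
      apply Complex.ext <;> simp [sq]
      · linear_combination f1
      · simp only [v]; ring
    simp only at e1 e2 ⊢
    rw [e1, e2]
    have : (Complex.I * ((v + 4 * m * (1 + g ^ 2) - 4 * m * η : ℝ) : ℂ))
      * (Complex.I * ((v + 4 * m * (1 + g ^ 2) + 4 * m * η : ℝ) : ℂ))
      = -(((v + 4 * m * (1 + g ^ 2)) ^ 2 - (4 * m * η) ^ 2 : ℝ) : ℂ) := by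
      push_cast
      linear_combination (((v : ℂ) + 4 * m * (1 + g ^ 2)) ^ 2 - (4 * m * η) ^ 2) * Complex.I_sq
    rw [this, f3]
    simp

/-! ### Two rigidity lemmas for holomorphic functions -/

/-- Where `φ ≠ 0`, division by `|φ|²` says that the holomorphic function `2k̄/φ - z` has zero real
part, so it is an imaginary constant `iκ`. The identity theorem extends the resulting formula to all
of `Ω`. -/
theorem eq_zero_or_eq_div {Ω : Set ℂ} (hΩ : IsOpen Ω) (hΩ' : IsPreconnected Ω) {φ : ℂ → ℂ}
    (hφ : DifferentiableOn ℂ φ Ω) {k : ℂ}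
    (h : ∀ z ∈ Ω, (z + conj z) * (φ z * conj (φ z)) = 2 * (k * φ z + conj (k * φ z))) :
    (∀ z ∈ Ω, φ z = 0) ∨ ∃ κ : ℝ, ∀ z ∈ Ω, φ z * (z + Complex.I * κ) = 2 * conj k := by
  by_cases h0 : ∀ z ∈ Ω, φ z = 0
  · exact Or.inl h0
  right
  push Not at h0
  obtain ⟨z₁, hz₁, hne⟩ := h0
  have hnhd : ∀ᶠ z in 𝓝 z₁, φ z ≠ 0 ∧ z ∈ Ω :=
    ((hφ.continuousOn.continuousAt (hΩ.mem_nhds hz₁)).eventually_ne hne).and (hΩ.mem_nhds hz₁)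
  obtain ⟨ε, hε, hball⟩ := Metric.eventually_nhds_iff_ball.1 hnhd
  have hχ : DifferentiableOn ℂ (fun z => 2 * conj k / φ z - z) (Metric.ball z₁ ε) := by
    refine DifferentiableOn.sub (DifferentiableOn.div (differentiableOn_const _)
      (hφ.mono fun z hz => (hball z hz).2) fun z hz => (hball z hz).1) differentiableOn_id
  have hre : ∀ z ∈ Metric.ball z₁ ε, (2 * conj k / φ z - z).re = 0 := by
    intro z hz
    have hz0 := (hball z hz).1
    have hzc : conj (φ z) ≠ 0 := by simpa using hz0
    have e : (2 * conj k / φ z - z) + conj (2 * conj k / φ z - z) = 0 := by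
      simp only [map_sub, map_div₀, map_mul, Complex.conj_conj, map_ofNat]
      have := h z (hball z hz).2
      simp only [map_mul] at this
      field_simp
      linear_combination -this
    rw [Complex.add_conj] at e
    have : (2 : ℂ) ≠ 0 := two_ne_zero
    norm_cast at e
    linarith
  obtain ⟨κ, hκ⟩ := AnalyticOnNhd.eq_const_of_re_eq_const
    (hχ.analyticOnNhd Metric.isOpen_ball) hre
    Metric.isOpen_ball ((convex_ball z₁ ε).isConnected ⟨z₁, Metric.mem_ball_self hε⟩)
  have hκ0 : κ = Complex.I * κ.im := by
    have h1 := hre z₁ (Metric.mem_ball_self hε)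
    have h2 : κ = (fun z => 2 * conj k / φ z - z) z₁ := (hκ z₁ (Metric.mem_ball_self hε)).symm
    have h3 : κ.re = 0 := by rw [h2]; exact h1
    apply Complex.ext <;> simp [h3]
  refine ⟨κ.im, ?_⟩
  have hA : AnalyticOnNhd ℂ (fun z => φ z * (z + Complex.I * κ.im)) Ω :=
    (hφ.mul (differentiableOn_id.add_const _)).analyticOnNhd hΩ
  refine hA.eqOn_of_preconnected_of_eventuallyEq analyticOnNhd_const hΩ' hz₁ ?_
  filter_upwards [Metric.ball_mem_nhds z₁ hε] with z hz
  have h1 : 2 * conj k / φ z - z = κ := hκ z hz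
  have h2 := (hball z hz).1
  rw [← hκ0, ← h1]
  field_simp
  ring

theorem hasFrame_comp_snd {f : ℂ → ℂ} {Ω : Set ℂ} (hΩ : IsOpen Ω) (hf : DifferentiableOn ℂ f Ω)
    {p : ℂ × ℂ} (hp : p.2 ∈ Ω) : HasFrame (fun s => f s.2) p 0 0 (deriv f p.2) 0 :=
  (hasFrame_snd.comp_holomorphic ((hf.differentiableAt (hΩ.mem_nhds hp)).hasDerivAt)).congr_coeff
    (by ring) (by ring) (by ring) (by ring)

/-- If `(S + S̄) P = e (β - β̄)` on a nonempty open set, where `β' = P S'`, then `P` is an imaginary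
constant. -/
theorem imaginary_const_of_relation {Ω U : Set ℂ} (hΩ : IsOpen Ω) (hΩ' : IsPreconnected Ω)
    (hU : IsOpen U) (hUΩ : U ⊆ Ω) (hne : U.Nonempty) {S β : ℂ → ℂ} {e : ℂ}
    (hS : DifferentiableOn ℂ S Ω) (hβ : DifferentiableOn ℂ β Ω) (hS' : ∀ z ∈ Ω, deriv S z ≠ 0)
    (h : ∀ z ∈ U, (S z + conj (S z)) * deriv β z = e * (β z - conj (β z)) * deriv S z) :
    ∃ ν : ℝ, ∀ z ∈ Ω, deriv β z = Complex.I * ν * deriv S z := by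
  set P : ℂ → ℂ := fun z => deriv β z / deriv S z
  have hP : DifferentiableOn ℂ P Ω := (hβ.deriv hΩ).div (hS.deriv hΩ) hS'
  have hβP : ∀ z ∈ Ω, deriv β z = P z * deriv S z := fun z hz => by
    simp only [P]; field_simp [hS' z hz]
  have hO : IsOpen {s : ℂ × ℂ | s.2 ∈ U} := hU.preimage continuous_snd
  have hrel : ∀ s ∈ {s : ℂ × ℂ | s.2 ∈ U},
      (S s.2 + conj (S s.2)) * P s.2 = e * (β s.2 - conj (β s.2)) := fun s hs => by
    have h1 := h s.2 hs
    rw [hβP _ (hUΩ hs)] at h1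
    apply mul_right_cancel₀ (hS' _ (hUΩ hs))
    linear_combination h1
  -- The `z`- and `z̄`-derivatives of `(S + S̄) P = e (β - β̄)`. The dummy first coordinate `0`
  -- makes the two-variable frame calculus available.
  have hd {z : ℂ} (hz : z ∈ U) : deriv S z * P z + (S z + conj (S z)) * deriv P z = e * deriv β z ∧
      conj (deriv S z) * P z = -(e * conj (deriv β z)) := by
    have hz' : ((0 : ℂ), z).2 ∈ Ω := hUΩ hz
    have f1 := hasFrame_comp_snd hΩ hS hz'
    have f2 := hasFrame_comp_snd hΩ hP hz'
    have f3 := hasFrame_comp_snd hΩ hβ hz'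
    have g1 := (f1.add f1.conj).mul f2
    have g2 := (f3.sub f3.conj).const_mul e
    have e1 := dz_congr_on hO hrel (p := ((0 : ℂ), z)) hz
    have e2 := dzbar_congr_on hO hrel (p := ((0 : ℂ), z)) hz
    rw [g1.dz_eq, g2.dz_eq] at e1
    rw [g1.dzbar_eq, g2.dzbar_eq] at e2
    simp only [map_zero] at e1 e2
    exact ⟨by linear_combination e1, by linear_combination e2⟩
  have hPc : ∀ z ∈ U, P z = -(e * conj (P z)) := fun z hz => by
    have h1 := (hd hz).2
    have h2 : conj (deriv S z) ≠ 0 := by simpa using hS' z (hUΩ hz)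
    rw [hβP z (hUΩ hz), map_mul] at h1
    apply mul_left_cancel₀ h2
    linear_combination h1
  -- The relation `P = -e P̄` makes the holomorphic `P` antiholomorphic as well.
  have hPd : ∀ z ∈ U, deriv P z = 0 := fun z hz => by
    have hz' : ((0 : ℂ), z).2 ∈ Ω := hUΩ hz
    have f2 := hasFrame_comp_snd hΩ hP hz'
    have e1 := dz_congr_on hO (f := fun s => P s.2) (g := fun s => -e * conj (P s.2))
      (fun s hs => (hPc s.2 hs).trans (by ring)) (p := ((0 : ℂ), z)) hz
    rw [f2.dz_eq, (f2.conj.const_mul (-e)).dz_eq] at e1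
    simpa using e1
  obtain ⟨z₁, hz₁⟩ := hne
  have hPd' : ∀ z ∈ Ω, deriv P z = 0 :=
    ((hP.deriv hΩ).analyticOnNhd hΩ).eqOn_of_preconnected_of_eventuallyEq
      (analyticOnNhd_const (v := (0 : ℂ))) hΩ' (hUΩ hz₁)
      (Filter.eventuallyEq_of_mem (hU.mem_nhds hz₁) hPd)
  have hconst : ∀ z ∈ Ω, P z = P z₁ := fun z hz =>
    hΩ.is_const_of_deriv_eq_zero hΩ' hP hPd' hz (hUΩ hz₁)
  have hre : conj (P z₁) = -P z₁ := by
    by_cases h0 : P z₁ = 0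
    · simp [h0]
    · have h1 := (hd hz₁).1
      rw [hPd z₁ hz₁, hβP z₁ (hUΩ hz₁)] at h1
      -- With `P' = 0` the `z`-derivative reads `P S' = e P S'`. So `e = 1` unless `P = 0`, and then
      -- `P = -P̄`.
      have h2 : e = 1 := by
        apply mul_right_cancel₀ (mul_ne_zero h0 (hS' z₁ (hUΩ hz₁)))
        linear_combination -h1
      have h3 := hPc z₁ hz₁
      rw [h2] at h3
      linear_combination h3
  refine ⟨(P z₁).im, fun z hz => ?_⟩
  rw [hβP z hz, hconst z hz]
  congr 1
  have h4 := congrArg Complex.re hre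
  simp at h4
  have h5 : (P z₁).re = 0 := by linarith
  apply Complex.ext <;> simp [h5]

namespace IsAnsatz

/-! ### Consequences of the two equations -/

variable {D : Set (ℂ × ℂ)} {I : Set ℝ} {Ω : Set ℂ} {b : ℂ → ℝ → ℂ} {F : ℂ → ℝ → ℝ}
  {L : ℂ × ℂ → ℂ} {ψ : ℂ × ℂ → ℝ}

/-- With `(z, y)` fixed, everything in (H) except `x` and the branch of the logarithm is constant,
and the domain meets every such line in a nonempty open set. This transfers information from `D` to
the whole cylinder over `Ω × I`. -/
theorem exists_slice (h : IsAnsatz D I Ω b F L ψ) (hBF : IsBFSolution ψ D)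
    (hH : IsHCMASolution ψ D) {s : ℂ × ℂ} (hs : s ∈ cylinder Ω I) :
    ∃ (S : Set ℝ) (M : ℝ → ℂ), IsOpen S ∧ S.Nonempty ∧ ContinuousOn M S ∧
      (∀ x ∈ S, Complex.exp (M x) = x + lift b s) ∧
      ∀ x ∈ S, (s.2 + conj s.2) ^ 2 * ((dz (lift b) s * (1 + Complex.I * dy (lift b) s)
          + (x + lift b s) * (Complex.I * (dy (dz (lift b)) s * (M x + 1) + dy (dz (liftF F)) s)
            - 2 / (s.2 + conj s.2)))
        * conj (dz (lift b) s * (1 + Complex.I * dy (lift b) s)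
          + (x + lift b s) * (Complex.I * (dy (dz (lift b)) s * (M x + 1) + dy (dz (liftF F)) s)
            - 2 / (s.2 + conj s.2))))
        = (conj ((x : ℂ) + lift b s) * (1 + Complex.I * dy (lift b) s)
            + (x + lift b s) * (1 + Complex.I * conj (dy (lift b) s)))
          * conj (conj ((x : ℂ) + lift b s) * (1 + Complex.I * dy (lift b) s)
            + (x + lift b s) * (1 + Complex.I * conj (dy (lift b) s))) := by
  have hcurve : Continuous fun x : ℝ => ((⟨x, s.1.im⟩ : ℂ), s.2) := by
    have e : Continuous fun x : ℝ => (⟨x, s.1.im⟩ : ℂ) := by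
      simp only [Complex.mk_eq_add_mul_I]; fun_prop
    exact e.prodMk continuous_const
  refine ⟨(fun x : ℝ => ((⟨x, s.1.im⟩ : ℂ), s.2)) ⁻¹' D, fun x => L (⟨x, s.1.im⟩, s.2),
    h.domain.isOpen.preimage hcurve, h.domain.exists_mem _ hs.2 _ hs.1,
    h.continuous_L.comp hcurve.continuousOn fun x hx => hx, fun x hx => h.exp_L _ hx,
    fun x hx => ?_⟩
  have h1 := (h.mongeAmpere_iff hx (hBF.2.2 _ hx)).1 (hH.2.2 _ hx)
  have e1 : dz (lift b) (⟨x, s.1.im⟩, s.2) = dz (lift b) s :=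
    (xInvariant_lift b).dz.eq_of_eq rfl rfl
  have e2 : dy (lift b) (⟨x, s.1.im⟩, s.2) = dy (lift b) s :=
    (xInvariant_lift b).dy.eq_of_eq rfl rfl
  have e3 : dy (dz (lift b)) (⟨x, s.1.im⟩, s.2) = dy (dz (lift b)) s :=
    (xInvariant_lift b).dz.dy.eq_of_eq rfl rfl
  have e4 : dy (dz (liftF F)) (⟨x, s.1.im⟩, s.2) = dy (dz (liftF F)) s :=
    (xInvariant_lift _).dz.dy.eq_of_eq rfl rfl
  have e5 : arg b (⟨x, s.1.im⟩, s.2) = x + lift b s := rfl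
  simp only [mixed, pure, e1, e2, e3, e4, e5] at h1
  exact h1

/-- The logarithm enters the equation only with the coefficient `i b_yz`, and `log_coeff_eq_zero`
makes this coefficient vanish. -/
theorem dy_dz_b_eq_zero (h : IsAnsatz D I Ω b F L ψ) (hBF : IsBFSolution ψ D)
    (hH : IsHCMASolution ψ D) {s : ℂ × ℂ} (hs : s ∈ cylinder Ω I) : dy (dz (lift b)) s = 0 := by
  obtain ⟨S, M, hS, hne, hM, hexp, heq⟩ := h.exists_slice hBF hH hs
  have hθ := add_conj_ne_zero (h.domain.re_pos _ hs.1)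
  have hreal : conj (s.2 + conj s.2) = s.2 + conj s.2 := by simp [add_comm]
  have key := log_coeff_eq_zero hS hM (A₀ := dz (lift b) s * (1 + Complex.I * dy (lift b) s))
    (A₁ := Complex.I * (dy (dz (lift b)) s + dy (dz (liftF F)) s) - 2 / (s.2 + conj s.2))
    (u := Complex.I * dy (dz (lift b)) s) (c := 1 + Complex.I * dy (lift b) s)
    (d := 1 + Complex.I * conj (dy (lift b) s)) hθ hexp (fun x hx => ?_) hne
  · exact (mul_eq_zero.1 key).resolve_left Complex.I_ne_zero
  · have h1 := heq x hx
    set R := conj ((x : ℂ) + lift b s) * (1 + Complex.I * dy (lift b) s)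
            + (x + lift b s) * (1 + Complex.I * conj (dy (lift b) s))
    set Q := dz (lift b) s * (1 + Complex.I * dy (lift b) s)
          + (x + lift b s) * (Complex.I * (dy (dz (lift b)) s * (M x + 1) + dy (dz (liftF F)) s)
            - 2 / (s.2 + conj s.2)) with hQ
    have h2 : ((s.2 + conj s.2) * Q) * conj ((s.2 + conj s.2) * Q) = R * conj R := by
      rw [map_mul, hreal, ← h1]; ring
    rw [Complex.mul_conj, Complex.mul_conj, Complex.normSq_eq_norm_sq,
      Complex.normSq_eq_norm_sq] at h2
    have h3 : ‖(s.2 + conj s.2) * Q‖ ^ 2 = ‖R‖ ^ 2 := by exact_mod_cast h2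
    have h4 := (sq_eq_sq₀ (norm_nonneg _) (norm_nonneg _)).1 h3
    rw [← h4, hQ]
    congr 2
    ring

/-- Once the logarithm is gone, `θ` times the mixed term is `W + (x + b)τ`, and `coeff_relations`
applies to the slice. -/
theorem relations (h : IsAnsatz D I Ω b F L ψ) (hBF : IsBFSolution ψ D)
    (hH : IsHCMASolution ψ D) {s : ℂ × ℂ} (hs : s ∈ cylinder Ω I) {W τ : ℂ}
    (hW : W = (s.2 + conj s.2) * (dz (lift b) s * (1 + Complex.I * dy (lift b) s)))
    (hτ : τ = Complex.I * (s.2 + conj s.2) * dy (dz (liftF F)) s - 2) :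
    τ * conj τ = 4 * (1 + (dy (lift b) s).re ^ 2) ∧
    (W * conj τ + 4 * Complex.I * (lift b s).im
      * ((1 + Complex.I * dy (lift b) s) * (1 - Complex.I * (dy (lift b) s).re)))
      * (W * conj τ + 4 * Complex.I * (lift b s).im
        * (conj (1 + Complex.I * conj (dy (lift b) s)) * (1 + Complex.I * (dy (lift b) s).re)))
      = 0 := by
  obtain ⟨S, M, hS, hne, hM, hexp, heq⟩ := h.exists_slice hBF hH hs
  have hθ := add_conj_ne_zero (h.domain.re_pos _ hs.1)
  have hreal : conj (s.2 + conj s.2) = s.2 + conj s.2 := by simp [add_comm]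
  refine coeff_relations hS hne fun x hx => ?_
  rw [← heq x hx]
  have e : W + (x + lift b s) * τ = (s.2 + conj s.2)
      * (dz (lift b) s * (1 + Complex.I * dy (lift b) s)
          + (x + lift b s) * (Complex.I * (dy (dz (lift b)) s * (M x + 1) + dy (dz (liftF F)) s)
            - 2 / (s.2 + conj s.2))) := by
    rw [h.dy_dz_b_eq_zero hBF hH hs, hW, hτ]; field_simp; ring
  rw [e, map_mul, hreal]
  ring

theorem dz_dzbar_F (h : IsAnsatz D I Ω b F L ψ) (hBF : IsBFSolution ψ D) {s : ℂ × ℂ}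
    (hs : s ∈ cylinder Ω I) :
    dz (dzbar (liftF F)) s = (lift b s + conj (lift b s)) / (s.2 + conj s.2) ^ 2 := by
  obtain ⟨x, hx⟩ := h.domain.exists_mem _ hs.2 _ hs.1
  have h1 := (h.boyerFinley_iff hx).1 (hBF.2.2 _ hx)
  have e : dz (dzbar (liftF F)) (⟨x, s.1.im⟩, s.2) = dz (dzbar (liftF F)) s :=
    (xInvariant_lift _).dzbar.dz.eq_of_eq rfl rfl
  rw [e] at h1
  exact h1

/-- `b_y` does not depend on `z`. -/
theorem dy_b_eq (h : IsAnsatz D I Ω b F L ψ) (hBF : IsBFSolution ψ D)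
    (hH : IsHCMASolution ψ D) {s t : ℂ × ℂ} (hs : s ∈ cylinder Ω I) (ht : t ∈ cylinder Ω I)
    (hst : s.1.im = t.1.im) : dy (lift b) s = dy (lift b) t := by
  have hd : ∀ z ∈ Ω, HasDerivAt (fun z => dy (lift b) (s.1, z)) 0 z := fun z hz => by
    have hm : (s.1, z) ∈ cylinder Ω I := ⟨hz, hs.2⟩
    have h1 := h.hasFrame_dy_b hm
    rw [h.dy_dz_b_eq_zero hBF hH hm] at h1
    exact h1.hasDerivAt_snd
  have h1 := h.domain.isOpen_Ω.is_const_of_deriv_eq_zero h.domain.isPreconnected_Ω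
    (fun z hz => (hd z hz).differentiableAt.differentiableWithinAt) (fun z hz => (hd z hz).deriv)
    hs.1 ht.1
  exact h1.trans ((xInvariant_lift b).dy.eq_of_eq hst rfl)

/-- `b_z` does not depend on `y`. -/
theorem dz_b_eq (h : IsAnsatz D I Ω b F L ψ) (hBF : IsBFSolution ψ D)
    (hH : IsHCMASolution ψ D) {s t : ℂ × ℂ} (hs : s ∈ cylinder Ω I) (ht : t ∈ cylinder Ω I)
    (hst : s.2 = t.2) : dz (lift b) s = dz (lift b) t := by
  have hd : ∀ y ∈ I, HasDerivAt (fun y : ℝ => dz (lift b) (⟨s.1.re, y⟩, s.2)) 0 y := fun y hy => by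
    have hm : ((⟨s.1.re, y⟩ : ℂ), s.2) ∈ cylinder Ω I := ⟨hs.1, hy⟩
    have h1 := (h.hasFrame_dz_b hm).hasDerivAt_im
    rwa [h.dy_dz_b_eq_zero hBF hH hm] at h1
  have h1 := h.domain.isOpen_I.is_const_of_deriv_eq_zero h.domain.ordConnected_I.isPreconnected
    (fun y hy => (hd y hy).differentiableAt.differentiableWithinAt) (fun y hy => (hd y hy).deriv)
    hs.2 ht.2
  exact h1.trans ((xInvariant_lift b).dz.eq_of_eq rfl hst)

/-- The function `F_{yz} + 2g / (z + z̄)`, where `g = re b_y`, is holomorphic in `z`. -/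
theorem differentiableOn_phi (h : IsAnsatz D I Ω b F L ψ) (hBF : IsBFSolution ψ D)
    {q : ℂ} (hq : q.im ∈ I) {g : ℝ} (hg : ∀ z ∈ Ω, (dy (lift b) (q, z)).re = g) :
    DifferentiableOn ℂ (fun z => dy (dz (liftF F)) (q, z) + 2 * g * (z + conj z)⁻¹) Ω := by
  intro z hz
  have hS := h.isOpen_cylinder
  have hm : (q, z) ∈ cylinder Ω I := ⟨hz, hq⟩
  have hθ := add_conj_ne_zero (h.domain.re_pos _ hz)
  have h2 := ((hasFrame_add_conj (q, z)).comp_holomorphic (hasDerivAt_inv hθ)).const_mul (2 * g : ℂ)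
  have h1 := hasFrame_of_contDiffOn hS (contDiffOn_dy hS (contDiffOn_dz hS h.contDiffOn_F)) hm
  -- This is the `y`-derivative of `F_{zz̄} = (b + b̄)/θ²`. It cancels the `z̄`-derivative of
  -- `2g/θ`.
  have e : dzbar (dy (dz (liftF F))) (q, z) = 2 * g / (z + conj z) ^ 2 := by
    rw [← dy_dzbar_comm hS (contDiffOn_dz hS h.contDiffOn_F) hm]
    have h3 : ∀ s ∈ cylinder Ω I, dzbar (dz (liftF F)) s
        = (lift b s + conj (lift b s)) * ((s.2 + conj s.2) ^ 2)⁻¹ := fun s hs => by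
      rw [dzbar_dz_comm hS h.contDiffOn_F hs, h.dz_dzbar_F hBF hs, div_eq_mul_inv]
    have h4 := (h.hasFrame_b hm).add (h.hasFrame_b hm).conj
    have h5 := ((hasFrame_add_conj (q, z)).comp_holomorphic (h := fun w => (w ^ 2)⁻¹)
      ((hasDerivAt_pow 2 (z + conj z)).inv (pow_ne_zero 2 hθ)))
    rw [dy_congr_on hS h3 hm, (h4.mul h5).dy_eq, Complex.add_conj, hg z hz]
    push_cast
    ring
  have h6 := (h1.add h2).congr_coeff rfl rfl rfl (d' := 0) (by rw [e]; ring)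
  exact h6.hasDerivAt_snd.differentiableAt.differentiableWithinAt

end IsAnsatz

namespace IsAnsatz

/-! ### Noninvariant solutions have `b_y = i` -/

variable {D : Set (ℂ × ℂ)} {I : Set ℝ} {Ω : Set ℂ} {b : ℂ → ℝ → ℂ} {F : ℂ → ℝ → ℝ}
  {L : ℂ × ℂ → ℂ} {ψ : ℂ × ℂ → ℝ}

/-- For `φ = F_yz + 2g/θ` one has `τ = iθφ - 2(1 + ig)`, so `|τ|² = 4(1 + g²)` becomes `θ|φ|² = 4
Re((i + g)φ)`. This is the hypothesis of `eq_zero_or_eq_div` with `k = i + g`. -/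
theorem phi_dichotomy (h : IsAnsatz D I Ω b F L ψ) (hBF : IsBFSolution ψ D)
    (hH : IsHCMASolution ψ D) {q : ℂ} (hq : q.im ∈ I) {g : ℝ}
    (hg : ∀ z ∈ Ω, (dy (lift b) (q, z)).re = g) :
    (∀ z ∈ Ω, dy (dz (liftF F)) (q, z) + 2 * g * (z + conj z)⁻¹ = 0) ∨
    ∃ κ : ℝ, ∀ z ∈ Ω, (dy (dz (liftF F)) (q, z) + 2 * g * (z + conj z)⁻¹) * (z + Complex.I * κ)
      = 2 * conj (Complex.I + g) := by
  refine eq_zero_or_eq_div h.domain.isOpen_Ω h.domain.isPreconnected_Ω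
    (h.differentiableOn_phi hBF hq hg) fun z hz => ?_
  have hθ := add_conj_ne_zero (h.domain.re_pos _ hz)
  have hreal : conj (z + conj z) = z + conj z := by simp [add_comm]
  have h1 := (h.relations hBF hH (s := (q, z)) ⟨hz, hq⟩ rfl rfl).1
  rw [hg z hz] at h1
  simp only [map_mul, map_sub, map_add, map_inv₀, hreal, Complex.conj_I, Complex.conj_ofReal,
    map_ofNat] at h1 ⊢
  generalize dy (dz (liftF F)) (q, z) = φ at *
  generalize conj φ = φ' at *
  generalize z + conj z = θ at *
  apply mul_left_cancel₀ hθ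
  field_simp
  have hI := Complex.I_sq
  linear_combination h1 + (φ * φ' * θ ^ 2) * hI

/-- A holomorphic coordinate `S` in which `θ (i F_{yz} - 2/θ)` takes a standard form, and the
generator of the isometries of the half plane that it belongs to. -/
theorem exists_coordinate (h : IsAnsatz D I Ω b F L ψ) (hBF : IsBFSolution ψ D)
    (hH : IsHCMASolution ψ D) {q : ℂ} (hq : q.im ∈ I) {g : ℝ}
    (hg : ∀ z ∈ Ω, (dy (lift b) (q, z)).re = g) :
    ∃ S a : ℂ → ℂ, DifferentiableOn ℂ S Ω ∧ DifferentiableOn ℂ a Ω ∧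
      (∀ z ∈ Ω, a z * deriv S z = Complex.I) ∧
      (∀ z ∈ Ω, (deriv a z + conj (deriv a z)) * (z + conj z) = 2 * (a z + conj (a z))) ∧
      ∀ z ∈ Ω, (S z + conj (S z)) * (Complex.I * (z + conj z) * dy (dz (liftF F)) (q, z) - 2)
        = -2 * (1 + Complex.I * g) * (z + conj z) * deriv S z := by
  have hI := Complex.I_sq
  rcases h.phi_dichotomy hBF hH hq hg with h0 | ⟨κ, hκ⟩
  -- Here `τ` is the constant `-2(1 + ig)`: the coordinate is `z` itself and the isometries are the
  -- vertical translations.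
  · refine ⟨id, fun _ => Complex.I, differentiableOn_id, differentiableOn_const _, fun z _ => by simp,
      fun z _ => by simp, fun z hz => ?_⟩
    have hθ := add_conj_ne_zero (h.domain.re_pos _ hz)
    have h1 := h0 z hz
    have h2 : (z + conj z) * dy (dz (liftF F)) (q, z) = -2 * g := by
      field_simp at h1
      linear_combination h1
    simp only [id, deriv_id]
    linear_combination Complex.I * (z + conj z) * h2
  · have hne : ∀ z ∈ Ω, z + Complex.I * κ ≠ 0 := fun z hz =>
      ne_zero_of_re_pos (by simpa using h.domain.re_pos z hz)
    have hdS : ∀ z ∈ Ω, HasDerivAt (fun z => (z + Complex.I * κ)⁻¹)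
        (-((z + Complex.I * κ) ^ 2)⁻¹) z := fun z hz => by
      have h1 := ((hasDerivAt_id z).add_const (Complex.I * (κ : ℂ))).inv (hne z hz)
      refine h1.congr_deriv ?_
      simp [neg_div]
    have hda : ∀ z, HasDerivAt (fun z => -Complex.I * (z + Complex.I * κ) ^ 2)
        (-2 * Complex.I * (z + Complex.I * κ)) z := fun z => by
      have h1 := (((hasDerivAt_id z).add_const (Complex.I * (κ : ℂ))).pow 2).const_mul (-Complex.I)
      refine h1.congr_deriv ?_
      simp; ring
    -- With `w = z + iκ` one finds `τ = 2(1 + ig) w̄/w`, and `S = 1/w` gives `θS'/(S + S̄) = -w̄/w`.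
    -- The field `a = i/S'` is the vertical translation in the coordinate `S`.
    refine ⟨fun z => (z + Complex.I * κ)⁻¹, fun z => -Complex.I * (z + Complex.I * κ) ^ 2,
      fun z hz => (hdS z hz).differentiableAt.differentiableWithinAt,
      fun z _ => (hda z).differentiableAt.differentiableWithinAt, fun z hz => ?_, fun z hz => ?_,
      fun z hz => ?_⟩
    · rw [(hdS z hz).deriv]; field_simp [hne z hz]
    · rw [(hda z).deriv]
      simp only [map_mul, map_add, map_pow, map_neg, Complex.conj_I, Complex.conj_ofReal, map_ofNat]
      ring
    · have hθ := add_conj_ne_zero (h.domain.re_pos _ hz)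
      have h1 := hκ z hz
      have hz1 := hne z hz
      have hz2 : conj z - Complex.I * κ ≠ 0 := by
        have h3 : conj (z + Complex.I * κ) ≠ 0 := (map_ne_zero _).2 hz1
        rw [map_add, map_mul, Complex.conj_I, Complex.conj_ofReal] at h3
        rwa [sub_eq_add_neg, ← neg_mul]
      rw [(hdS z hz).deriv]
      simp only [map_add, map_mul, map_inv₀, Complex.conj_I, Complex.conj_ofReal] at h1 ⊢
      have h2 : dy (dz (liftF F)) (q, z) * (z + conj z) * (z + Complex.I * κ)
          = 2 * (-Complex.I + g) * (z + conj z) - 2 * g * (z + Complex.I * κ) := by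
        field_simp at h1
        linear_combination h1
      rw [neg_mul Complex.I, ← sub_eq_add_neg]
      field_simp
      linear_combination ((z + conj z) * Complex.I) * h2 - 2 * (z + conj z) ^ 2 * hI

/-- Where `1 + i b_y ≠ 0`, the second equation determines `b` up to a sign: one of two linear
relations holds at each point. -/
theorem linear_relation (h : IsAnsatz D I Ω b F L ψ) (hBF : IsBFSolution ψ D)
    (hH : IsHCMASolution ψ D) {s : ℂ × ℂ} (hs : s ∈ cylinder Ω I) {γ S S' : ℂ}
    (hγ : dy (lift b) s = γ) (hc : 1 + Complex.I * γ ≠ 0)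
    (hS : (S + conj S) * (Complex.I * (s.2 + conj s.2) * dy (dz (liftF F)) s - 2)
        = -2 * (1 + Complex.I * γ.re) * (s.2 + conj s.2) * S') :
    (S + conj S) * dz (lift b) s = (lift b s - conj (lift b s)) * S' ∨
    (S + conj S) * dz (lift b) s = conj (1 + Complex.I * conj γ) * (1 + Complex.I * γ.re)
        / ((1 + Complex.I * γ) * (1 - Complex.I * γ.re)) * (lift b s - conj (lift b s)) * S' := by
  obtain ⟨h1, h2⟩ := h.relations hBF hH hs rfl rfl
  have hθ := add_conj_ne_zero (h.domain.re_pos _ hs.1)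
  have hI := Complex.I_sq
  have h0 : (4 : ℂ) ≠ 0 := by norm_num
  rw [hγ] at h1 h2
  set τ := Complex.I * (s.2 + conj s.2) * dy (dz (liftF F)) s - 2
  have hm := Complex.sub_conj (lift b s)
  push_cast at hm
  have hg1 : 1 + Complex.I * (γ.re : ℂ) ≠ 0 := fun h0 => by
    have := congrArg Complex.re h0; simp at this
  have hg2 : 1 - Complex.I * (γ.re : ℂ) ≠ 0 := fun h0 => by
    have := congrArg Complex.re h0; simp at this
  rcases mul_eq_zero.1 h2 with h3 | h3
  · left
    -- Multiplication by `τ` replaces `τ̄τ` by `4(1 + g²) = 4(1 + ig)(1 - ig)`, after which the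
    -- nonzero common factors cancel.
    have h4 : (s.2 + conj s.2) * dz (lift b) s * (1 + Complex.I * γ.re)
        = -Complex.I * (lift b s).im * τ := by
      apply mul_left_cancel₀ (mul_ne_zero (mul_ne_zero h0 hc) hg2)
      linear_combination τ * h3 - (s.2 + conj s.2) * dz (lift b) s * (1 + Complex.I * γ) * h1
        - 4 * (s.2 + conj s.2) * dz (lift b) s * (1 + Complex.I * γ) * (γ.re : ℂ) ^ 2 * hI
    apply mul_left_cancel₀ (mul_ne_zero hθ hg1)
    rw [hm]
    linear_combination (S + conj S) * h4 - Complex.I * (lift b s).im * hS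
  · right
    have h4 : (s.2 + conj s.2) * dz (lift b) s * ((1 + Complex.I * γ) * (1 - Complex.I * γ.re))
        = -Complex.I * (lift b s).im * conj (1 + Complex.I * conj γ) * τ := by
      apply mul_left_cancel₀ (mul_ne_zero h0 hg1)
      linear_combination τ * h3 - (s.2 + conj s.2) * dz (lift b) s * (1 + Complex.I * γ) * h1
        - 4 * (s.2 + conj s.2) * dz (lift b) s * (1 + Complex.I * γ) * (γ.re : ℂ) ^ 2 * hI
    rw [hm, div_mul_eq_mul_div, div_mul_eq_mul_div, eq_div_iff (mul_ne_zero hc hg2)]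
    apply mul_left_cancel₀ hθ
    linear_combination (S + conj S) * h4
      - Complex.I * (lift b s).im * conj (1 + Complex.I * conj γ) * hS

/-- If `b_y ≠ i` for one value of `y`, the relations at that value force `b_z = iν S'`, and `ψ_x`
acquires a symmetry whose `z`-component `a` vanishes nowhere. -/
theorem dy_b_eq_I (h : IsAnsatz D I Ω b F L ψ) (hBF : IsBFSolution ψ D)
    (hN : IsNoninvariant ψ D Ω) (hH : IsHCMASolution ψ D) {s : ℂ × ℂ} (hs : s ∈ cylinder Ω I) :
    dy (lift b) s = Complex.I := by
  by_contra hne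
  have hΩ := h.domain.isOpen_Ω
  set γ := dy (lift b) s with hγ
  have hc : 1 + Complex.I * γ ≠ 0 := fun h0 => hne (by
    linear_combination -Complex.I * h0 + γ * Complex.I_sq)
  have hm {z : ℂ} (hz : z ∈ Ω) : (s.1, z) ∈ cylinder Ω I := ⟨hz, hs.2⟩
  have hγz : ∀ z ∈ Ω, dy (lift b) (s.1, z) = γ := fun z hz => h.dy_b_eq hBF hH (hm hz) hs rfl
  obtain ⟨S, a, hS, ha, haS, hakill, hrel⟩ := h.exists_coordinate hBF hH hs.2 (g := γ.re)
    (fun z hz => by rw [hγz z hz])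
  have hS' : ∀ z ∈ Ω, deriv S z ≠ 0 := fun z hz h0 => by
    have := haS z hz
    rw [h0, mul_zero] at this
    exact Complex.I_ne_zero this.symm
  have hβ := h.holomorphic_b _ hs.2
  have hβ' : ∀ z ∈ Ω, deriv (fun z => b z s.1.im) z = dz (lift b) (s.1, z) := fun z hz =>
    (h.dz_b (hm hz)).symm
  set e := conj (1 + Complex.I * conj γ) * (1 + Complex.I * γ.re)
        / ((1 + Complex.I * γ) * (1 - Complex.I * γ.re))
  have hor : ∀ z ∈ Ω,
      (S z + conj (S z)) * deriv (fun z => b z s.1.im) z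
        = (b z s.1.im - conj (b z s.1.im)) * deriv S z ∨
      (S z + conj (S z)) * deriv (fun z => b z s.1.im) z
        = e * (b z s.1.im - conj (b z s.1.im)) * deriv S z := fun z hz => by
    rw [hβ' z hz]
    exact h.linear_relation hBF hH (hm hz) (hγz z hz) hc (hrel z hz)
  obtain ⟨ν, hν⟩ : ∃ ν : ℝ, ∀ z ∈ Ω, deriv (fun z => b z s.1.im) z
      = Complex.I * ν * deriv S z := by
    -- The choice between the two linear relations may vary with `z`. If the first fails somewhere,
    -- it fails on an open set, where the second holds; the rigidity lemma needs no more than an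
    -- open set.
    by_cases hall : ∀ z ∈ Ω, (S z + conj (S z)) * deriv (fun z => b z s.1.im) z
        = (b z s.1.im - conj (b z s.1.im)) * deriv S z
    · exact imaginary_const_of_relation hΩ h.domain.isPreconnected_Ω hΩ le_rfl ⟨_, hs.1⟩ (e := 1) hS
        hβ hS' (fun z hz => by rw [hall z hz, one_mul])
    · push Not at hall
      obtain ⟨z₁, hz₁, hne₁⟩ := hall
      have hcont : ContinuousOn (fun z => (S z + conj (S z)) * deriv (fun z => b z s.1.im) z
          - (b z s.1.im - conj (b z s.1.im)) * deriv S z) Ω := by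
        have hconj {f : ℂ → ℂ} (hf : ContinuousOn f Ω) : ContinuousOn (fun z => conj (f z)) Ω :=
          Complex.continuous_conj.comp_continuousOn hf
        exact ((hS.continuousOn.add (hconj hS.continuousOn)).mul (hβ.deriv hΩ).continuousOn).sub
          ((hβ.continuousOn.sub (hconj hβ.continuousOn)).mul (hS.deriv hΩ).continuousOn)
      refine imaginary_const_of_relation hΩ h.domain.isPreconnected_Ω
        (hcont.isOpen_inter_preimage hΩ isOpen_compl_singleton (t := {0}ᶜ)) Set.inter_subset_left
        ⟨z₁, hz₁, sub_ne_zero.2 hne₁⟩ (e := e) hS hβ hS' (fun z hz => ?_)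
      exact (hor z hz.1).resolve_left fun h0 => hz.2 (sub_eq_zero.2 h0)
  -- The relation was obtained at a single `y`, but `b_z` does not depend on `y`.
  have hbz : ∀ p ∈ D, dz (lift b) p = Complex.I * ν * deriv S p.2 := fun p hp => by
    have hp' := h.mem_cylinder hp
    rw [← hν _ hp'.1, hβ' _ hp'.1]
    exact h.dz_b_eq hBF hH hp' (hm hp'.1) rfl
  -- Since `a b_z = iν a S' = -ν`, the terms `a b_z/B` and their conjugates cancel `ν ψ_xx`. What is
  -- left, `-2(a + ā)/θ`, equals `-(a' + ā')` because `a` generates an isometry of the half plane.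
  obtain ⟨-, -, ha0⟩ := hN ν 0 a ha fun p hp => by
    have hp' := h.mem_cylinder hp
    have hX := h.hasFrame_dx_psi hp
    have hθ := add_conj_ne_zero (h.re_pos hp)
    have h1 := haS _ hp'.1
    have h2 := congrArg conj h1
    have h3 := hakill _ hp'.1
    rw [map_mul, Complex.conj_I] at h2
    rw [hX.dx_eq, hX.dz_eq, hX.dzbar_eq, hbz p hp]
    have h4 : deriv a p.2 + conj (deriv a p.2)
        = 2 * (a p.2 + conj (a p.2)) / (p.2 + conj p.2) := by rw [eq_div_iff hθ, h3]
    simp only [map_mul, Complex.conj_I, Complex.conj_ofReal, Complex.ofReal_zero, zero_mul, mul_zero,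
      add_zero, zero_sub]
    linear_combination (Complex.I * ν / arg b p) * h1 + (-Complex.I * ν / conj (arg b p)) * h2
      + h4 + (ν / arg b p + ν / conj (arg b p)) * Complex.I_sq
  have := haS _ hs.1
  rw [ha0 _ hs.1, zero_mul] at this
  exact Complex.I_ne_zero this.symm

end IsAnsatz

/-! ### The normal form -/

/-- `ψ` has the form common to the listed functions, with a term `F(z, y)` that satisfies the
equations. -/
structure IsNormalForm (D : Set (ℂ × ℂ)) (I : Set ℝ) (Ω : Set ℂ) (β : ℂ → ℂ) (F : ℂ → ℝ → ℝ)
    (L : ℂ × ℂ → ℂ) (ψ : ℂ × ℂ → ℝ) : Prop where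
  domain : IsDomainOver D I Ω
  holomorphic : DifferentiableOn ℂ β Ω
  smooth_F : ContDiffOn ℝ ∞ (fun s : ℂ × ℝ => F s.1 s.2) (Ω ×ˢ I)
  continuous_L : ContinuousOn L D
  exp_L : ∀ p ∈ D, Complex.exp (L p) = p.1 + β p.2
  dz_dzbar : ∀ p ∈ cylinder Ω I,
    dz (dzbar (liftF F)) p = (β p.2 + conj (β p.2)) / (p.2 + conj p.2) ^ 2
  dichotomy : ∀ q : ℂ, q.im ∈ I → (∀ z ∈ Ω, dy (dz (liftF F)) (q, z) = 0) ∨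
    ∃ κ : ℝ, ∀ z ∈ Ω, dy (dz (liftF F)) (q, z) * (z + Complex.I * κ) = -2 * Complex.I
  eq : ∀ p ∈ D, (ψ p : ℂ) = (p.1 + β p.2) * L p + (conj p.1 + conj (β p.2)) * conj (L p)
      - (p.1 + conj p.1) * (Complex.log (p.2 + conj p.2) + 1) + (F p.2 p.1.im : ℂ)

theorem isNormalForm_of_isAnsatz {D : Set (ℂ × ℂ)} {I : Set ℝ} {Ω : Set ℂ} {b : ℂ → ℝ → ℂ}
    {F : ℂ → ℝ → ℝ} {L : ℂ × ℂ → ℂ} {ψ : ℂ × ℂ → ℝ} (h : IsAnsatz D I Ω b F L ψ)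
    (hBF : IsBFSolution ψ D) (hN : IsNoninvariant ψ D Ω) (hH : IsHCMASolution ψ D) {y₀ : ℝ}
    (hy₀ : y₀ ∈ I) : IsNormalForm D I Ω (fun z => b z y₀ - Complex.I * y₀) F L ψ := by
  have hb : ∀ z ∈ Ω, ∀ y ∈ I, b z y = b z y₀ - Complex.I * y₀ + Complex.I * y := by
    intro z hz y hy
    have hd : ∀ t ∈ I, HasDerivAt (fun t : ℝ => b z t - Complex.I * t) 0 t := fun t ht => by
      have hm : ((⟨0, t⟩ : ℂ), z) ∈ cylinder Ω I := ⟨hz, ht⟩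
      have h1 := (h.hasFrame_b hm).hasDerivAt_im
      rw [h.dy_b_eq_I hBF hN hH hm] at h1
      have h2 := h1.sub ((Complex.ofRealCLM.hasDerivAt (x := t)).const_mul Complex.I)
      simp only [Complex.ofRealCLM_apply, Complex.ofReal_one, mul_one, sub_self] at h2
      exact h2
    have := h.domain.isOpen_I.is_const_of_deriv_eq_zero h.domain.ordConnected_I.isPreconnected
      (fun t ht => (hd t ht).differentiableAt.differentiableWithinAt) (fun t ht => (hd t ht).deriv)
      hy hy₀
    linear_combination (this : b z y - Complex.I * y = b z y₀ - Complex.I * y₀)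
  have hbp : ∀ p ∈ D, (p.1.re : ℂ) + b p.2 p.1.im = p.1 + (b p.2 y₀ - Complex.I * y₀) := by
    intro p hp
    have hp' := h.mem_cylinder hp
    rw [hb _ hp'.1 _ hp'.2]
    conv_rhs => rw [← Complex.re_add_im p.1]
    ring
  exact {
    domain := h.domain
    holomorphic := (h.holomorphic_b _ hy₀).sub_const _
    smooth_F := h.smooth_F
    continuous_L := h.continuous_L
    exp_L := fun p hp => by rw [h.exp_L p hp, hbp p hp]
    dz_dzbar := fun p hp => by
      rw [h.dz_dzbar_F hBF hp, lift, hb _ hp.1 _ hp.2]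
      simp only [map_add, map_sub, map_mul, Complex.conj_I, Complex.conj_ofReal]
      ring
    dichotomy := fun q hq => by
      have := h.phi_dichotomy hBF hH hq (g := 0)
        (fun z hz => by rw [h.dy_b_eq_I hBF hN hH (s := (q, z)) ⟨hz, hq⟩, Complex.I_re])
      simpa using this
    eq := fun p hp => by
      have h1 := congrArg conj (hbp p hp)
      simp only [map_add, Complex.conj_ofReal] at h1
      have h2 : p.1 + conj p.1 = 2 * (p.1.re : ℂ) := by rw [Complex.add_conj]; push_cast; ring
      rw [h.eq p hp, h1, hbp p hp, h2, map_sub, add_sub_assoc] }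

/-! ### Normal forms with nonvanishing `F_yz`: the third family -/

namespace IsNormalForm

variable {D : Set (ℂ × ℂ)} {I : Set ℝ} {Ω : Set ℂ} {β : ℂ → ℂ} {F : ℂ → ℝ → ℝ}
  {L : ℂ × ℂ → ℂ} {ψ : ℂ × ℂ → ℝ}

theorem contDiffOn_F (h : IsNormalForm D I Ω β F L ψ) :
    ContDiffOn ℝ ∞ (liftF F) (cylinder Ω I) :=
  contDiffOn_lift (Complex.ofRealCLM.contDiff.comp_contDiffOn h.smooth_F)

theorem restrict (h : IsNormalForm D I Ω β F L ψ) {J : Set ℝ} (hJ : IsOpen J)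
    (hJ' : J.OrdConnected) (hJI : J ⊆ I) :
    IsNormalForm {p ∈ D | p.1.im ∈ J} J Ω β F L ψ where
  domain :=
    { isOpen := h.domain.isOpen.inter (hJ.preimage (Complex.continuous_im.comp continuous_fst))
      isOpen_I := hJ
      ordConnected_I := hJ'
      isOpen_Ω := h.domain.isOpen_Ω
      isPreconnected_Ω := h.domain.isPreconnected_Ω
      re_pos := h.domain.re_pos
      proj_mem := fun p hp => ⟨hp.2, (h.domain.proj_mem p hp.1).2⟩
      exists_mem := fun y hy z hz => (h.domain.exists_mem y (hJI hy) z hz).imp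
        fun _ hx => ⟨hx, hy⟩ }
  holomorphic := h.holomorphic
  smooth_F := h.smooth_F.mono (Set.prod_mono_right hJI)
  continuous_L := h.continuous_L.mono fun _ hp => hp.1
  exp_L p hp := h.exp_L p hp.1
  dz_dzbar p hp := h.dz_dzbar p ⟨hp.1, hJI hp.2⟩
  dichotomy q hq := h.dichotomy q (hJI hq)
  eq p hp := h.eq p hp.1

/-- If `F_{yz} = -2i / (z - 2ik(y))`, then `F` is the sum of a function of `z`, of the integral of
the angle, and of a function of `y`. -/
theorem F_eq_add (h : IsNormalForm D I Ω β F L ψ) {k : ℝ → ℝ} (hk : ContDiffOn ℝ ∞ k I)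
    (hφ : ∀ p ∈ cylinder Ω I,
      dy (dz (liftF F)) p * (p.2 - 2 * Complex.I * k p.1.im) = -2 * Complex.I)
    {y₁ : ℝ} (hy₁ : y₁ ∈ I) {z₀ z : ℂ} (hz₀ : z₀ ∈ Ω) (hz : z ∈ Ω) {y : ℝ} (hy : y ∈ I) :
    F z y = F z y₁ + angleIntegral k y₁ z y
      + (F z₀ y - F z₀ y₁ - angleIntegral k y₁ z₀ y) := by
  have hΩ := h.domain.isOpen_Ω
  have hI := h.domain.isOpen_I
  have hI' := h.domain.ordConnected_I
  have hre := h.domain.re_pos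
  have hS := isOpen_cylinder hΩ hI
  have hK := contDiffOn_liftF_angleIntegral hΩ hI hI' hre hk hy₁
  set E : ℂ × ℂ → ℂ := fun s => liftF F s - liftF (angleIntegral k y₁) s
  have hE : ContDiffOn ℝ ∞ E (cylinder Ω I) := h.contDiffOn_F.sub hK
  have hEreal : ∀ s, conj (E s) = E s := fun s => by simp [E, conj_liftF]
  have hdz : ∀ s ∈ cylinder Ω I, dz E s = dz (liftF F) s - dz (liftF (angleIntegral k y₁)) s :=
    fun s hs => ((hasFrame_of_contDiffOn hS h.contDiffOn_F hs).sub
      (hasFrame_of_contDiffOn hS hK hs)).dz_eq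
  have hdydz : ∀ s ∈ cylinder Ω I, dy (dz E) s = 0 := fun s hs => by
    rw [dy_congr_on hS hdz hs, ((hasFrame_of_contDiffOn hS (contDiffOn_dz hS h.contDiffOn_F) hs).sub
      (hasFrame_of_contDiffOn hS (contDiffOn_dz hS hK) hs)).dy_eq,
      dy_dz_angleIntegral hΩ hI hI' hre hk hy₁ hs, sub_eq_zero, eq_div_iff, hφ s hs]
    exact ne_zero_of_re_pos (by rw [re_sub_two_I_mul]; exact hre _ hs.1)
  have hindep : ∀ t ∈ I, dy E (⟨0, t⟩, z) = dy E (⟨0, t⟩, z₀) := fun t ht => by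
    have hd : ∀ w ∈ Ω, HasDerivAt (fun w => dy E (⟨0, t⟩, w)) 0 w := fun w hw => by
      have hm : ((⟨0, t⟩ : ℂ), w) ∈ cylinder Ω I := ⟨hw, ht⟩
      have h1 := hasFrame_of_contDiffOn hS (contDiffOn_dy hS hE) hm
      have e1 : dz (dy E) (⟨0, t⟩, w) = 0 := by rw [← dy_dz_comm hS hE hm, hdydz _ hm]
      have e2 : dzbar (dy E) (⟨0, t⟩, w) = 0 := by
        rw [← dy_dzbar_comm hS hE hm, dy_dzbar_eq_conj hS hE hEreal hm, hdydz _ hm, map_zero]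
      exact (h1.congr_coeff rfl rfl e1 e2).hasDerivAt_snd
    -- Because `E` is real, `E_yz = 0` entails `E_yz̄ = 0`, so `E_y` depends on `y` alone.
    exact hΩ.is_const_of_deriv_eq_zero h.domain.isPreconnected_Ω
      (fun w hw => (hd w hw).differentiableAt.differentiableWithinAt) (fun w hw => (hd w hw).deriv)
      hz hz₀
  have hd : ∀ t ∈ I, HasDerivAt (fun t : ℝ => E (⟨0, t⟩, z) - E (⟨0, t⟩, z₀)) 0 t := fun t ht => by
    have h1 := (hasFrame_of_contDiffOn hS hE (p := (⟨0, t⟩, z)) ⟨hz, ht⟩).hasDerivAt_im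
    have h2 := (hasFrame_of_contDiffOn hS hE (p := (⟨0, t⟩, z₀)) ⟨hz₀, ht⟩).hasDerivAt_im
    have h3 := h1.sub h2
    rw [hindep t ht, sub_self] at h3
    exact h3
  have hconst := hI.is_const_of_deriv_eq_zero hI'.isPreconnected
    (fun t ht => (hd t ht).differentiableAt.differentiableWithinAt) (fun t ht => (hd t ht).deriv)
    hy hy₁
  simp only [E, liftF, lift, angleIntegral, intervalIntegral.integral_same] at hconst
  norm_cast at hconst
  simp only [angleIntegral]
  linarith

theorem isListed_of_angle (h : IsNormalForm D I Ω β F L ψ) {k : ℝ → ℝ} (hk : ContDiffOn ℝ ∞ k I)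
    (hφ : ∀ p ∈ cylinder Ω I,
      dy (dz (liftF F)) p * (p.2 - 2 * Complex.I * k p.1.im) = -2 * Complex.I)
    {y₁ : ℝ} (hy₁ : y₁ ∈ I) {z₀ : ℂ} (hz₀ : z₀ ∈ Ω) : IsListed D ψ := by
  have hΩ := h.domain.isOpen_Ω
  have hI := h.domain.isOpen_I
  have hI' := h.domain.ordConnected_I
  have hre := h.domain.re_pos
  have hS := isOpen_cylinder hΩ hI
  have hG : ContDiffOn ℝ ∞ (fun z => F z y₁) Ω := by
    have h1 : ContDiff ℝ ∞ (fun z : ℂ => (z, y₁)) := contDiff_prodMk_left y₁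
    exact h.smooth_F.comp h1.contDiffOn fun z hz => Set.mk_mem_prod hz hy₁
  have hcurve : ContDiff ℝ ∞ (fun y : ℝ => (z₀, y)) := contDiff_prodMk_right z₀
  have hmaps : Set.MapsTo (fun y : ℝ => (z₀, y)) I (Ω ×ˢ I) := fun y hy => Set.mk_mem_prod hz₀ hy
  have hr : ContDiffOn ℝ ∞ (fun y => F z₀ y - F z₀ y₁ - angleIntegral k y₁ z₀ y) I := by
    have h1 := h.smooth_F.comp hcurve.contDiffOn hmaps
    have h2 := (contDiffOn_angleIntegral hΩ hI hI' hre hk hy₁).comp hcurve.contDiffOn hmaps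
    simp only [Function.comp_def] at h1 h2
    exact (h1.sub contDiffOn_const).sub h2
  have hadd {z : ℂ} (hz : z ∈ Ω) {y : ℝ} (hy : y ∈ I) := h.F_eq_add hk hφ hy₁ hz₀ hz hy
  refine ⟨I, Ω, β, L, fun z => F z y₁, fun y => F z₀ y - F z₀ y₁ - angleIntegral k y₁ z₀ y,
    h.domain, h.holomorphic, h.continuous_L, h.exp_L, ⟨hG, fun z hz => ?_⟩, hr,
    Or.inr (Or.inr ⟨k, y₁, hk, hy₁, fun p hp => ?_⟩)⟩
  · have hm : ((⟨0, y₁⟩ : ℂ), z) ∈ cylinder Ω I := ⟨hz, hy₁⟩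
    have h1 := (dy_dz_liftF_add hΩ hI hG
      (contDiffOn_liftF_angleIntegral hΩ hI hI' hre hk hy₁) hr hm).2
    rw [dz_dzbar_angleIntegral hΩ hI hI' hre hk hy₁ hm, add_zero] at h1
    rw [← h1, ← h.dz_dzbar _ hm]
    have h2 : ∀ s ∈ cylinder Ω I, liftF (fun z y => F z y₁ + angleIntegral k y₁ z y
        + (F z₀ y - F z₀ y₁ - angleIntegral k y₁ z₀ y)) s = liftF F s := fun s hs => by
      simp only [liftF, lift, ← hadd hs.1 hs.2]
    exact dz_congr_on hS (fun s hs => dzbar_congr_on hS h2 hs) hm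
  · have hp' := h.domain.proj_mem p hp
    rw [h.eq p hp, hadd hp'.2 hp'.1, sol3]
    have h1 : (angleIntegral k y₁ p.2 p.1.im : ℂ) = 2 * Complex.I * (∫ t in y₁..p.1.im,
        Complex.log ((conj p.2 + 2 * Complex.I * (k t : ℂ)) / (p.2 - 2 * Complex.I * (k t : ℂ)))) := by
      rw [angleIntegral, ← intervalIntegral.integral_ofReal, ← intervalIntegral.integral_const_mul]
      simp only [angle_eq (hre _ hp'.2)]
    rw [← h1]
    push_cast
    ring

/-- Where `F_{yz} ≠ 0`, the function is one of the third family. -/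
theorem exists_isListed (h : IsNormalForm D I Ω β F L ψ) {y₀ : ℝ} (hy₀ : y₀ ∈ I) {z₀ : ℂ}
    (hz₀ : z₀ ∈ Ω) (hne : dy (dz (liftF F)) (⟨0, y₀⟩, z₀) ≠ 0) :
    ∃ J : Set ℝ, IsOpen J ∧ J.OrdConnected ∧ y₀ ∈ J ∧ J ⊆ I ∧
      IsListed {p ∈ D | p.1.im ∈ J} ψ := by
  have hΩ := h.domain.isOpen_Ω
  have hI := h.domain.isOpen_I
  have hS := isOpen_cylinder hΩ hI
  set f : ℝ → ℂ := fun y => dy (dz (liftF F)) (⟨0, y⟩, z₀)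
  have hf : ContDiffOn ℝ ∞ f I := by
    have h1 : ContDiff ℝ ∞ (fun y : ℝ => ((⟨0, y⟩ : ℂ), z₀)) := by
      have e : ContDiff ℝ ∞ (fun y : ℝ => (⟨0, y⟩ : ℂ)) := by
        simp only [Complex.mk_eq_add_mul_I]
        exact contDiff_const.add (Complex.ofRealCLM.contDiff.mul contDiff_const)
      exact e.prodMk contDiff_const
    exact (contDiffOn_dy hS (contDiffOn_dz hS h.contDiffOn_F)).comp h1.contDiffOn
      fun y hy => ⟨hz₀, hy⟩
  have hev : ∀ᶠ y in 𝓝 y₀, f y ≠ 0 ∧ y ∈ I :=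
    ((hf.continuousOn.continuousAt (hI.mem_nhds hy₀)).eventually_ne hne).and (hI.mem_nhds hy₀)
  obtain ⟨ε, hε, hball⟩ := Metric.eventually_nhds_iff_ball.1 hev
  have hJI : Metric.ball y₀ ε ⊆ I := fun y hy => (hball y hy).2
  have hJ' : (Metric.ball y₀ ε).OrdConnected := (convex_ball y₀ ε).ordConnected
  refine ⟨Metric.ball y₀ ε, Metric.isOpen_ball, hJ', Metric.mem_ball_self hε, hJI, ?_⟩
  -- The equation `F_yz (z - 2ik) = -2i` solved for `k` at `z = z₀`. The quotient is real by the
  -- dichotomy, and taking the real part makes `k` a smooth real function by construction.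
  set k : ℝ → ℝ := fun y => ((2 * Complex.I / f y + z₀) / (2 * Complex.I)).re
  have hk : ContDiffOn ℝ ∞ k (Metric.ball y₀ ε) := by
    have h1 : ContDiffOn ℝ ∞ (fun y => (f y)⁻¹) (Metric.ball y₀ ε) :=
      (hf.mono hJI).inv fun y hy => (hball y hy).1
    have h2 : ContDiffOn ℝ ∞ (fun y => (2 * Complex.I / f y + z₀) / (2 * Complex.I))
        (Metric.ball y₀ ε) := by
      simp only [div_eq_mul_inv]
      exact ((contDiffOn_const.mul h1).add contDiffOn_const).mul contDiffOn_const
    exact Complex.reCLM.contDiff.comp_contDiffOn h2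
  refine (h.restrict Metric.isOpen_ball hJ' hJI).isListed_of_angle hk (fun p hp => ?_)
    (Metric.mem_ball_self hε) hz₀
  obtain ⟨hf0, hpI⟩ := hball _ hp.2
  -- Vanishing of `F_yz` is excluded on this interval, so the second alternative holds and
  -- identifies `k` with `-κ/2`.
  rcases h.dichotomy p.1 hpI with h0 | ⟨κ, hκ⟩
  · refine absurd ?_ hf0
    rw [← h0 z₀ hz₀]
    exact (xInvariant_lift _).dz.dy.eq_of_eq rfl rfl
  · have h1 := hκ z₀ hz₀
    have e : dy (dz (liftF F)) (p.1, z₀) = f p.1.im :=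
      (xInvariant_lift _).dz.dy.eq_of_eq rfl rfl
    rw [e] at h1
    have h2 : k p.1.im = -κ / 2 := by
      have h3 : (2 * Complex.I / f p.1.im + z₀) / (2 * Complex.I) = ((-κ / 2 : ℝ) : ℂ) := by
        have hI0 := Complex.I_ne_zero
        push_cast
        field_simp
        linear_combination h1
      simp only [k]
      rw [h3, Complex.ofReal_re]
    rw [h2, ← hκ p.2 hp.1]
    push_cast
    ring

end IsNormalForm

/-! ### The inverted normal form -/

theorem log_inv_add_conj {w : ℂ} (hw : 0 < w.re) :
    Complex.log (w⁻¹ + conj w⁻¹)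
      = Complex.log (w + conj w) - Complex.log w - conj (Complex.log w) := by
  have h0 := ne_zero_of_re_pos hw
  have hn : 0 < Complex.normSq w := Complex.normSq_pos.2 h0
  have h1 : w⁻¹ + conj w⁻¹ = ((2 * w.re / Complex.normSq w : ℝ) : ℂ) := by
    rw [Complex.add_conj, Complex.inv_re, mul_div_assoc]
  have h2 : Complex.log w + conj (Complex.log w) = ((2 * Real.log ‖w‖ : ℝ) : ℂ) := by
    rw [Complex.add_conj, Complex.log_re]
  rw [sub_sub, h2, h1, Complex.add_conj, ← Complex.ofReal_log (by positivity),
    ← Complex.ofReal_log (by positivity), Real.log_div (by positivity) hn.ne',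
    Complex.normSq_eq_norm_sq, Real.log_pow]
  push_cast
  ring

theorem preimage_inv_eq_image {Ω : Set ℂ} : (fun w : ℂ => w⁻¹) ⁻¹' Ω = (fun w : ℂ => w⁻¹) '' Ω := by
  ext w
  exact ⟨fun h => ⟨w⁻¹, h, inv_inv w⟩, by rintro ⟨z, hz, rfl⟩; simpa using hz⟩

/-- The `F` of the image under the inversion. -/
def invertedF (F : ℂ → ℝ → ℝ) (w : ℂ) (y : ℝ) : ℝ :=
  F w⁻¹ y + angleIntegral (fun _ => 0) 0 w y

/-- The image of `ψ` under the inversion. -/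
def invertedSol (ψ : ℂ × ℂ → ℝ) (p : ℂ × ℂ) : ℝ :=
  ψ (p.1, p.2⁻¹) + 4 * (p.1 * Complex.log p.2⁻¹).re

section Inverted

variable {I : Set ℝ} {Ω : Set ℂ} {F : ℂ → ℝ → ℝ}

theorem angleIntegral_zero (w : ℂ) (y : ℝ) :
    angleIntegral (fun _ => 0) 0 w y = 4 * y * (Complex.log w).im := by
  simp [angleIntegral, angle]
  ring

theorem isOpen_preimage_inv (hΩ : IsOpen Ω) (hre : ∀ z ∈ Ω, 0 < z.re) :
    IsOpen ((fun w : ℂ => w⁻¹) ⁻¹' Ω) := by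
  refine isOpen_iff_mem_nhds.2 fun w hw => ?_
  have h0 : w ≠ 0 := fun h => by simpa [h] using hre _ hw
  exact (continuousAt_inv₀ h0).preimage_mem_nhds (hΩ.mem_nhds hw)

theorem re_pos_of_inv {w : ℂ} (h : 0 < (w⁻¹).re) : 0 < w.re := by simpa using inv_re_pos h

/-- The chain rule gives the factors, and the added term `4y arg w`, harmonic in `w`, contributes
only the shift `-2i/w` to `F_yz`. -/
theorem derivs_invertedF (hΩ : IsOpen Ω) (hI : IsOpen I) (hre : ∀ z ∈ Ω, 0 < z.re)
    (hF : ContDiffOn ℝ ∞ (liftF F) (cylinder Ω I)) {p : ℂ × ℂ} (hp : (p.1, p.2⁻¹) ∈ cylinder Ω I) :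
    dy (dz (liftF (invertedF F))) p
        = -(p.2 ^ 2)⁻¹ * dy (dz (liftF F)) (p.1, p.2⁻¹) - 2 * Complex.I / p.2 ∧
    dz (dzbar (liftF (invertedF F))) p
        = (p.2⁻¹ * conj p.2⁻¹) ^ 2 * dz (dzbar (liftF F)) (p.1, p.2⁻¹) := by
  have hS := isOpen_cylinder hΩ hI
  have hΩ' := isOpen_preimage_inv hΩ hre
  have hre' : ∀ w ∈ (fun w : ℂ => w⁻¹) ⁻¹' Ω, 0 < w.re := fun w hw => re_pos_of_inv (hre _ hw)
  have hS' := isOpen_cylinder hΩ' isOpen_univ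
  have hT := isOpen_cylinder hΩ' hI
  have hpT : p ∈ cylinder ((fun w : ℂ => w⁻¹) ⁻¹' Ω) I := hp
  have hpS : p ∈ cylinder ((fun w : ℂ => w⁻¹) ⁻¹' Ω) Set.univ := ⟨hp.1, trivial⟩
  have hk : ContDiffOn ℝ ∞ (fun _ : ℝ => (0 : ℝ)) Set.univ := contDiffOn_const
  have hA := contDiffOn_liftF_angleIntegral hΩ' isOpen_univ Set.ordConnected_univ hre' hk
    (Set.mem_univ 0)
  have hA1 := dy_dz_angleIntegral hΩ' isOpen_univ Set.ordConnected_univ hre' hk (Set.mem_univ 0) hpS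
  have hA2 := dz_dzbar_angleIntegral hΩ' isOpen_univ Set.ordConnected_univ hre' hk (Set.mem_univ 0)
    hpS
  have h0 (s) (hs : s ∈ cylinder ((fun w : ℂ => w⁻¹) ⁻¹' Ω) I) : s.2 ≠ 0 :=
    ne_zero_of_re_pos (hre' _ hs.1)
  have hfr : ∀ s ∈ cylinder ((fun w : ℂ => w⁻¹) ⁻¹' Ω) I,
      HasFrame (liftF (invertedF F)) s _ _ _ _ := fun s hs =>
    (((hasFrame_of_contDiffOn hS hF (p := (s.1, s.2⁻¹)) hs).comp_inv (h0 s hs)).add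
      (hasFrame_of_contDiffOn hS' hA (p := s) ⟨hs.1, trivial⟩)).congr_of_eventuallyEq
      (Filter.Eventually.of_forall fun s => by simp [liftF, lift, invertedF])
  have hinv : HasFrame (fun s : ℂ × ℂ => -(s.2 ^ 2)⁻¹) p 0 0 (2 * (p.2 ^ 3)⁻¹) 0 := by
    have h1 := hasFrame_snd.comp_holomorphic (p := p) (hasDerivAt_inv (h0 p hpT))
    have h2 := ((h1.mul h1).const_mul (-1)).congr_of_eventuallyEq
      (g := fun s : ℂ × ℂ => -(s.2 ^ 2)⁻¹) (Filter.Eventually.of_forall fun s => by ring)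
    refine h2.congr_coeff (by ring) (by ring) ?_ (by ring)
    have := h0 p hpT
    field_simp
    ring
  constructor
  · rw [dy_congr_on hT (fun s hs => (hfr s hs).dz_eq) hpT,
      ((((hasFrame_of_contDiffOn hS (contDiffOn_dz hS hF) hp).comp_inv (h0 p hpT)).mul hinv).add
        (hasFrame_of_contDiffOn hS' (contDiffOn_dz hS' hA) hpS)).dy_eq, hA1]
    simp
    ring
  · rw [dz_congr_on hT (fun s hs => (hfr s hs).dzbar_eq) hpT,
      ((((hasFrame_of_contDiffOn hS (contDiffOn_dzbar hS hF) hp).comp_inv (h0 p hpT)).mul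
        hinv.conj).add (hasFrame_of_contDiffOn hS' (contDiffOn_dzbar hS' hA) hpS)).dz_eq, hA2]
    simp
    ring

end Inverted

/-! ### Inversion of normal forms and the final alternative -/

namespace IsNormalForm

variable {D : Set (ℂ × ℂ)} {I : Set ℝ} {Ω : Set ℂ} {β : ℂ → ℂ} {F : ℂ → ℝ → ℝ}
  {L : ℂ × ℂ → ℂ} {ψ : ℂ × ℂ → ℝ}

/-- On the alternatives for `F_yz` the inversion acts by `κ ↦ -1/κ`, with `F_yz = 0` in the role of
`κ = ∞`. In `ψ` itself the `x`-part of the added term is absorbed by `ln(z + z̄)`, and only `4y arg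
w` remains to be put into `F`. -/
theorem invert (h : IsNormalForm D I Ω β F L ψ) :
    IsNormalForm {p | (p.1, p.2⁻¹) ∈ D} I ((fun w : ℂ => w⁻¹) ⁻¹' Ω) (fun w => β w⁻¹)
      (invertedF F) (fun p => L (p.1, p.2⁻¹)) (invertedSol ψ) := by
  have hΩ := h.domain.isOpen_Ω
  have hI := h.domain.isOpen_I
  have hre := h.domain.re_pos
  have hΩ' := isOpen_preimage_inv hΩ hre
  have hre' : ∀ w ∈ (fun w : ℂ => w⁻¹) ⁻¹' Ω, 0 < w.re := fun w hw => re_pos_of_inv (hre _ hw)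
  have hne : ∀ w ∈ (fun w : ℂ => w⁻¹) ⁻¹' Ω, w ≠ 0 := fun w hw => ne_zero_of_re_pos (hre' w hw)
  have hmem (p : ℂ × ℂ) (hp : (p.1, p.2⁻¹) ∈ D) :
      p.1.im ∈ I ∧ p.2 ∈ (fun w : ℂ => w⁻¹) ⁻¹' Ω := h.domain.proj_mem _ hp
  have hcont : ∀ p : ℂ × ℂ, p.2 ≠ 0 → ContinuousAt (fun p : ℂ × ℂ => (p.1, p.2⁻¹)) p :=
    fun p hp => continuousAt_fst.prodMk (continuousAt_snd.inv₀ hp)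
  refine ⟨⟨?_, hI, h.domain.ordConnected_I, hΩ', ?_, hre', hmem, fun y hy w hw =>
    h.domain.exists_mem y hy w⁻¹ hw⟩, ?_, ?_, ?_, fun p hp => h.exp_L _ hp, ?_, ?_, ?_⟩
  · refine isOpen_iff_mem_nhds.2 fun p hp => ?_
    exact (hcont p (hne _ (hmem p hp).2)).preimage_mem_nhds (h.domain.isOpen.mem_nhds hp)
  · rw [preimage_inv_eq_image]
    exact h.domain.isPreconnected_Ω.image _ fun z hz =>
      (continuousAt_inv₀ (ne_zero_of_re_pos (hre z hz))).continuousWithinAt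
  · exact h.holomorphic.comp (fun w hw => (differentiableAt_inv (hne w hw)).differentiableWithinAt)
      fun w hw => hw
  · have h1 : ContDiffOn ℝ ∞ (fun s : ℂ × ℝ => (s.1⁻¹, s.2)) (((fun w : ℂ => w⁻¹) ⁻¹' Ω) ×ˢ I) := by
      refine ContDiffOn.prodMk (fun s hs => ?_) contDiffOn_snd
      exact (((contDiffAt_inv ℂ (hne _ hs.1) (n := ∞)).restrict_scalars ℝ).comp s
        contDiffAt_fst).contDiffWithinAt
    have h2 := h.smooth_F.comp h1 fun s hs => Set.mk_mem_prod hs.1 hs.2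
    have h3 := (contDiffOn_angleIntegral hΩ' isOpen_univ Set.ordConnected_univ hre'
      (k := fun _ => 0) contDiffOn_const (Set.mem_univ 0)).mono
      (Set.prod_mono_right (Set.subset_univ I))
    exact h2.add h3
  · intro p hp
    have hp' : (p.1, p.2⁻¹) ∈ D := hp
    have h1 := h.continuous_L.continuousAt (h.domain.isOpen.mem_nhds hp')
    exact (ContinuousAt.comp (f := fun p : ℂ × ℂ => (p.1, p.2⁻¹)) h1
      (hcont p (hne _ (hmem p hp).2))).continuousWithinAt
  · intro p hp
    have hp' : (p.1, p.2⁻¹) ∈ cylinder Ω I := hp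
    have h0 := hne _ hp.1
    have h0' : conj p.2 ≠ 0 := by simpa using h0
    have h1 := add_conj_ne_zero (hre' _ hp.1)
    rw [(derivs_invertedF hΩ hI hre h.contDiffOn_F hp').2, h.dz_dzbar _ hp']
    have e : p.2⁻¹ + conj p.2⁻¹ = (p.2 + conj p.2) * (p.2⁻¹ * conj p.2⁻¹) := by
      rw [map_inv₀]; field_simp; ring
    have h2 : p.2⁻¹ * conj p.2⁻¹ ≠ 0 := by rw [map_inv₀]; positivity
    simp only [e]
    rw [mul_pow (p.2 + conj p.2), div_mul_eq_div_div_swap, div_right_comm]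
    exact mul_div_cancel₀ _ (pow_ne_zero 2 h2)
  · intro q hq
    have key (w) (hw : w ∈ (fun w : ℂ => w⁻¹) ⁻¹' Ω) :=
      (derivs_invertedF hΩ hI hre h.contDiffOn_F (p := (q, w)) ⟨hw, hq⟩).1
    rcases h.dichotomy q hq with h0 | ⟨κ, hκ⟩
    -- The value `κ = ∞` goes to `κ = 0`: only the shift `-2i/w` survives.
    · refine Or.inr ⟨0, fun w hw => ?_⟩
      rw [key w hw, h0 _ hw]
      have := hne w hw
      simp only [Complex.ofReal_zero]
      field_simp
      ring
    · have hφ (w) (hw : w ∈ (fun w : ℂ => w⁻¹) ⁻¹' Ω) :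
          dy (dz (liftF F)) (q, w⁻¹) * (1 + Complex.I * κ * w) = -2 * Complex.I * w := by
        rw [← hκ _ hw]
        have := hne w hw
        field_simp
      by_cases hκ0 : κ = 0
      -- The value `κ = 0` goes to `κ = ∞`: the shift cancels `F_yz`.
      · refine Or.inl fun w hw => ?_
        have h1 := hφ w hw
        have := hne w hw
        rw [key w hw]
        simp only [hκ0, Complex.ofReal_zero, mul_zero, zero_mul, add_zero, mul_one] at h1
        rw [h1]
        field_simp
        ring
      · refine Or.inr ⟨-κ⁻¹, fun w hw => ?_⟩
        have h1 := hφ w hw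
        have h2 := hne w hw
        have h3 : (κ : ℂ) ≠ 0 := by exact_mod_cast hκ0
        rw [key w hw]
        simp only
        generalize dy (dz (liftF F)) (q, w⁻¹) = φ at h1
        push_cast
        field_simp
        linear_combination Complex.I * h1 - φ * κ * w * Complex.I_sq
  · intro p hp
    have hp' : (p.1, p.2⁻¹) ∈ D := hp
    have hw := hre' _ (hmem p hp).2
    have e1 : ((4 * (p.1 * Complex.log p.2⁻¹).re : ℝ) : ℂ)
        = -2 * (p.1 * Complex.log p.2 + conj (p.1 * Complex.log p.2)) := by
      rw [log_inv_of_re_pos hw, Complex.add_conj]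
      simp only [mul_neg, Complex.neg_re]
      push_cast
      ring
    have e2 : ((4 * p.1.im * (Complex.log p.2).im : ℝ) : ℂ)
        = -(p.1 - conj p.1) * (Complex.log p.2 - conj (Complex.log p.2)) := by
      rw [Complex.sub_conj, Complex.sub_conj]
      push_cast
      linear_combination (4 * (p.1.im : ℂ) * ((Complex.log p.2).im : ℂ)) * Complex.I_sq
    rw [invertedSol, invertedF, Complex.ofReal_add, Complex.ofReal_add, h.eq _ hp', e1,
      angleIntegral_zero, e2, log_inv_add_conj hw, map_mul]
    ring

theorem transforms_inversion (h : IsNormalForm D I Ω β F L ψ) (J : Set ℝ) :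
    Transforms inversion ψ {p ∈ D | p.1.im ∈ J} (invertedSol ψ)
      {p ∈ {p | (p.1, p.2⁻¹) ∈ D} | p.1.im ∈ J} := by
  refine ⟨?_, Set.Subset.antisymm ?_ ?_⟩
  · rintro _ ⟨p, hp, rfl⟩
    exact h.domain.re_pos _ (h.domain.proj_mem p hp.1).2
  · rintro _ ⟨_, ⟨p, hp, rfl⟩, rfl⟩
    exact ⟨(p.1, p.2⁻¹), ⟨by simpa using hp.1, hp.2⟩, by simp [inversion_apply, invertedSol]⟩
  · rintro _ ⟨p, hp, rfl⟩
    exact ⟨_, ⟨(p.1, p.2⁻¹), ⟨hp.1, hp.2⟩, rfl⟩, by simp [inversion_apply, invertedSol]⟩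

/-- Near each `y₀`, either `ψ` itself or its image under the inversion is a listed function. -/
theorem exists_symmetry (h : IsNormalForm D I Ω β F L ψ) {y₀ : ℝ} (hy₀ : y₀ ∈ I) {z₀ : ℂ}
    (hz₀ : z₀ ∈ Ω) :
    ∃ J : Set ℝ, IsOpen J ∧ J.OrdConnected ∧ y₀ ∈ J ∧ J ⊆ I ∧
      ∃ (Φ : OpenPartialHomeomorph (ℂ × ℂ × ℝ) (ℂ × ℂ × ℝ)) (D' : Set (ℂ × ℂ))
        (ψ' : ℂ × ℂ → ℝ),
        IsHCMASymmetry Φ ∧ IsListed D' ψ' ∧ Transforms Φ ψ {p ∈ D | p.1.im ∈ J} ψ' D' := by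
  -- If `F_yz` vanishes at the point, its inverted counterpart there equals `-2i z₀ ≠ 0`. So one of
  -- the two functions always satisfies the hypothesis of `exists_isListed`.
  by_cases hne : dy (dz (liftF F)) (⟨0, y₀⟩, z₀) = 0
  · have hw₀ : z₀⁻¹ ∈ (fun w : ℂ => w⁻¹) ⁻¹' Ω := by simpa using hz₀
    have hm : ((⟨0, y₀⟩ : ℂ), (z₀⁻¹)⁻¹) ∈ cylinder Ω I := ⟨hw₀, hy₀⟩
    have h0 := ne_zero_of_re_pos (h.domain.re_pos _ hz₀)
    obtain ⟨J, hJ, hJ', hyJ, hJI, hl⟩ := h.invert.exists_isListed hy₀ hw₀ (by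
      rw [(derivs_invertedF h.domain.isOpen_Ω h.domain.isOpen_I h.domain.re_pos h.contDiffOn_F
        (p := (⟨0, y₀⟩, z₀⁻¹)) hm).1]
      simp only [inv_inv]
      simp [hne, h0])
    exact ⟨J, hJ, hJ', hyJ, hJI, _, _, _, isHCMASymmetry_inversion, hl, h.transforms_inversion J⟩
  · obtain ⟨J, hJ, hJ', hyJ, hJI, hl⟩ := h.exists_isListed hy₀ hz₀ hne
    exact ⟨J, hJ, hJ', hyJ, hJI, _, _, _, isHCMASymmetry_refl, hl, transforms_refl _ _⟩

end IsNormalForm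

/-- Over an empty `Ω` the domain is empty, and invariance under `∂_x` would hold vacuously. -/
theorem IsNoninvariant.nonempty {D : Set (ℂ × ℂ)} {I : Set ℝ} {Ω : Set ℂ} {ψ : ℂ × ℂ → ℝ}
    (hN : IsNoninvariant ψ D Ω) (hD : IsDomainOver D I Ω) : Ω.Nonempty := by
  by_contra hΩ
  have h1 := (hN 1 0 0 (differentiableOn_const 0) fun p hp =>
    absurd ⟨p.2, (hD.proj_mem p hp).2⟩ hΩ).1
  exact one_ne_zero h1

end BFLift

end

/-- Every listed function is a solution of the Boyer–Finley equation of the given form that also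
solves the Legendre transformed hyperbolic complex Monge–Ampère equation; conversely, near each
value of the parameter `y`, every noninvariant solution of the Boyer–Finley equation of the given
form that also solves the latter equation is taken to a listed function by a symmetry
transformation of the latter equation. -/
theorem theorem1 :
    (∀ (D : Set (ℂ × ℂ)) (ψ : ℂ × ℂ → ℝ), BFLift.IsListed D ψ →
      (∃ (I : Set ℝ) (Ω : Set ℂ) (b : ℂ → ℝ → ℂ) (F : ℂ → ℝ → ℝ) (L : ℂ × ℂ → ℂ),
        BFLift.IsAnsatz D I Ω b F L ψ) ∧
      BFLift.IsBFSolution ψ D ∧ BFLift.IsHCMASolution ψ D) ∧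
    (∀ (D : Set (ℂ × ℂ)) (I : Set ℝ) (Ω : Set ℂ) (b : ℂ → ℝ → ℂ) (F : ℂ → ℝ → ℝ)
      (L : ℂ × ℂ → ℂ) (ψ : ℂ × ℂ → ℝ),
      BFLift.IsAnsatz D I Ω b F L ψ → BFLift.IsBFSolution ψ D →
      BFLift.IsNoninvariant ψ D Ω → BFLift.IsHCMASolution ψ D →
      ∀ y₀ ∈ I, ∃ J : Set ℝ, IsOpen J ∧ J.OrdConnected ∧ y₀ ∈ J ∧ J ⊆ I ∧
        ∃ (Φ : OpenPartialHomeomorph (ℂ × ℂ × ℝ) (ℂ × ℂ × ℝ)) (D' : Set (ℂ × ℂ))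
          (ψ' : ℂ × ℂ → ℝ),
          BFLift.IsHCMASymmetry Φ ∧ BFLift.IsListed D' ψ' ∧
          BFLift.Transforms Φ ψ {p ∈ D | p.1.im ∈ J} ψ' D') := by
  refine ⟨fun D ψ h => BFLift.isSolution_of_isListed h,
    fun D I Ω b F L ψ h hBF hN hH y₀ hy₀ => ?_⟩
  obtain ⟨z₀, hz₀⟩ := hN.nonempty h.domain
  exact (BFLift.isNormalForm_of_isAnsatz h hBF hN hH hy₀).exists_symmetry hy₀ hz₀
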